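/- Let $d\ge 1$, let $c,a:\mathbb R^d\to\mathbb R$ be smooth with $c$ bounded between two positive constants and $a\ge 0$, let $\Omega\subset\mathbb R^d$ be a bounded open set with Lipschitz boundary, let $T>0$, and put $c_+=\sup_{x\in\mathbb R^d}c(x)$. For $g\in L^2([0,T];H^{1/2}(\partial\Omega))\cap H^1([0,T];H^{-1/2}(\partial\Omega))$ consider the problem $$\big[c^{-2}\partial_{tt}+a\,\partial_t-\Delta\big]q=0\ \text{ in }(\mathbb R^d\setminus\partial\Omega)\times(0,T),\qquad q(0)=0,\ q_t(0)=0,\qquad [q]=0,\ \Big[\frac{\partial q}{\partial\nu}\Big]=g\ \text{ on }\partial\Omega,$$ where $[\cdot]$ denotes the jump across $\partial\Omega$. A weak solution is a function $q\in L^2([0,T];H^1(\mathbb R^d))$ with $q'\in L^2([0,T];L^2(\mathbb R^d))$ and $q''\in L^2([0,T];H^{-1}(\mathbb R^d))$ such that $q(0)=0$, $q_t(0)=0$ (for the continuous representatives of $q$ in $L^2(\mathbb R^d)$ and of $q_t$ in $H^{-1}(\mathbb R^d)$) and, for every $\phi\in H^1(\mathbb R^d)$ and almost every $t\in[0,T]$,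 $$\langle c^{-2}q_{tt}(t),\phi\rangle+\int_{\mathbb R^d}a\,q_t(t)\,\phi\,dx+\int_{\mathbb R^d}\nabla q(t)\cdot\nabla\phi\,dx=-\int_{\partial\Omega}g(t)\,\phi\,d\sigma .$$ Here it is part of the definition that $a\,q_t(t)\,\phi$ is integrable and that $c^{-2}q_{tt}(t)$ belongs to $H^{-1}(\mathbb R^d)$ for almost every $t$; on $\partial\Omega$, $\phi$ denotes the trace and $\sigma$ the surface measure. Then there is a constant $C$, depending only on $d,c,a,\Omega,T$, such that for every such $g$ the problem has a unique weak solution $q$, and moreover: (i) (finite speed of propagation) for every $t\in[0,T]$, the continuous representative of $q$ in $L^2(\mathbb R^d)$ satisfies $q(x,t)=0$ for almost every $x\in\mathbb R^d\setminus\Omega$ with $\operatorname{dist}(x,\partial\Omega)\ge c_+t$; (ii) $$\int_0^T\Big[\int_{\mathbb R^d}c^{-2}(x)\,q_t(x,t)^2\,dx+\|q(t)\|_{H^1(\mathbb R^d)}^2\Big]dt\ \le\ C\,\|g\|^2_{H^1([0,T];H^{-1/2}(\partial\Omega))},$$ where $\|g\|^2_{H^1([0,T];H^{-1/2}(\partial\Omega))}=\int_0^T\big[\|g(t)\|^2_{H^{-1/2}(\partial\Omega)}+\|g'(t)\|^2_{H^{-1/2}(\partial\Omega)}\big]dt$.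 -/

import Mathlib

open MeasureTheory Filter Topology
open scoped ContDiff Gradient

noncomputable section

namespace DampedWave

/-- Euclidean space `ℝ^d`. -/
abbrev Space (d : ℕ) : Type := EuclideanSpace ℝ (Fin d)

/-! ### The Sobolev spaces `H^1(ℝ^d)` and `H^{-1}(ℝ^d)` -/

/-- `G` is the weak gradient of `u`. -/
def IsWeakGradient {d : ℕ} (u : Lp ℝ 2 (volume : Measure (Space d)))
    (G : Lp (Space d) 2 (volume : Measure (Space d))) : Prop :=
  ∀ φ : Space d → ℝ, ContDiff ℝ ∞ φ → HasCompactSupport φ →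
    ∫ x, u x • ∇ φ x = -∫ x, φ x • G x

theorem continuous_gradient {d : ℕ} {φ : Space d → ℝ} (h : ContDiff ℝ ∞ φ) :
    Continuous (∇ φ) :=
  (InnerProductSpace.toDual ℝ (Space d)).symm.continuous.comp
    (h.continuous_fderiv (by simp))

theorem hasCompactSupport_gradient {d : ℕ} {φ : Space d → ℝ} (h : HasCompactSupport φ) :
    HasCompactSupport (∇ φ) :=
  (h.fderiv (𝕜 := ℝ)).comp_left (map_zero (InnerProductSpace.toDual ℝ (Space d)).symm)

theorem integrable_smul_gradient {d : ℕ} (u : Lp ℝ 2 (volume : Measure (Space d)))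
    {φ : Space d → ℝ} (h : ContDiff ℝ ∞ φ) (h' : HasCompactSupport φ) :
    Integrable (fun x => u x • ∇ φ x) :=
  memLp_one_iff_integrable.1 <|
    ((continuous_gradient h).memLp_of_hasCompactSupport (p := 2)
      (hasCompactSupport_gradient h')).smul (p := 2) (q := 2) (r := 1) (Lp.memLp u)

theorem integrable_test_smul {d : ℕ} (G : Lp (Space d) 2 (volume : Measure (Space d)))
    {φ : Space d → ℝ} (h : ContDiff ℝ ∞ φ) (h' : HasCompactSupport φ) :
    Integrable (fun x => φ x • G x) :=
  memLp_one_iff_integrable.1 <|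
    (Lp.memLp G).smul (p := 2) (q := 2) (r := 1)
      (h.continuous.memLp_of_hasCompactSupport (p := 2) h')

/-- `H^1(ℝ^d)`, realised as the space of pairs `(u, ∇u)` in `L² × L²` with the Hilbert norm
`‖u‖² + ‖∇u‖²`. -/
def sobolevOne (d : ℕ) :
    Submodule ℝ (WithLp 2 (Lp ℝ 2 (volume : Measure (Space d)) ×
      Lp (Space d) 2 (volume : Measure (Space d)))) where
  carrier := {w | IsWeakGradient w.fst w.snd}
  zero_mem' := by
    intro φ _ _
    have h1 : ∀ᵐ x : Space d, ((0 : Lp ℝ 2 (volume : Measure (Space d))) x) • ∇ φ x = 0 := by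
      filter_upwards [Lp.coeFn_zero ℝ 2 (volume : Measure (Space d))] with x hx
      rw [hx, Pi.zero_apply, zero_smul]
    have h2 : ∀ᵐ x : Space d,
        φ x • ((0 : Lp (Space d) 2 (volume : Measure (Space d))) x) = 0 := by
      filter_upwards [Lp.coeFn_zero (Space d) 2 (volume : Measure (Space d))] with x hx
      rw [hx, Pi.zero_apply, smul_zero]
    change ∫ x, ((0 : Lp ℝ 2 (volume : Measure (Space d))) x) • ∇ φ x
      = -∫ x, φ x • ((0 : Lp (Space d) 2 (volume : Measure (Space d))) x)
    rw [integral_congr_ae h1, integral_congr_ae h2]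
    simp
  add_mem' := by
    intro v w hv hw φ h h'
    have h1 : ∀ᵐ x : Space d, ((v.fst + w.fst : Lp ℝ 2 (volume : Measure (Space d))) x) • ∇ φ x
        = v.fst x • ∇ φ x + w.fst x • ∇ φ x := by
      filter_upwards [Lp.coeFn_add v.fst w.fst] with x hx
      rw [hx, Pi.add_apply, add_smul]
    have h2 : ∀ᵐ x : Space d,
        φ x • ((v.snd + w.snd : Lp (Space d) 2 (volume : Measure (Space d))) x)
        = φ x • v.snd x + φ x • w.snd x := by
      filter_upwards [Lp.coeFn_add v.snd w.snd] with x hx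
      rw [hx, Pi.add_apply, smul_add]
    change ∫ x, ((v.fst + w.fst : Lp ℝ 2 (volume : Measure (Space d))) x) • ∇ φ x
      = -∫ x, φ x • ((v.snd + w.snd : Lp (Space d) 2 (volume : Measure (Space d))) x)
    rw [integral_congr_ae h1, integral_congr_ae h2,
      integral_add (integrable_smul_gradient _ h h') (integrable_smul_gradient _ h h'),
      integral_add (integrable_test_smul _ h h') (integrable_test_smul _ h h'),
      hv φ h h', hw φ h h', neg_add]
  smul_mem' := by
    intro r w hw φ h h'
    have h1 : ∀ᵐ x : Space d, ((r • w.fst : Lp ℝ 2 (volume : Measure (Space d))) x) • ∇ φ x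
        = r • (w.fst x • ∇ φ x) := by
      filter_upwards [Lp.coeFn_smul r w.fst] with x hx
      rw [hx, Pi.smul_apply, smul_assoc]
    have h2 : ∀ᵐ x : Space d,
        φ x • ((r • w.snd : Lp (Space d) 2 (volume : Measure (Space d))) x)
        = r • (φ x • w.snd x) := by
      filter_upwards [Lp.coeFn_smul r w.snd] with x hx
      rw [hx, Pi.smul_apply, smul_comm]
    change ∫ x, ((r • w.fst : Lp ℝ 2 (volume : Measure (Space d))) x) • ∇ φ x
      = -∫ x, φ x • ((r • w.snd : Lp (Space d) 2 (volume : Measure (Space d))) x)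
    rw [integral_congr_ae h1, integral_congr_ae h2, integral_smul, integral_smul,
      hw φ h h', smul_neg]

/-- The Hilbert space `H^1(ℝ^d)`. -/
abbrev H1 (d : ℕ) : Type := sobolevOne d

/-- The inclusion `H^1(ℝ^d) → L²(ℝ^d)`. -/
def H1.toL2 (d : ℕ) : H1 d →L[ℝ] Lp ℝ 2 (volume : Measure (Space d)) :=
  (WithLp.fstL 2 ℝ _ _).comp (sobolevOne d).subtypeL

/-- The weak gradient `H^1(ℝ^d) → L²(ℝ^d; ℝ^d)`. -/
def H1.grad (d : ℕ) : H1 d →L[ℝ] Lp (Space d) 2 (volume : Measure (Space d)) :=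
  (WithLp.sndL 2 ℝ _ _).comp (sobolevOne d).subtypeL

/-- `H^{-1}(ℝ^d)`, the dual of `H^1(ℝ^d)`. -/
abbrev HNegOne (d : ℕ) : Type := StrongDual ℝ (H1 d)

/-- The inclusion of `L²(ℝ^d)` in `H^{-1}(ℝ^d)`: `v ↦ (φ ↦ ∫ v φ)`. -/
def L2.toHNegOne {d : ℕ} (v : Lp ℝ 2 (volume : Measure (Space d))) : HNegOne d :=
  (innerSL ℝ v).comp (H1.toL2 d)

/-! ### The boundary: surface measure, traces, `H^{1/2}` and `H^{-1/2}` -/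

/-- `∂Ω` is Lipschitz: near every boundary point, in the direction of some unit vector `e`,
`Ω` is the region strictly above the graph of a Lipschitz function of the components
orthogonal to `e`. -/
def HasLipschitzBoundary {d : ℕ} (Ω : Set (Space d)) : Prop :=
  ∀ x₀ ∈ frontier Ω, ∃ (e : Space d) (r : ℝ) (K : NNReal) (γ : Space d → ℝ),
    ‖e‖ = 1 ∧ 0 < r ∧ LipschitzWith K γ ∧
    ∀ x ∈ Metric.ball x₀ r, x ∈ Ω ↔ γ (x - inner ℝ x e • e) < inner ℝ x e

/-- The surface measure on `∂Ω`: the `(d-1)`-dimensional Hausdorff measure, normalised to agree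
with Lebesgue measure on hyperplanes. -/
def surfaceMeasure {d : ℕ} (Ω : Set (Space d)) : Measure (Space d) :=
  (Measure.euclideanHausdorffMeasure (d - 1) : Measure (Space d)).restrict (frontier Ω)

/-- `L²(∂Ω)`. -/
abbrev L2Boundary {d : ℕ} (Ω : Set (Space d)) : Type := Lp ℝ 2 (surfaceMeasure Ω)

/-- `f ∈ L²(∂Ω)` is the trace on `∂Ω` of `u ∈ H^1(ℝ^d)`: there are test functions that converge
to `u` in `H^1(ℝ^d)` and whose restrictions to `∂Ω` converge to `f` in `L²(∂Ω)`. -/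
def IsTrace {d : ℕ} (Ω : Set (Space d)) (u : H1 d) (f : L2Boundary Ω) : Prop :=
  ∃ φ : ℕ → Space d → ℝ,
    (∀ n, ContDiff ℝ ∞ (φ n) ∧ HasCompactSupport (φ n)) ∧
    Tendsto (fun n => eLpNorm (fun x => φ n x - H1.toL2 d u x) 2 volume) atTop (𝓝 0) ∧
    Tendsto (fun n => eLpNorm (fun x => ∇ (φ n) x - H1.grad d u x) 2 volume) atTop (𝓝 0) ∧
    Tendsto (fun n => eLpNorm (fun y => φ n y - f y) 2 (surfaceMeasure Ω)) atTop (𝓝 0)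

/-- `H^{1/2}(∂Ω)` in the Sobolev–Slobodeckij form: the pairs `(f, D)` with `f ∈ L²(∂Ω)` and
`D(x,y) = (f(x) - f(y)) / |x - y|^{d/2}` in `L²(∂Ω × ∂Ω)`, with the Hilbert norm
`‖f‖² + ∬ |f(x) - f(y)|² / |x - y|^d`. -/
def sobolevHalf {d : ℕ} (Ω : Set (Space d)) :
    Submodule ℝ (WithLp 2 (L2Boundary Ω ×
      Lp ℝ 2 ((surfaceMeasure Ω).prod (surfaceMeasure Ω)))) where
  carrier := {w | ∃ f : Space d → ℝ, w.fst =ᵐ[surfaceMeasure Ω] f ∧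
    w.snd =ᵐ[(surfaceMeasure Ω).prod (surfaceMeasure Ω)]
      fun p => (f p.1 - f p.2) / ‖p.1 - p.2‖ ^ ((d : ℝ) / 2)}
  zero_mem' := by
    refine ⟨fun _ => 0, Lp.coeFn_zero ℝ 2 _, ?_⟩
    refine (Lp.coeFn_zero ℝ 2 ((surfaceMeasure Ω).prod (surfaceMeasure Ω))).trans ?_
    exact Eventually.of_forall fun p => by simp
  add_mem' := by
    rintro v w ⟨f, hf, hf'⟩ ⟨g, hg, hg'⟩
    refine ⟨f + g, (Lp.coeFn_add v.fst w.fst).trans (hf.add hg),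
      (Lp.coeFn_add v.snd w.snd).trans ((hf'.add hg').trans ?_)⟩
    exact Eventually.of_forall fun p => by
      simp only [Pi.add_apply]
      ring
  smul_mem' := by
    rintro r w ⟨f, hf, hf'⟩
    refine ⟨r • f, (Lp.coeFn_smul r w.fst).trans (hf.const_smul r),
      (Lp.coeFn_smul r w.snd).trans ((hf'.const_smul r).trans ?_)⟩
    exact Eventually.of_forall fun p => by
      simp only [Pi.smul_apply, smul_eq_mul]
      ring

/-- The Hilbert space `H^{1/2}(∂Ω)`. -/
abbrev HHalf {d : ℕ} (Ω : Set (Space d)) : Type := sobolevHalf Ω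

/-- The inclusion `H^{1/2}(∂Ω) → L²(∂Ω)`. -/
def HHalf.toL2 {d : ℕ} (Ω : Set (Space d)) : HHalf Ω →L[ℝ] L2Boundary Ω :=
  (WithLp.fstL 2 ℝ _ _).comp (sobolevHalf Ω).subtypeL

/-- `H^{-1/2}(∂Ω)`, the dual of `H^{1/2}(∂Ω)`. -/
abbrev HNegHalf {d : ℕ} (Ω : Set (Space d)) : Type := StrongDual ℝ (HHalf Ω)

/-- The inclusion of `H^{1/2}(∂Ω)` in `H^{-1/2}(∂Ω)`: `g ↦ (ψ ↦ ∫_{∂Ω} g ψ)`. -/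
def HHalf.toHNegHalf {d : ℕ} {Ω : Set (Space d)} (g : HHalf Ω) : HNegHalf Ω :=
  (innerSL ℝ (HHalf.toL2 Ω g)).comp (HHalf.toL2 Ω)

/-! ### Functions of time with values in a normed space -/

/-- Lebesgue measure on `[0,T]`. -/
def timeMeasure (T : ℝ) : Measure ℝ := volume.restrict (Set.Icc 0 T)

/-- `v` is the weak derivative of `u` on `(0,T)`. -/
def IsWeakTimeDeriv {V : Type*} [NormedAddCommGroup V] [NormedSpace ℝ V] (T : ℝ)
    (u v : ℝ → V) : Prop :=
  ∀ η : ℝ → ℝ, ContDiff ℝ ∞ η → HasCompactSupport η → tsupport η ⊆ Set.Ioo 0 T →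
    ∫ t, deriv η t • u t ∂(timeMeasure T) = -∫ t, η t • v t ∂(timeMeasure T)

/-- `w` is the continuous representative on `[0,T]` of `u`. -/
def IsContinuousRep {V : Type*} [NormedAddCommGroup V] (T : ℝ) (u w : ℝ → V) : Prop :=
  ContinuousOn w (Set.Icc 0 T) ∧ u =ᵐ[timeMeasure T] w

/-- `u(0) = 0`, in the sense of the continuous representative. -/
def VanishesAtZero {V : Type*} [NormedAddCommGroup V] (T : ℝ) (u : ℝ → V) : Prop :=
  ∃ w : ℝ → V, IsContinuousRep T u w ∧ w 0 = 0

/-- `g ∈ L²([0,T]; H^{1/2}(∂Ω)) ∩ H^1([0,T]; H^{-1/2}(∂Ω))`, with time derivative `gt`. -/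
structure IsJumpDatum {d : ℕ} (Ω : Set (Space d)) (T : ℝ) (g : ℝ → HHalf Ω)
    (gt : ℝ → HNegHalf Ω) : Prop where
  memLp : MemLp g 2 (timeMeasure T)
  memLp_deriv : MemLp gt 2 (timeMeasure T)
  deriv : IsWeakTimeDeriv T (fun t => (g t).toHNegHalf) gt

/-! ### Weak solutions -/

/-- `W = c⁻² F` in `H^{-1}(ℝ^d)`, i.e. `W(φ) = F(c⁻² φ)` whenever `φ` and `c⁻² φ` are in `H^1`
(for instance for test functions, which determine `W`). -/
def IsWeightedFunctional {d : ℕ} (c : Space d → ℝ) (F W : HNegOne d) : Prop :=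
  ∀ φ ψ : H1 d, (∀ᵐ x : Space d, H1.toL2 d ψ x = (c x ^ 2)⁻¹ * H1.toL2 d φ x) → W φ = F ψ

/-- `q`, with `q' = qt` and `q'' = qtt`, is a weak solution on `[0,T]` of
`c⁻² q'' + a q' - Δ q = 0` off `∂Ω`, `q(0) = q'(0) = 0`, `[q] = 0`, `[∂q/∂ν] = g`. -/
structure IsWeakSolution {d : ℕ} (c a : Space d → ℝ) (Ω : Set (Space d)) (T : ℝ)
    (g : ℝ → HHalf Ω) (q : ℝ → H1 d) (qt : ℝ → Lp ℝ 2 (volume : Measure (Space d)))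
    (qtt : ℝ → HNegOne d) : Prop where
  memLp : MemLp q 2 (timeMeasure T)
  memLp_deriv : MemLp qt 2 (timeMeasure T)
  memLp_deriv_deriv : MemLp qtt 2 (timeMeasure T)
  deriv : IsWeakTimeDeriv T (fun t => H1.toL2 d (q t)) qt
  deriv_deriv : IsWeakTimeDeriv T (fun t => L2.toHNegOne (qt t)) qtt
  initial : VanishesAtZero T (fun t => H1.toL2 d (q t))
  initial_deriv : VanishesAtZero T (fun t => L2.toHNegOne (qt t))
  equation : ∃ W : ℝ → HNegOne d,
    (∀ᵐ t ∂(timeMeasure T), IsWeightedFunctional c (qtt t) (W t)) ∧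
    ∀ φ : H1 d, ∃ f : L2Boundary Ω, IsTrace Ω φ f ∧
      ∀ᵐ t ∂(timeMeasure T),
        Integrable (fun x => a x * qt t x * H1.toL2 d φ x) ∧
        W t φ + (∫ x, a x * qt t x * H1.toL2 d φ x)
            + (∫ x, inner ℝ (H1.grad d (q t) x) (H1.grad d φ x))
          = -∫ y, HHalf.toL2 Ω (g t) y * f y ∂(surfaceMeasure Ω)

end DampedWave

end

/-!
The proof has three ingredients: a trace theorem, Lions' projection theorem for existence, and a
local energy estimate in backward cones for everything else.

*Traces.* The trace operator `H^1(ℝ^d) → H^{1/2}(∂Ω)` (`exists_trace`) extends the restriction of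
test functions, which are dense in `H^1` (`denseRange_ofTest`). Over a Lipschitz graph the bound is
obtained by joining two boundary points by the two legs of a tent above the graph. Averaging over
the height of the apex turns the line integrals of `∇φ` along the legs into volume integrals, and
the kernel `‖h‖⁻ᵈ` of the Slobodeckij seminorm is just integrable enough
(`lintegral_lintegral_tent_le`, `lintegral_graph_seminorm_le`). Compactness of `∂Ω` reduces the
general case to graphs, because points that are not close do not matter for the seminorm. Only an
upper bound for the surface measure by Lebesgue measure on the hyperplane is used. The jump `g`
then acts on `H^1` as the load `φ ↦ -⟨g, φ|_∂Ω⟩`, and its `H^{-1}` norm is bounded by the `H^{-1/2}`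
norm of `g`.

*The integrated equation.* A weak solution vanishes initially together with its first derivative,
so the equation may be integrated once in time: `c⁻² q' + a q - div ∫₀ᵗ ∇q = ∫₀ᵗ f`
(`IsIntegratedWave`, `IsWeakSolution.isIntegratedWave`). This equation may be tested with `χ q`,
whereas `χ q'` is no admissible test function in the original one. If `χ(t)` is a cut-off of the
section at time `t` of a backward cone of slope `κ = sup c` over a ball that the source does not
meet, the local energy `∫ χ (c⁻² q² + |∫₀ᵗ ∇q|²)` does not increase, because the time derivative of
`χ` dominates its gradient (`cone_flux_nonpos`). Hence `q = 0` in the cone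
(`scalarMul_coneCutoff_eq_zero`, `IsIntegratedWave.ae_eq_zero_of_ball`). Applied to all small cones
off `∂Ω` this is the finite speed of propagation, up to the borderline case
`dist(x, ∂Ω) = κ t`, which follows by continuity in time (`IsIntegratedWave.ae_eq_zero_of_le`);
applied to the difference of two solutions it is uniqueness (`IsWeakSolution.unique`).

*Existence.* For bounded damping, a solution of the integrated equation comes from Lions'
projection theorem (`exists_mem_inner_eq`): the variational form is coercive along
`φ' = e^{2t} θ` for test functions `θ` (`lions_coercive`). The load is continuous for the same
energy after an integration by parts in time, which is where one time derivative of `g` in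
`H^{-1/2}` is spent (`abs_load_le`); the resulting bound is the energy estimate
(`exists_abstract_wave`, `exists_wave`). The damping `a` may be unbounded, so it is first
multiplied by a cut-off which equals `1` on a large ball. By finite speed of propagation the wave
does not leave a smaller ball before time `T` (`IsIntegratedWave.mul_cutoff_eq`). It therefore
solves the original problem, and since it is compactly supported, `c⁻² q''` is meaningful without
any bound on the derivatives of `c` (`IsVariationalWave.isWeakSolution`).
-/
noncomputable section

namespace DampedWave

/-! ### Multiplication of `L²` functions by bounded continuous functions -/

section Multiplication

variable {d : ℕ} {E₁ E₂ E₃ : Type*} [NormedAddCommGroup E₁] [NormedSpace ℝ E₁]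
  [NormedAddCommGroup E₂] [NormedSpace ℝ E₂] [NormedAddCommGroup E₃] [NormedSpace ℝ E₃]

theorem memLp_bilin_bcf (B : E₁ →L[ℝ] E₂ →L[ℝ] E₃) (f : BoundedContinuousFunction (Space d) E₁)
    (u : Lp E₂ 2 (volume : Measure (Space d))) : MemLp (fun x => B (f x) (u x)) 2 volume := by
  refine (Lp.memLp u).of_le_mul (c := ‖B‖ * ‖f‖) ?_ ?_
  · exact B.aestronglyMeasurable_comp₂ f.continuous.aestronglyMeasurable
      (Lp.aestronglyMeasurable u)
  · exact Eventually.of_forall fun x => (B.le_opNorm₂ _ _).trans (by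
      gcongr; exact f.norm_coe_le_norm x)

/-- The pointwise product, through a bilinear map `B`, of a bounded continuous function and an
`L²` function. -/
def bcfMul (B : E₁ →L[ℝ] E₂ →L[ℝ] E₃) :
    BoundedContinuousFunction (Space d) E₁ →L[ℝ] Lp E₂ 2 (volume : Measure (Space d)) →L[ℝ] Lp E₃ 2 (volume : Measure (Space d)) :=
  LinearMap.mkContinuous₂
    (LinearMap.mk₂ ℝ (fun f u => (memLp_bilin_bcf B f u).toLp _)
      (fun f g u => by
        rw [← MemLp.toLp_add]
        exact MemLp.toLp_congr _ _ (Eventually.of_forall fun x => by simp))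
      (fun r f u => by
        rw [← MemLp.toLp_const_smul]
        exact MemLp.toLp_congr _ _ (Eventually.of_forall fun x => by simp))
      (fun f u v => by
        rw [← MemLp.toLp_add]
        refine MemLp.toLp_congr _ _ ?_
        filter_upwards [Lp.coeFn_add u v] with x hx
        rw [hx, Pi.add_apply, Pi.add_apply, map_add])
      (fun r f u => by
        rw [← MemLp.toLp_const_smul]
        refine MemLp.toLp_congr _ _ ?_
        filter_upwards [Lp.coeFn_smul r u] with x hx
        rw [hx, Pi.smul_apply, Pi.smul_apply, map_smul]))
    ‖B‖ (fun f u => by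
      refine Lp.norm_le_mul_norm_of_ae_le_mul ?_
      filter_upwards [(memLp_bilin_bcf B f u).coeFn_toLp] with x hx
      simp only [LinearMap.mk₂_apply]
      rw [hx]
      exact (B.le_opNorm₂ _ _).trans (by gcongr; exact f.norm_coe_le_norm x))

theorem coeFn_bcfMul (B : E₁ →L[ℝ] E₂ →L[ℝ] E₃) (f : BoundedContinuousFunction (Space d) E₁)
    (u : Lp E₂ 2 (volume : Measure (Space d))) : bcfMul B f u =ᵐ[volume] fun x => B (f x) (u x) :=
  (memLp_bilin_bcf B f u).coeFn_toLp

/-- Multiplication of an `L²` function by a bounded continuous scalar function. -/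
def scalarMul {E : Type*} [NormedAddCommGroup E] [NormedSpace ℝ E]
    (f : BoundedContinuousFunction (Space d) ℝ) : Lp E 2 (volume : Measure (Space d)) →L[ℝ] Lp E 2 (volume : Measure (Space d)) :=
  bcfMul (ContinuousLinearMap.lsmul ℝ ℝ) f

theorem coeFn_scalarMul {E : Type*} [NormedAddCommGroup E] [NormedSpace ℝ E]
    (f : BoundedContinuousFunction (Space d) ℝ) (u : Lp E 2 (volume : Measure (Space d))) :
    scalarMul f u =ᵐ[volume] fun x => f x • u x :=
  coeFn_bcfMul _ f u

theorem inner_scalarMul {E : Type*} [NormedAddCommGroup E] [InnerProductSpace ℝ E]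
    (f : BoundedContinuousFunction (Space d) ℝ) (u v : Lp E 2 (volume : Measure (Space d))) :
    inner ℝ (scalarMul f u) v = ∫ x, f x * inner ℝ (u x) (v x) := by
  rw [L2.inner_def]
  refine integral_congr_ae ?_
  filter_upwards [coeFn_scalarMul f u] with x hx
  rw [hx, real_inner_smul_left]

theorem inner_scalarMul_right {E : Type*} [NormedAddCommGroup E] [InnerProductSpace ℝ E]
    (f : BoundedContinuousFunction (Space d) ℝ) (u v : Lp E 2 (volume : Measure (Space d))) :
    inner ℝ u (scalarMul f v) = inner ℝ (scalarMul f u) v := by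
  rw [real_inner_comm, inner_scalarMul, inner_scalarMul]
  simp_rw [real_inner_comm]

end Multiplication

/-! ### Test functions and the space `H^1(ℝ^d)` -/

variable {d : ℕ}

/-- The space `C_c^∞(ℝ^d)` of test functions. -/
def testFunctions (d : ℕ) : Submodule ℝ (Space d → ℝ) where
  carrier := {φ | ContDiff ℝ ∞ φ ∧ HasCompactSupport φ}
  zero_mem' := ⟨contDiff_const, HasCompactSupport.zero⟩
  add_mem' := fun ha hb => ⟨ha.1.add hb.1, ha.2.add hb.2⟩
  smul_mem' := fun r _ ha => ⟨contDiff_const.smul ha.1, ha.2.smul_left (f := fun _ => r)⟩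

/-- The type of test functions. -/
abbrev TestFn (d : ℕ) : Type := testFunctions d

instance : CoeFun (testFunctions d) fun _ => Space d → ℝ := ⟨Subtype.val⟩

namespace TestFn

theorem contDiff (φ : TestFn d) : ContDiff ℝ ∞ (φ : Space d → ℝ) := φ.2.1

theorem hasCompactSupport (φ : TestFn d) : HasCompactSupport (φ : Space d → ℝ) := φ.2.2

theorem differentiable (φ : TestFn d) : Differentiable ℝ (φ : Space d → ℝ) :=
  φ.contDiff.differentiable (by simp)

/-- A test function as a bounded continuous function. -/
def bcf (φ : TestFn d) : BoundedContinuousFunction (Space d) ℝ :=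
  BoundedContinuousFunction.ofNormedAddCommGroup φ φ.contDiff.continuous
    (φ.hasCompactSupport.exists_bound_of_continuous φ.contDiff.continuous).choose
    (φ.hasCompactSupport.exists_bound_of_continuous φ.contDiff.continuous).choose_spec

@[simp] theorem bcf_apply (φ : TestFn d) (x : Space d) : φ.bcf x = φ x := rfl

/-- The gradient of a test function as a bounded continuous vector field. -/
def gradBcf (φ : TestFn d) : BoundedContinuousFunction (Space d) (Space d) :=
  BoundedContinuousFunction.ofNormedAddCommGroup (∇ (φ : Space d → ℝ))
    (continuous_gradient φ.contDiff)
    ((hasCompactSupport_gradient φ.hasCompactSupport).exists_bound_of_continuous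
      (continuous_gradient φ.contDiff)).choose
    ((hasCompactSupport_gradient φ.hasCompactSupport).exists_bound_of_continuous
      (continuous_gradient φ.contDiff)).choose_spec

@[simp] theorem gradBcf_apply (φ : TestFn d) (x : Space d) :
    φ.gradBcf x = ∇ φ x := rfl

theorem memLp (φ : TestFn d) (p : ENNReal) (μ : Measure (Space d))
    [IsFiniteMeasureOnCompacts μ] : MemLp (φ : Space d → ℝ) p μ :=
  φ.contDiff.continuous.memLp_of_hasCompactSupport φ.hasCompactSupport

theorem memLp_gradient (φ : TestFn d) (p : ENNReal) (μ : Measure (Space d))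
    [IsFiniteMeasureOnCompacts μ] : MemLp (∇ (φ : Space d → ℝ)) p μ :=
  (continuous_gradient φ.contDiff).memLp_of_hasCompactSupport
    (hasCompactSupport_gradient φ.hasCompactSupport)

/-- The product of two test functions. -/
def mul (φ ψ : TestFn d) : TestFn d :=
  ⟨fun x => φ x * ψ x, φ.contDiff.mul ψ.contDiff,
    φ.hasCompactSupport.mul_right⟩

@[simp] theorem mul_apply (φ ψ : TestFn d) (x : Space d) :
    (φ.mul ψ) x = φ x * ψ x := rfl

end TestFn

theorem inner_gradient {φ : Space d → ℝ} {x : Space d} (v : Space d) :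
    inner ℝ (∇ φ x) v = fderiv ℝ φ x v := by
  simp [gradient]

theorem gradient_mul {φ ψ : Space d → ℝ} {x : Space d} (hφ : DifferentiableAt ℝ φ x)
    (hψ : DifferentiableAt ℝ ψ x) :
    ∇ (fun y => φ y * ψ y) x = φ x • ∇ ψ x + ψ x • ∇ φ x := by
  refine ext_inner_right ℝ fun v => ?_
  rw [inner_gradient, fderiv_fun_mul hφ hψ]
  simp [inner_add_left, real_inner_smul_left]

/-- Integration by parts for test functions, in gradient form. -/
theorem integral_smul_gradient_test (φ ψ : TestFn d) :
    ∫ x, φ x • ∇ ψ x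
      = -∫ x, ψ x • ∇ φ x := by
  have int : ∀ φ ψ : TestFn d,
      Integrable (fun x => φ x • ∇ ψ x) := fun φ ψ =>
    (φ.contDiff.continuous.smul (continuous_gradient ψ.contDiff)).integrable_of_hasCompactSupport
      φ.hasCompactSupport.smul_right
  refine ext_inner_right ℝ fun v => ?_
  rw [inner_neg_left, real_inner_comm, real_inner_comm v, ← integral_inner (int φ ψ),
    ← integral_inner (int ψ φ)]
  have key := integral_mul_fderiv_eq_neg_fderiv_mul_of_integrable (𝕜 := ℝ) (μ := volume)
    (f := (φ : Space d → ℝ)) (g := (ψ : Space d → ℝ)) (v := v)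
    (by
      refine ((int ψ φ).inner_const v).congr (Eventually.of_forall fun x => ?_)
      simp only [real_inner_smul_left, inner_gradient]; ring)
    (by
      refine ((int φ ψ).inner_const v).congr (Eventually.of_forall fun x => ?_)
      simp only [real_inner_smul_left, inner_gradient])
    ((φ.contDiff.continuous.mul ψ.contDiff.continuous).integrable_of_hasCompactSupport
      φ.hasCompactSupport.mul_right)
    (fun x _ => φ.differentiable x) (fun x _ => ψ.differentiable x)
  have h1 : ∀ x, inner ℝ v (φ x • ∇ ψ x)
      = φ x * fderiv ℝ ψ x v := fun x => by
    rw [real_inner_comm, real_inner_smul_left, inner_gradient]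
  have h2 : ∀ x, inner ℝ v (ψ x • ∇ φ x)
      = fderiv ℝ φ x v * ψ x := fun x => by
    rw [real_inner_comm, real_inner_smul_left, inner_gradient, mul_comm]
  simp_rw [h1, h2]
  exact key

namespace H1

/-- An element of `H^1` from a function and its weak gradient. -/
def mk (u : Lp ℝ 2 (volume : Measure (Space d))) (G : Lp (Space d) 2 (volume : Measure (Space d)))
    (h : IsWeakGradient u G) : H1 d := ⟨WithLp.toLp 2 (u, G), h⟩

theorem isWeakGradient (u : H1 d) : IsWeakGradient (toL2 d u) (grad d u) := u.2

theorem inner_eq (u v : H1 d) :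
    inner ℝ u v = inner ℝ (toL2 d u) (toL2 d v) + inner ℝ (grad d u) (grad d v) := rfl

theorem norm_sq_eq (u : H1 d) : ‖u‖ ^ 2 = ‖toL2 d u‖ ^ 2 + ‖grad d u‖ ^ 2 := by
  rw [← real_inner_self_eq_norm_sq, inner_eq, real_inner_self_eq_norm_sq,
    real_inner_self_eq_norm_sq]

theorem ext_of_toL2_grad {u v : H1 d} (h : toL2 d u = toL2 d v) (h' : grad d u = grad d v) :
    u = v := by
  rw [← sub_eq_zero, ← norm_eq_zero, ← sq_eq_zero_iff, norm_sq_eq, map_sub, map_sub, h, h']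
  simp

theorem locallyIntegrable_grad (u : Lp (Space d) 2 (volume : Measure (Space d))) :
    LocallyIntegrable u volume :=
  (Lp.memLp u).locallyIntegrable (by norm_num)

/-- The weak gradient is determined by the function, so equations in `H^1` may be checked in `L²`.
-/
theorem toL2_injective : Function.Injective (toL2 d) := by
  refine (injective_iff_map_eq_zero (toL2 d)).2 fun u hu => ?_
  refine ext_of_toL2_grad (by rw [hu, map_zero]) ?_
  rw [map_zero]
  refine Lp.ext ?_
  have := ae_eq_zero_of_integral_contDiff_smul_eq_zero (locallyIntegrable_grad (grad d u))
    (fun φ h h' => by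
      have h0 := u.isWeakGradient φ h h'
      rw [hu] at h0
      rw [← neg_eq_zero, ← h0]
      refine integral_eq_zero_of_ae ?_
      filter_upwards [Lp.coeFn_zero ℝ 2 (volume : Measure (Space d))] with x hx
      rw [hx, Pi.zero_apply, zero_smul, Pi.zero_apply])
  filter_upwards [this, Lp.coeFn_zero (Space d) 2 (volume : Measure (Space d))] with x hx hx'
  rw [hx, hx', Pi.zero_apply]

theorem isWeakGradient_test (φ : TestFn d) :
    IsWeakGradient ((φ.memLp 2 volume).toLp _) ((φ.memLp_gradient 2 volume).toLp _) := by
  intro ψ h h'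
  have h1 : ∀ᵐ x, (φ.memLp 2 volume).toLp _ x • ∇ ψ x = φ x • ∇ ψ x := by
    filter_upwards [(φ.memLp 2 volume).coeFn_toLp] with x hx
    rw [hx]
  have h2 : ∀ᵐ x, ψ x • (φ.memLp_gradient 2 volume).toLp _ x = ψ x • ∇ (φ : Space d → ℝ) x := by
    filter_upwards [(φ.memLp_gradient 2 volume).coeFn_toLp] with x hx
    rw [hx]
  rw [integral_congr_ae h1, integral_congr_ae h2]
  exact integral_smul_gradient_test φ ⟨ψ, h, h'⟩

/-- A test function as an element of `H^1`. -/
def ofTest : TestFn d →ₗ[ℝ] H1 d where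
  toFun φ := mk _ _ (isWeakGradient_test φ)
  map_add' _ _ := toL2_injective rfl
  map_smul' _ _ := toL2_injective rfl

theorem coeFn_toL2_ofTest (φ : TestFn d) :
    toL2 d (ofTest φ) =ᵐ[volume] (φ : Space d → ℝ) :=
  (φ.memLp 2 volume).coeFn_toLp

theorem coeFn_grad_ofTest (φ : TestFn d) :
    grad d (ofTest φ) =ᵐ[volume] ∇ (φ : Space d → ℝ) :=
  (φ.memLp_gradient 2 volume).coeFn_toLp

/-- The map `v ↦ v ∇χ` on `L²`, for a test function `χ`. -/
def mulGrad (χ : TestFn d) : Lp ℝ 2 (volume : Measure (Space d)) →L[ℝ]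
    Lp (Space d) 2 (volume : Measure (Space d)) :=
  bcfMul (ContinuousLinearMap.lsmul ℝ ℝ).flip χ.gradBcf

theorem coeFn_mulGrad (χ : TestFn d) (v : Lp ℝ 2 (volume : Measure (Space d))) :
    mulGrad χ v =ᵐ[volume] fun x => v x • ∇ (χ : Space d → ℝ) x :=
  coeFn_bcfMul _ χ.gradBcf v

set_option maxHeartbeats 1000000 in
/-- The product rule for the product of a test function and an element of `H^1`. -/
theorem isWeakGradient_mul (χ : TestFn d) (u : H1 d) :
    IsWeakGradient (scalarMul χ.bcf (toL2 d u))
      (scalarMul χ.bcf (grad d u) + mulGrad χ (toL2 d u)) := by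
  intro ψ h h'
  have key := u.isWeakGradient _ (χ.mul ⟨ψ, h, h'⟩).contDiff (χ.mul ⟨ψ, h, h'⟩).hasCompactSupport
  have e1 : ∀ᵐ x, toL2 d u x • ∇ (χ.mul ⟨ψ, h, h'⟩ : Space d → ℝ) x
      = (scalarMul χ.bcf (toL2 d u)) x • ∇ ψ x + ψ x • (mulGrad χ (toL2 d u)) x := by
    filter_upwards [coeFn_scalarMul χ.bcf (toL2 d u), coeFn_mulGrad χ (toL2 d u)] with x hx hx'
    have hg : ∇ (χ.mul ⟨ψ, h, h'⟩ : Space d → ℝ) x = χ x • ∇ ψ x + ψ x • ∇ (χ : Space d → ℝ) x :=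
      gradient_mul (χ.differentiable x) (h.differentiable (by simp) x)
    rw [hx, hx', hg, TestFn.bcf_apply, smul_add, smul_smul, smul_smul, smul_eq_mul, smul_smul,
      mul_comm (χ x), mul_comm (ψ x)]
  have e2 : ∀ᵐ x, (χ.mul ⟨ψ, h, h'⟩) x • grad d u x = ψ x • (scalarMul χ.bcf (grad d u)) x := by
    filter_upwards [coeFn_scalarMul χ.bcf (grad d u)] with x hx
    rw [hx, smul_smul]
    exact congrArg (· • _) (mul_comm (χ x) (ψ x))
  have e3 : ∀ᵐ x, ψ x • (scalarMul χ.bcf (grad d u) + mulGrad χ (toL2 d u)) x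
      = ψ x • (scalarMul χ.bcf (grad d u)) x + ψ x • (mulGrad χ (toL2 d u)) x := by
    filter_upwards [Lp.coeFn_add (scalarMul χ.bcf (grad d u)) (mulGrad χ (toL2 d u))] with x hx
    rw [hx, Pi.add_apply, smul_add]
  rw [integral_congr_ae e1, integral_congr_ae e2,
    integral_add (integrable_smul_gradient _ h h') (integrable_test_smul _ h h')] at key
  rw [integral_congr_ae e3, integral_add (integrable_test_smul _ h h')
    (integrable_test_smul _ h h'), neg_add, ← key]
  abel

/-- Multiplication by a test function, as a bounded operator on `H^1`. -/
def mul (χ : TestFn d) : H1 d →L[ℝ] H1 d where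
  toFun u := mk _ _ (isWeakGradient_mul χ u)
  map_add' u v := toL2_injective (by
    change scalarMul χ.bcf (toL2 d (u + v)) = scalarMul χ.bcf (toL2 d u) + scalarMul χ.bcf (toL2 d v)
    rw [map_add, map_add])
  map_smul' r u := toL2_injective (by
    change scalarMul χ.bcf (toL2 d (r • u)) = r • scalarMul χ.bcf (toL2 d u)
    rw [map_smul, map_smul])
  cont := by
    refine Continuous.subtype_mk ?_ _
    refine (WithLp.prod_continuous_toLp 2 _ _).comp (Continuous.prodMk ?_ ?_)
    · exact (scalarMul χ.bcf ∘L toL2 d).continuous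
    · exact (scalarMul χ.bcf ∘L grad d + mulGrad χ ∘L toL2 d).continuous

theorem toL2_mul (χ : TestFn d) (u : H1 d) : toL2 d (mul χ u) = scalarMul χ.bcf (toL2 d u) := rfl

theorem grad_mul (χ : TestFn d) (u : H1 d) :
    grad d (mul χ u) = scalarMul χ.bcf (grad d u) + mulGrad χ (toL2 d u) := rfl

theorem coeFn_toL2_mul (χ : TestFn d) (u : H1 d) :
    toL2 d (mul χ u) =ᵐ[volume] fun x => χ x * toL2 d u x :=
  coeFn_scalarMul χ.bcf (toL2 d u)

theorem coeFn_grad_mul (χ : TestFn d) (u : H1 d) :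
    grad d (mul χ u) =ᵐ[volume]
      fun x => χ x • grad d u x + toL2 d u x • ∇ (χ : Space d → ℝ) x := by
  rw [grad_mul]
  filter_upwards [Lp.coeFn_add (scalarMul χ.bcf (grad d u)) (mulGrad χ (toL2 d u)),
    coeFn_scalarMul χ.bcf (grad d u), coeFn_mulGrad χ (toL2 d u)] with x h1 h2 h3
  rw [h1, Pi.add_apply, h2, h3, TestFn.bcf_apply]

theorem mul_ofTest (χ φ : TestFn d) : mul χ (ofTest φ) = ofTest (χ.mul φ) := by
  refine toL2_injective (Lp.ext ?_)
  filter_upwards [coeFn_toL2_mul χ (ofTest φ), coeFn_toL2_ofTest φ,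
    coeFn_toL2_ofTest (χ.mul φ)] with x h1 h2 h3
  rw [h1, h2, h3, TestFn.mul_apply]

end H1

/-! ### `L²` estimates with lower integrals -/

theorem eLpNorm_two_sq {α E : Type*} [MeasurableSpace α] [NormedAddCommGroup E] (f : α → E)
    (μ : Measure α) : eLpNorm f 2 μ ^ 2 = ∫⁻ x, ‖f x‖ₑ ^ 2 ∂μ := by
  rw [eLpNorm_eq_lintegral_rpow_enorm_toReal (by norm_num) (by norm_num), ← ENNReal.rpow_natCast,
    ← ENNReal.rpow_mul]
  norm_num

theorem tendsto_eLpNorm_two_zero_iff {α E ι : Type*} [MeasurableSpace α] [NormedAddCommGroup E]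
    {f : ι → α → E} {μ : Measure α} {l : Filter ι} :
    Tendsto (fun i => eLpNorm (f i) 2 μ) l (𝓝 0) ↔
      Tendsto (fun i => ∫⁻ x, ‖f i x‖ₑ ^ 2 ∂μ) l (𝓝 0) := by
  simp_rw [← eLpNorm_two_sq]
  refine ⟨fun h => ?_, fun h => ?_⟩
  · simpa [Function.comp_def] using ((ENNReal.continuous_pow 2).tendsto 0).comp h
  · have := (ENNReal.continuous_rpow_const (y := 1 / 2)).continuousAt.tendsto.comp h
    simp only [Function.comp_def, ← ENNReal.rpow_natCast, ← ENNReal.rpow_mul] at this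
    norm_num at this
    exact this

/-- The Cauchy–Schwarz inequality against the constant `1`. -/
theorem sq_lintegral_le {α : Type*} [MeasurableSpace α] {μ : Measure α} {f : α → ENNReal}
    (hf : AEMeasurable f μ) : (∫⁻ x, f x ∂μ) ^ 2 ≤ μ Set.univ * ∫⁻ x, f x ^ 2 ∂μ := by
  have h := ENNReal.lintegral_mul_le_Lp_mul_Lq μ Real.HolderConjugate.two_two
    hf (aemeasurable_const (b := (1 : ENNReal)))
  have h2 := pow_le_pow_left₀ zero_le h 2
  simp only [Pi.mul_apply, mul_one, ENNReal.one_rpow, lintegral_const, one_mul, mul_pow] at h2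
  rw [← ENNReal.rpow_natCast, ← ENNReal.rpow_natCast (_ ^ (1 / 2 : ℝ)),
    ← ENNReal.rpow_natCast (_ ^ (1 / 2 : ℝ)), ← ENNReal.rpow_mul, ← ENNReal.rpow_mul] at h2
  norm_num at h2
  rwa [mul_comm] at h2

variable {d : ℕ}

/-- Dominated convergence for multiplication operators on `L²`. -/
theorem tendsto_bcfMul_zero {E₁ E₂ E₃ : Type*} [NormedAddCommGroup E₁] [NormedSpace ℝ E₁]
    [NormedAddCommGroup E₂] [NormedSpace ℝ E₂] [NormedAddCommGroup E₃] [NormedSpace ℝ E₃]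
    (B : E₁ →L[ℝ] E₂ →L[ℝ] E₃) {f : ℕ → BoundedContinuousFunction (Space d) E₁} {C : ℝ}
    (hC : ∀ n x, ‖f n x‖ ≤ C) (hf : ∀ x, Tendsto (fun n => f n x) atTop (𝓝 0))
    (u : Lp E₂ 2 (volume : Measure (Space d))) :
    Tendsto (fun n => bcfMul B (f n) u) atTop (𝓝 0) := by
  rw [Lp.tendsto_Lp_iff_tendsto_eLpNorm', tendsto_eLpNorm_two_zero_iff]
  have hmeas : ∀ n, AEMeasurable (fun x => ‖B (f n x) (u x)‖ₑ ^ 2) volume := fun n =>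
    ((memLp_bilin_bcf B (f n) u).aestronglyMeasurable.enorm).pow_const 2
  have h1 : ∀ n, ∫⁻ x, ‖((bcfMul B (f n) u : Lp E₃ 2 (volume : Measure (Space d)))
      - (0 : Lp E₃ 2 (volume : Measure (Space d))) : Space d → E₃) x‖ₑ ^ 2
      = ∫⁻ x, ‖B (f n x) (u x)‖ₑ ^ 2 := fun n => by
    refine lintegral_congr_ae ?_
    filter_upwards [coeFn_bcfMul B (f n) u, Lp.coeFn_zero E₃ 2 (volume : Measure (Space d))]
      with x hx hx'
    rw [Pi.sub_apply, hx, hx', Pi.zero_apply, sub_zero]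
  simp_rw [h1]
  rw [show (0 : ENNReal) = ∫⁻ _ : Space d, 0 by simp]
  refine tendsto_lintegral_of_dominated_convergence'
    (fun x => (ENNReal.ofReal (‖B‖ * C) * ‖u x‖ₑ) ^ 2) hmeas (fun n => ?_) ?_ ?_
  · refine Eventually.of_forall fun x => ?_
    have hb : ‖B (f n x) (u x)‖ ≤ ‖B‖ * C * ‖u x‖ :=
      (B.le_opNorm₂ _ _).trans (by gcongr; exact hC n x)
    have : ‖B (f n x) (u x)‖ₑ ≤ ENNReal.ofReal (‖B‖ * C) * ‖u x‖ₑ := by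
      rw [← ofReal_norm, ← ofReal_norm (u x), ← ENNReal.ofReal_mul
        (mul_nonneg (norm_nonneg B) ((norm_nonneg _).trans (hC n x)))]
      exact ENNReal.ofReal_le_ofReal hb
    exact pow_le_pow_left₀ zero_le this 2
  · simp_rw [mul_pow]
    rw [lintegral_const_mul'' _ ((Lp.aestronglyMeasurable u).enorm.pow_const 2), ← eLpNorm_two_sq]
    exact ENNReal.mul_ne_top (by simp) (by simpa using Lp.eLpNorm_ne_top u)
  · refine Eventually.of_forall fun x => ?_
    have h0 : Tendsto (fun n => B (f n x) (u x)) atTop (𝓝 0) := by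
      have : Continuous fun y => B y (u x) := (B.flip (u x)).continuous
      simpa [Function.comp_def] using (this.tendsto 0).comp (hf x)
    simpa [Function.comp_def] using ((ENNReal.continuous_pow 2).tendsto _).comp h0.enorm

/-! ### Density of the test functions in `H^1(ℝ^d)` -/

/-- A test function that equals `1` on the ball of radius `n + 1` and is supported in the ball of
radius `2 (n + 1)`, with a gradient bounded independently of `n`. -/
def cutoff (d n : ℕ) : TestFn d :=
  ⟨fun x => (⟨1, 2, one_pos, one_lt_two⟩ : ContDiffBump (0 : Space d)) (((n : ℝ) + 1)⁻¹ • x),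
    (ContDiffBump.contDiff _).comp (contDiff_const_smul _),
    (ContDiffBump.hasCompactSupport _).comp_smul (by positivity)⟩

theorem cutoff_mem_Icc (n : ℕ) (x : Space d) : cutoff d n x ∈ Set.Icc 0 1 :=
  ⟨ContDiffBump.nonneg _, ContDiffBump.le_one _⟩

theorem cutoff_eq_one {n : ℕ} {x : Space d} (h : ‖x‖ ≤ n + 1) : cutoff d n x = 1 := by
  refine ContDiffBump.one_of_mem_closedBall _ ?_
  rw [mem_closedBall_zero_iff, norm_smul, norm_inv, Real.norm_of_nonneg (by positivity)]
  exact (inv_mul_le_one₀ (by positivity)).2 h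

theorem exists_norm_gradient_cutoff_le (d : ℕ) :
    ∃ C, ∀ n (x : Space d), ‖∇ (cutoff d n : Space d → ℝ) x‖ ≤ C := by
  have h0 : HasCompactSupport
      (⟨1, 2, one_pos, one_lt_two⟩ : ContDiffBump (0 : Space d)) := ContDiffBump.hasCompactSupport _
  have h1 : ContDiff ℝ ∞ (⟨1, 2, one_pos, one_lt_two⟩ : ContDiffBump (0 : Space d)) :=
    ContDiffBump.contDiff _
  obtain ⟨C, hC⟩ := (h0.fderiv (𝕜 := ℝ)).exists_bound_of_continuous
    (h1.continuous_fderiv (by simp))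
  refine ⟨C, fun n x => ?_⟩
  have hn : ‖((n : ℝ) + 1)⁻¹‖ ≤ 1 := by
    rw [norm_inv, Real.norm_of_nonneg (by positivity)]
    exact inv_le_one_of_one_le₀ (by linarith [n.cast_nonneg (α := ℝ)])
  have hf : fderiv ℝ (cutoff d n : Space d → ℝ) x = ((n : ℝ) + 1)⁻¹ •
      fderiv ℝ (⟨1, 2, one_pos, one_lt_two⟩ : ContDiffBump (0 : Space d))
        (((n : ℝ) + 1)⁻¹ • x) := fderiv_comp_smul
      (f := (⟨1, 2, one_pos, one_lt_two⟩ : ContDiffBump (0 : Space d))) (x := x) _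
  rw [gradient, LinearIsometryEquiv.norm_map, hf, norm_smul]
  exact (mul_le_mul hn (hC _) (norm_nonneg _) zero_le_one).trans (by rw [one_mul])

theorem tendsto_cutoff (x : Space d) : ∀ᶠ n in atTop, ∀ᶠ y in 𝓝 x, cutoff d n y = 1 := by
  filter_upwards [tendsto_natCast_atTop_atTop.eventually_ge_atTop (‖x‖)] with n hn
  have : ∀ᶠ y in 𝓝 x, ‖y‖ < ‖x‖ + 1 :=
    continuous_norm.continuousAt.eventually_lt continuousAt_const (by simp)
  filter_upwards [this] with y hy
  exact cutoff_eq_one (by linarith)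

theorem tendsto_scalarMul_cutoff {E : Type*} [NormedAddCommGroup E] [NormedSpace ℝ E]
    (u : Lp E 2 (volume : Measure (Space d))) :
    Tendsto (fun n => scalarMul (cutoff d n).bcf u) atTop (𝓝 u) := by
  have h := tendsto_bcfMul_zero (ContinuousLinearMap.lsmul ℝ ℝ)
    (f := fun n => (cutoff d n).bcf - BoundedContinuousFunction.const _ 1) (C := 1)
    (fun n x => by
      have := cutoff_mem_Icc n x
      simp only [BoundedContinuousFunction.coe_sub, Pi.sub_apply, TestFn.bcf_apply,
        BoundedContinuousFunction.const_apply, Real.norm_eq_abs, abs_le]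
      constructor <;> linarith [this.1, this.2])
    (fun x => by
      refine tendsto_const_nhds.congr' ?_
      filter_upwards [tendsto_cutoff x] with n hn
      simp [hn.self_of_nhds]) u
  have h1 : bcfMul (ContinuousLinearMap.lsmul ℝ ℝ) (BoundedContinuousFunction.const (Space d) 1) u
      = u := by
    refine Lp.ext ?_
    filter_upwards [coeFn_bcfMul (ContinuousLinearMap.lsmul ℝ ℝ)
      (BoundedContinuousFunction.const (Space d) (1 : ℝ)) u] with x hx
    simp [hx]
  simp only [map_sub, sub_apply, h1] at h
  have h2 := h.add_const u
  simp only [sub_add_cancel, zero_add] at h2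
  exact h2

theorem H1.tendsto_iff {ι : Type*} {l : Filter ι} {u : ι → H1 d} {v : H1 d} :
    Tendsto u l (𝓝 v) ↔ Tendsto (fun i => H1.toL2 d (u i)) l (𝓝 (H1.toL2 d v)) ∧
      Tendsto (fun i => H1.grad d (u i)) l (𝓝 (H1.grad d v)) := by
  refine ⟨fun h => ⟨((H1.toL2 d).continuous.tendsto _).comp h,
    ((H1.grad d).continuous.tendsto _).comp h⟩, fun ⟨h1, h2⟩ => ?_⟩
  rw [tendsto_iff_norm_sub_tendsto_zero] at h1 h2 ⊢
  have h : ∀ i, ‖u i - v‖ = √(‖H1.toL2 d (u i) - H1.toL2 d v‖ ^ 2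
      + ‖H1.grad d (u i) - H1.grad d v‖ ^ 2) := fun i => by
    rw [← map_sub, ← map_sub, ← H1.norm_sq_eq, Real.sqrt_sq (norm_nonneg _)]
  simp_rw [h]
  simpa using ((h1.pow 2).add (h2.pow 2)).sqrt

/-- The cutoffs converge because the term `u ∇χₙ` of the product rule tends to `0` by dominated
convergence: the gradients are uniformly bounded and vanish eventually at every point. -/
theorem tendsto_mul_cutoff (u : H1 d) : Tendsto (fun n => H1.mul (cutoff d n) u) atTop (𝓝 u) := by
  rw [H1.tendsto_iff]
  refine ⟨tendsto_scalarMul_cutoff _, ?_⟩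
  simp_rw [H1.grad_mul]
  have h2 : Tendsto (fun n => H1.mulGrad (cutoff d n) (H1.toL2 d u)) atTop (𝓝 0) := by
    obtain ⟨C, hC⟩ := exists_norm_gradient_cutoff_le d
    refine tendsto_bcfMul_zero _ hC (fun x => ?_) _
    refine tendsto_const_nhds.congr' ?_
    filter_upwards [tendsto_cutoff x] with n hn
    rw [TestFn.gradBcf_apply, gradient,
      Filter.EventuallyEq.fderiv_eq (f := fun _ => (1 : ℝ)) hn]
    simp
  simpa using (tendsto_scalarMul_cutoff (H1.grad d u)).add h2

/-- Translation is continuous in `L²`. -/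
theorem tendsto_lintegral_translate {E : Type*} [NormedAddCommGroup E] [NormedSpace ℝ E]
    {g : Space d → E} (hg : MemLp g 2 volume) :
    Tendsto (fun t : Space d => ∫⁻ x, ‖g (x - t) - g x‖ₑ ^ 2) (𝓝 0) (𝓝 0) := by
  let S : Space d → C(Space d, Space d) := fun t => ⟨fun x => x - t, by fun_prop⟩
  have hS : Continuous S := by
    refine ContinuousMap.continuous_of_continuous_uncurry _ ?_
    exact continuous_snd.sub continuous_fst
  have hm : ∀ t, MeasurePreserving (S t) (volume : Measure (Space d)) volume := fun t =>
    measurePreserving_sub_right volume t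
  have h := (Continuous.compMeasurePreservingLp (continuous_const (y := hg.toLp g)) hS hm
    (by norm_num)).tendsto 0
  rw [Lp.tendsto_Lp_iff_tendsto_eLpNorm', tendsto_eLpNorm_two_zero_iff] at h
  refine h.congr fun t => lintegral_congr_ae ?_
  have e1 : ∀ t, (Lp.compMeasurePreserving (S t) (hm t) (hg.toLp g) : Space d → E)
      =ᵐ[volume] fun x => g (x - t) := fun t =>
    (Lp.coeFn_compMeasurePreserving _ (hm t)).trans
      ((hm t).quasiMeasurePreserving.ae_eq_comp hg.coeFn_toLp)
  filter_upwards [e1 t, e1 0] with x h1 h2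
  rw [Pi.sub_apply, h1, h2, sub_zero]

/-- Mollification converges in `L²`. -/
theorem tendsto_convolution_normed {E : Type*} [NormedAddCommGroup E] [NormedSpace ℝ E]
    [CompleteSpace E] {g : Space d → E} (hg : MemLp g 2 volume) {ρ : ℕ → ContDiffBump (0 : Space d)}
    (hρ : Tendsto (fun n => (ρ n).rOut) atTop (𝓝 0)) :
    Tendsto (fun n => eLpNorm (fun x => (∫ t, (ρ n).normed volume t • g (x - t)) - g x) 2 volume)
      atTop (𝓝 0) := by
  -- a strongly measurable representative makes the double integrals measurable
  obtain ⟨g', hg', hgg'⟩ := hg.1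
  have hgL : MemLp g' 2 volume := hg.ae_eq hgg'
  have hcongr : ∀ n, eLpNorm (fun x => (∫ t, (ρ n).normed volume t • g (x - t)) - g x) 2 volume
      = eLpNorm (fun x => (∫ t, (ρ n).normed volume t • g' (x - t)) - g' x) 2 volume := fun n => by
    refine eLpNorm_congr_ae ?_
    filter_upwards [hgg'] with x hx
    rw [hx]
    congr 1
    refine integral_congr_ae ?_
    have : (fun t => g (x - t)) =ᵐ[volume] fun t => g' (x - t) :=
      (quasiMeasurePreserving_sub_left volume x).ae_eq_comp hgg'
    filter_upwards [this] with t ht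
    rw [ht]
  simp_rw [hcongr]
  rw [tendsto_eLpNorm_two_zero_iff, ENNReal.tendsto_atTop_zero]
  intro ε hε
  have h1 := (ENNReal.tendsto_nhds_zero.1 (tendsto_lintegral_translate hgL)) ε hε
  obtain ⟨δ, hδ, hδ'⟩ := Metric.eventually_nhds_iff.1 h1
  obtain ⟨N, hN⟩ := (hρ.eventually (gt_mem_nhds hδ)).exists_forall_of_atTop
  refine ⟨N, fun n hn => ?_⟩
  have hcont : Continuous ((ρ n).normed (volume : Measure (Space d))) := (ρ n).continuous_normed
  have hint1 : Integrable ((ρ n).normed volume) (volume : Measure (Space d)) :=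
    hcont.integrable_of_hasCompactSupport (ρ n).hasCompactSupport_normed
  have hone : ∫⁻ t, ‖(ρ n).normed volume t‖ₑ = 1 := by
    rw [← ofReal_integral_norm_eq_lintegral_enorm hint1]
    simp_rw [Real.norm_of_nonneg ((ρ n).nonneg_normed _), (ρ n).integral_normed, ENNReal.ofReal_one]
  let ν : Measure (Space d) := volume.withDensity fun t => ‖(ρ n).normed volume t‖ₑ
  have hν : ν Set.univ = 1 := by
    rw [withDensity_apply _ MeasurableSet.univ, Measure.restrict_univ, hone]
  have hmd : Measurable fun t => ‖(ρ n).normed (volume : Measure (Space d)) t‖ₑ :=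
    hcont.measurable.enorm
  have hm2 : Measurable fun p : Space d × Space d => ‖g' (p.1 - p.2) - g' p.1‖ₑ :=
    ((hg'.comp_measurable (measurable_fst.sub measurable_snd)).sub
      (hg'.comp_measurable measurable_fst)).enorm
  have hpt : ∀ x, ‖(∫ t, (ρ n).normed volume t • g' (x - t)) - g' x‖ₑ ^ 2
      ≤ ∫⁻ t, ‖g' (x - t) - g' x‖ₑ ^ 2 ∂ν := fun x => by
    have hint2 : Integrable (fun t => (ρ n).normed volume t • g' (x - t)) := by
      have hloc : LocallyIntegrable (fun t => g' (x - t)) volume :=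
        (hgL.comp_measurePreserving (Measure.measurePreserving_sub_left volume x)).locallyIntegrable
          (by norm_num)
      exact hloc.integrable_smul_left_of_hasCompactSupport hcont (ρ n).hasCompactSupport_normed
    have e1 : (∫ t, (ρ n).normed volume t • g' (x - t)) - g' x
        = ∫ t, (ρ n).normed volume t • (g' (x - t) - g' x) := by
      simp_rw [smul_sub]
      rw [integral_sub hint2 (hint1.smul_const _), integral_smul_const, (ρ n).integral_normed,
        one_smul]
    have e2 : ‖∫ t, (ρ n).normed volume t • (g' (x - t) - g' x)‖ₑ
        ≤ ∫⁻ t, ‖g' (x - t) - g' x‖ₑ ∂ν := by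
      refine (enorm_integral_le_lintegral_enorm _).trans (le_of_eq ?_)
      have hm3 : Measurable fun t => ‖g' (x - t) - g' x‖ₑ := hm2.comp measurable_prodMk_left
      rw [lintegral_withDensity_eq_lintegral_mul _ hmd hm3]
      exact lintegral_congr fun t => by rw [enorm_smul]; rfl
    rw [e1]
    refine (pow_le_pow_left₀ zero_le e2 2).trans ?_
    refine (sq_lintegral_le (hm2.comp measurable_prodMk_left).aemeasurable).trans ?_
    rw [hν, one_mul]
    rfl
  refine (lintegral_mono hpt).trans ?_
  have : IsFiniteMeasure ν := ⟨by rw [hν]; exact ENNReal.one_lt_top⟩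
  rw [lintegral_lintegral_swap (hm2.pow_const 2).aemeasurable]
  have hsupp : ∀ᵐ t ∂ν, ∫⁻ x, ‖g' (x - t) - g' x‖ₑ ^ 2 ≤ ε := by
    rw [ae_withDensity_iff hmd]
    refine Eventually.of_forall fun t ht => hδ' ?_
    have : t ∈ Function.support ((ρ n).normed (volume : Measure (Space d))) := by
      simpa using ht
    rw [(ρ n).support_normed_eq, Metric.mem_ball] at this
    exact this.trans (hN n hn)
  refine (lintegral_mono_ae hsupp).trans ?_
  rw [lintegral_const, hν, mul_one]

theorem locallyIntegrable_mul_toL2 (χ : TestFn d) (u : H1 d) :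
    LocallyIntegrable (fun x => χ x * H1.toL2 d u x) volume :=
  ((Lp.memLp (H1.toL2 d (H1.mul χ u))).ae_eq (H1.coeFn_toL2_mul χ u)).locallyIntegrable
    (by norm_num)

/-- The mollification of `χ u` as a test function. -/
def mollify (ρ : ContDiffBump (0 : Space d)) (χ : TestFn d) (u : H1 d) : TestFn d :=
  ⟨convolution (ρ.normed volume) (fun x => χ x * H1.toL2 d u x) (ContinuousLinearMap.lsmul ℝ ℝ)
      volume,
    ρ.hasCompactSupport_normed.contDiff_convolution_left (ContinuousLinearMap.lsmul ℝ ℝ)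
      ρ.contDiff_normed (locallyIntegrable_mul_toL2 χ u),
    HasCompactSupport.convolution (ContinuousLinearMap.lsmul ℝ ℝ)
      ρ.hasCompactSupport_normed (HasCompactSupport.mul_right χ.hasCompactSupport)⟩

theorem mollify_apply (ρ : ContDiffBump (0 : Space d)) (χ : TestFn d) (u : H1 d) (x : Space d) :
    mollify ρ χ u x = ∫ t, ρ.normed volume t • (χ (x - t) * H1.toL2 d u (x - t)) := rfl

set_option maxHeartbeats 1000000 in
/-- The gradient of the mollification is the mollification of the weak gradient of `χ u`. -/
theorem gradient_mollify (ρ : ContDiffBump (0 : Space d)) (χ : TestFn d) (u : H1 d) (x : Space d) :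
    ∇ (mollify ρ χ u : Space d → ℝ) x
      = ∫ t, ρ.normed volume t • H1.grad d (H1.mul χ u) (x - t) := by
  set f : Space d → ℝ := fun x => χ x * H1.toL2 d u x with hf
  set r : Space d → ℝ := ρ.normed volume with hr
  have hloc : LocallyIntegrable f volume := locallyIntegrable_mul_toL2 χ u
  have hrs : ContDiff ℝ ∞ r := ρ.contDiff_normed
  have hrc : HasCompactSupport r := ρ.hasCompactSupport_normed
  -- the weak gradient is tested against `y ↦ ρ (x - y)`
  have hψ : ContDiff ℝ ∞ fun y => r (x - y) := hrs.comp (contDiff_const.sub contDiff_id)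
  have hψc : HasCompactSupport fun y => r (x - y) :=
    hrc.comp_homeomorph (Homeomorph.subLeft x)
  have hψd : ∀ y v, fderiv ℝ (fun y => r (x - y)) y v = -fderiv ℝ r (x - y) v := fun y v => by
    have h1 : HasFDerivAt (fun y : Space d => x - y) (-ContinuousLinearMap.id ℝ (Space d)) y :=
      (hasFDerivAt_id y).const_sub x
    have h2 : fderiv ℝ (fun y => r (x - y)) y = _ :=
      ((hrs.differentiable (by simp) (x - y)).hasFDerivAt.comp y h1).fderiv
    rw [h2]
    simp
  have key := (H1.mul χ u).isWeakGradient _ hψ hψc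
  have hswap : ∫ t, r t • H1.grad d (H1.mul χ u) (x - t)
      = ∫ y, r (x - y) • H1.grad d (H1.mul χ u) y := by
    rw [← integral_sub_left_eq_self _ volume x]
    simp only [sub_sub_cancel]
  rw [hswap, ← neg_eq_iff_eq_neg.2 key]
  refine ext_inner_right ℝ fun v => ?_
  rw [inner_gradient, inner_neg_left, real_inner_comm,
    ← integral_inner (integrable_smul_gradient _ hψ hψc)]
  have hder := (hrc.hasFDerivAt_convolution_left (ContinuousLinearMap.lsmul ℝ ℝ)
    (hrs.of_le (by simp)) hloc x).fderiv
  have hval : fderiv ℝ (mollify ρ χ u : Space d → ℝ) x v = ∫ y, fderiv ℝ r (x - y) v * f y := by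
    change fderiv ℝ (convolution r f (ContinuousLinearMap.lsmul ℝ ℝ) volume) x v = _
    rw [hder, convolution_eq_swap, ContinuousLinearMap.integral_apply]
    · rfl
    · exact ((hrc.fderiv (𝕜 := ℝ)).convolutionExists_left _ (hrs.continuous_fderiv (by simp)) hloc
        x).integrable_swap
  rw [hval, ← integral_neg]
  refine integral_congr_ae ?_
  filter_upwards [H1.coeFn_toL2_mul χ u] with y hy
  rw [real_inner_comm, real_inner_smul_left, inner_gradient, hψd, hy]
  ring

set_option maxHeartbeats 1000000 in
/-- The test functions are dense in `H^1(ℝ^d)`. -/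
theorem denseRange_ofTest : DenseRange (H1.ofTest : TestFn d → H1 d) := by
  have hcl : ∀ u n, H1.mul (cutoff d n) u ∈ closure (Set.range (H1.ofTest : TestFn d → H1 d)) := by
    intro u n
    set χ := cutoff d n
    let ρ : ℕ → ContDiffBump (0 : Space d) := fun n =>
      ⟨1 / ((n : ℝ) + 1) / 2, 1 / ((n : ℝ) + 1), by positivity, half_lt_self (by positivity)⟩
    have hρ : Tendsto (fun n => (ρ n).rOut) atTop (𝓝 0) := tendsto_one_div_add_atTop_nhds_zero_nat
    refine mem_closure_of_tendsto (f := fun k => H1.ofTest (mollify (ρ k) χ u)) (b := atTop) ?_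
      (Eventually.of_forall fun k => Set.mem_range_self _)
    have hu : MemLp (fun x => χ x * H1.toL2 d u x) 2 volume :=
      (Lp.memLp (H1.toL2 d (H1.mul χ u))).ae_eq (H1.coeFn_toL2_mul χ u)
    rw [H1.tendsto_iff, Lp.tendsto_Lp_iff_tendsto_eLpNorm', Lp.tendsto_Lp_iff_tendsto_eLpNorm']
    refine ⟨(tendsto_convolution_normed hu hρ).congr fun k => eLpNorm_congr_ae ?_,
      (tendsto_convolution_normed (Lp.memLp (H1.grad d (H1.mul χ u))) hρ).congr fun k =>
        eLpNorm_congr_ae ?_⟩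
    · filter_upwards [H1.coeFn_toL2_ofTest (mollify (ρ k) χ u), H1.coeFn_toL2_mul χ u] with x h1 h2
      rw [Pi.sub_apply, h1, h2, mollify_apply]
    · filter_upwards [H1.coeFn_grad_ofTest (mollify (ρ k) χ u)] with x h1
      rw [Pi.sub_apply, h1]
      exact congrArg (· - _) (gradient_mollify (ρ k) χ u x).symm
  intro u
  rw [← closure_closure]
  exact mem_closure_of_tendsto (tendsto_mul_cutoff u) (Eventually.of_forall (hcl u))

/-! ### Lipschitz graphs -/

section Graph

variable {d : ℕ} {e : Space d} {K : NNReal} {γ : Space d → ℝ}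

/-- The hyperplane through the origin with normal direction `e`. -/
abbrev Hyperplane (e : Space d) : Type := (ℝ ∙ e)ᗮ

/-- The point at height `s` over `y`. -/
def lift (e : Space d) (y : Hyperplane e) (s : ℝ) : Space d := (y : Space d) + s • e

/-- The parametrisation of the graph of `γ` over the hyperplane orthogonal to `e`. -/
def graphMap (e : Space d) (γ : Space d → ℝ) (y : Hyperplane e) : Space d := lift e y (γ y)

/-- The graph of `γ` over the hyperplane orthogonal to `e`. -/
def graph (e : Space d) (γ : Space d → ℝ) : Set (Space d) :=
  {x | inner ℝ x e = γ (x - inner ℝ x e • e)}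

theorem inner_hyperplane (y : Hyperplane e) : inner ℝ (y : Space d) e = 0 :=
  Submodule.mem_orthogonal_singleton_iff_inner_left.1 y.2

theorem continuous_lift : Continuous fun p : Hyperplane e × ℝ => lift e p.1 p.2 := by
  unfold lift; fun_prop

theorem finrank_hyperplane (he : ‖e‖ = 1) : Module.finrank ℝ (Hyperplane e) = d - 1 := by
  have h0 : e ≠ 0 := by rintro rfl; simp at he
  have h := (ℝ ∙ e).finrank_add_finrank_orthogonal
  rw [finrank_span_singleton h0, finrank_euclideanSpace_fin] at h
  exact (Nat.sub_eq_of_eq_add' h.symm).symm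

theorem one_le_dim (he : ‖e‖ = 1) : 1 ≤ d := by
  rcases Nat.eq_zero_or_pos d with rfl | h
  · rw [Subsingleton.elim e 0, norm_zero] at he
    exact absurd he zero_ne_one
  · exact h

/-- Lebesgue measure is the product of the measures on the hyperplane and on its normal line. -/
theorem measurePreserving_lift (he : ‖e‖ = 1) :
    MeasurePreserving (fun p : Hyperplane e × ℝ => lift e p.1 p.2)
      ((volume : Measure (Hyperplane e)).prod volume) volume := by
  have h1 := ((ℝ ∙ e).measurePreserving_measurableEquivProd (0 : Space d)).symm
  rw [InnerProductSpace.euclideanHausdorffMeasure_eq_volume] at h1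
  have h2 := ((LinearIsometryEquiv.toSpanUnitSingleton e he).measurePreserving).prod
    (MeasurePreserving.id (volume : Measure (Hyperplane e)))
  have h3 := (h1.comp h2).comp (Measure.measurePreserving_swap (μ := (volume : Measure (Hyperplane e)))
    (ν := (volume : Measure ℝ)))
  have h4 : (fun p : Hyperplane e × ℝ => lift e p.1 p.2)
      = (((ℝ ∙ e).measurableEquivProd (0 : Space d)).symm
        ∘ Prod.map (LinearIsometryEquiv.toSpanUnitSingleton e he) id) ∘ Prod.swap := by
    funext p
    simp only [Function.comp_apply, Submodule.measurableEquivProd_symm_apply]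
    simp [lift, add_comm]
  rw [h4]
  exact h3

/-- Fubini's theorem in coordinates that flatten the graph: height is measured from the graph. -/
theorem lintegral_eq_graph (he : ‖e‖ = 1) (γ : Space d → ℝ) {F : Space d → ENNReal}
    (hF : Measurable F) :
    ∫⁻ x, F x = ∫⁻ y : Hyperplane e, ∫⁻ t : ℝ, F (lift e y (γ y + t)) := by
  rw [← (measurePreserving_lift he).lintegral_comp hF,
    lintegral_prod (fun p : Hyperplane e × ℝ => F (lift e p.1 p.2))
      (hF.comp continuous_lift.measurable).aemeasurable]
  refine lintegral_congr fun y => ?_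
  exact (lintegral_add_left_eq_self (fun s => F (lift e y s)) (γ y)).symm

theorem norm_le_norm_lift (y : Hyperplane e) (s : ℝ) : ‖y‖ ≤ ‖lift e y s‖ := by
  refine (sq_le_sq₀ (norm_nonneg _) (norm_nonneg _)).1 ?_
  rw [lift, norm_add_sq_real, real_inner_smul_right, inner_hyperplane]
  simp only [Submodule.coe_norm]
  nlinarith [sq_nonneg ‖s • e‖]

theorem lipschitzWith_graphMap (he : ‖e‖ = 1) (hγ : LipschitzWith K γ) :
    LipschitzWith (1 + K) (graphMap e γ) := by
  refine LipschitzWith.of_dist_le_mul fun y z => ?_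
  have h1 : graphMap e γ y - graphMap e γ z = ((y : Space d) - z) + (γ y - γ z) • e := by
    simp only [graphMap, lift, sub_smul]; abel
  have h2 := hγ.dist_le_mul y z
  rw [dist_eq_norm, h1]
  refine (norm_add_le _ _).trans ?_
  rw [norm_smul, he, mul_one, NNReal.coe_add, NNReal.coe_one, add_mul, one_mul]
  exact add_le_add le_rfl h2

theorem graph_subset (he : ‖e‖ = 1) (A : Set (Space d)) :
    A ∩ graph e γ ⊆ graphMap e γ '' (graphMap e γ ⁻¹' A) := by
  rintro x ⟨hA, hx⟩
  have hy : x - inner ℝ x e • e ∈ (ℝ ∙ e)ᗮ := by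
    rw [Submodule.mem_orthogonal_singleton_iff_inner_left, inner_sub_left, real_inner_smul_left,
      real_inner_self_eq_norm_sq, he]
    ring
  have hG : graphMap e γ ⟨_, hy⟩ = x := by
    have hx' : γ (x - inner ℝ x e • e) = inner ℝ x e := hx.symm
    simp only [graphMap, lift, hx']
    abel
  exact ⟨⟨_, hy⟩, by rwa [Set.mem_preimage, hG], hG⟩

/-- The surface measure on a Lipschitz graph is at most a constant times the Lebesgue measure of the
parameter domain, because a Lipschitz map increases Hausdorff measure by a bounded factor. Only
this inequality is needed; the area formula is not. -/
theorem measure_graph_le (he : ‖e‖ = 1) (hγ : LipschitzWith K γ) :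
    (Measure.euclideanHausdorffMeasure (d - 1) : Measure (Space d)).restrict (graph e γ)
      ≤ ((1 + K : NNReal) ^ (d - 1) : NNReal) • Measure.map (graphMap e γ) volume := by
  have hL := lipschitzWith_graphMap he hγ
  refine Measure.le_iff.2 fun A hA => ?_
  rw [Measure.restrict_apply hA, Measure.smul_apply, Measure.map_apply hL.continuous.measurable hA]
  refine (measure_mono (graph_subset he A)).trans ?_
  rw [← InnerProductSpace.euclideanHausdorffMeasure_eq_volume, finrank_hyperplane he,
    Measure.euclideanHausdorffMeasure_def, Measure.euclideanHausdorffMeasure_def,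
    Measure.smul_apply, Measure.smul_apply]
  have := hL.hausdorffMeasure_image_le (d := ((d - 1 : ℕ) : ℝ)) (by positivity)
    (graphMap e γ ⁻¹' A)
  rw [smul_comm]
  simp only [ENNReal.smul_def, smul_eq_mul]
  gcongr
  refine this.trans (le_of_eq ?_)
  rw [ENNReal.rpow_natCast]
  norm_cast

/-! ### The trace inequality on a Lipschitz graph -/

/-- The increment of `φ` along a segment, parametrised by a `C¹` function `s` from `0` to `1`. -/
theorem enorm_sub_sq_le_lintegral {φ : Space d → ℝ} (hφ : ContDiff ℝ ∞ φ) {s s' : ℝ → ℝ}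
    (hs : ∀ σ, HasDerivAt s (s' σ) σ) (hs' : Continuous s') (h0 : s 0 = 0) (h1 : s 1 = 1)
    (x v : Space d) :
    ‖φ (x + v) - φ x‖ₑ ^ 2 ≤ ∫⁻ σ in Set.Ioc (0 : ℝ) 1,
      ENNReal.ofReal (s' σ ^ 2 * ‖v‖ ^ 2) * ‖∇ φ (x + s σ • v)‖ₑ ^ 2 := by
  have hsc : Continuous s := continuous_iff_continuousAt.2 fun σ => (hs σ).continuousAt
  have hg : Continuous fun σ => ∇ φ (x + s σ • v) :=
    (continuous_gradient hφ).comp (by fun_prop)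
  have hder : ∀ σ, HasDerivAt (fun σ => φ (x + s σ • v))
      (s' σ * inner ℝ (∇ φ (x + s σ • v)) v) σ := fun σ => by
    have h2 : HasDerivAt (fun σ => x + s σ • v) (s' σ • v) σ := ((hs σ).smul_const v).const_add x
    have h3 := (hφ.differentiable (by simp) (x + s σ • v)).hasFDerivAt.comp_hasDerivAt σ h2
    rw [inner_gradient]
    simpa [Function.comp_def] using h3
  have hcont : Continuous fun σ => s' σ * inner ℝ (∇ φ (x + s σ • v)) v :=
    hs'.mul (hg.inner continuous_const)
  have hint : φ (x + v) - φ x = ∫ σ in (0 : ℝ)..1, s' σ * inner ℝ (∇ φ (x + s σ • v)) v := by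
    rw [intervalIntegral.integral_eq_sub_of_hasDerivAt (fun σ _ => hder σ)
      (hcont.intervalIntegrable _ _), h0, h1]
    simp
  rw [hint, intervalIntegral.integral_of_le zero_le_one]
  refine (pow_le_pow_left₀ zero_le (enorm_integral_le_lintegral_enorm _) 2).trans ?_
  refine (sq_lintegral_le hcont.enorm.measurable.aemeasurable).trans ?_
  simp only [Measure.restrict_apply_univ, Real.volume_Ioc, sub_zero, ENNReal.ofReal_one, one_mul]
  refine lintegral_mono fun σ => ?_
  have hb : ‖s' σ * inner ℝ (∇ φ (x + s σ • v)) v‖ ^ 2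
      ≤ s' σ ^ 2 * ‖v‖ ^ 2 * ‖∇ φ (x + s σ • v)‖ ^ 2 := by
    have h2 := norm_inner_le_norm (𝕜 := ℝ) (∇ φ (x + s σ • v)) v
    have h3 := pow_le_pow_left₀ (norm_nonneg _) h2 2
    rw [norm_mul, mul_pow, Real.norm_eq_abs (s' σ), sq_abs]
    nlinarith [sq_nonneg (s' σ), mul_le_mul_of_nonneg_left h3 (sq_nonneg (s' σ))]
  rw [← ofReal_norm, ← ofReal_norm, ← ENNReal.ofReal_pow (norm_nonneg _),
    ← ENNReal.ofReal_pow (norm_nonneg _), ← ENNReal.ofReal_mul (by positivity)]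
  exact ENNReal.ofReal_le_ofReal hb

/-- The squared size of the gradient of `φ` at height `t` above the point of the graph of `γ` over
`y`. -/
def gradSq (e : Space d) (γ φ : Space d → ℝ) (y : Hyperplane e) (t : ℝ) : ENNReal :=
  ‖∇ φ (lift e y (γ y + t))‖ₑ ^ 2

theorem measurable_gradSq {φ : Space d → ℝ} (hφ : ContDiff ℝ ∞ φ) (hγ : Continuous γ) :
    Measurable fun p : Hyperplane e × ℝ => gradSq e γ φ p.1 p.2 := by
  unfold gradSq lift
  have : Continuous fun p : Hyperplane e × ℝ =>
      ∇ φ ((p.1 : Space d) + (γ (p.1 : Space d) + p.2) • e) :=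
    (continuous_gradient hφ).comp (by fun_prop)
  exact this.enorm.measurable.pow_const 2

theorem lintegral_gradSq (he : ‖e‖ = 1) {φ : Space d → ℝ} (hφ : ContDiff ℝ ∞ φ) :
    ∫⁻ y : Hyperplane e, ∫⁻ t : ℝ, gradSq e γ φ y t = ∫⁻ x, ‖∇ φ x‖ₑ ^ 2 :=
  (lintegral_eq_graph he γ ((continuous_gradient hφ).enorm.measurable.pow_const 2)).symm

theorem lintegral_comp_affine {a b : ℝ} (ha : 0 < a) {H : ℝ → ENNReal} (hH : Measurable H) :
    ∫⁻ L, H (b + a * L) = ENNReal.ofReal a⁻¹ * ∫⁻ t, H t := by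
  have h1 : ∫⁻ L, H (b + a * L) = ∫⁻ t, H (b + t) ∂(Measure.map (a * ·) volume) := by
    have hH' : Measurable fun t => H (b + t) := hH.comp (measurable_const_add b)
    rw [lintegral_map hH' (measurable_const_mul a)]
  rw [h1, Real.map_volume_mul_left ha.ne', lintegral_smul_measure, lintegral_add_left_eq_self,
    abs_of_pos (inv_pos.2 ha), smul_eq_mul]

/-- The displacement from the point of the graph over `y` to the apex of the tent over the segment
from `y` to `y + h`; the apex has height `L ‖h‖` above the midpoint of the chord. -/
def tent (e : Space d) (γ : Space d → ℝ) (y h : Hyperplane e) (L : ℝ) : Space d :=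
  lift e ((1 / 2 : ℝ) • h) ((γ (y + h : Hyperplane e) - γ y) / 2 + L * ‖h‖)

/-- Both legs of a tent end at the same apex. -/
theorem graphMap_add_tent_symm (y h : Hyperplane e) (L : ℝ) :
    graphMap e γ (y + h) + tent e γ (y + h) (-h) L = graphMap e γ y + tent e γ y h L := by
  have h2 : y + h + -h = y := by abel
  simp only [tent, graphMap, lift, h2, norm_neg]
  push_cast
  module

theorem norm_tent_le (he : ‖e‖ = 1) (hγ : LipschitzWith K γ) (y h : Hyperplane e) {L : ℝ}
    (hL : L ∈ Set.Icc ((K : ℝ) + 1) (K + 2)) : ‖tent e γ y h L‖ ≤ (3 + 2 * K) * ‖h‖ := by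
  have h1 : |γ (y + h : Hyperplane e) - γ y| ≤ K * ‖h‖ := by
    have := hγ.dist_le_mul (y + h : Hyperplane e) y
    rw [Real.dist_eq] at this
    refine this.trans (le_of_eq ?_)
    rw [dist_eq_norm]; simp
  have hK : (0 : ℝ) ≤ K := K.2
  refine (norm_add_le _ _).trans ?_
  rw [norm_smul, he, mul_one]
  have h2 : ‖(((1 / 2 : ℝ) • h : Hyperplane e) : Space d)‖ = 1 / 2 * ‖h‖ := by
    rw [← Submodule.coe_norm, norm_smul]; norm_num
  have h3 : ‖(γ (y + h : Hyperplane e) - γ y) / 2 + L * ‖h‖‖ ≤ K * ‖h‖ / 2 + (K + 2) * ‖h‖ := by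
    refine (norm_add_le _ _).trans (add_le_add ?_ ?_)
    · rw [Real.norm_eq_abs, abs_div, abs_two]; gcongr
    · rw [norm_mul, norm_norm, Real.norm_of_nonneg (by linarith [hL.1])]
      gcongr; exact hL.2
  rw [h2]
  nlinarith [norm_nonneg h, mul_nonneg hK (norm_nonneg h)]

/-- The set of heights over the graph that the ray from a point of the graph to the apex of a tent
of width `ℓ` meets at the fraction `σ²` of the way. -/
def heightKernel (K : NNReal) (ℓ σ t : ℝ) : ENNReal :=
  {t | σ ^ 2 * ℓ ≤ t ∧ t ≤ (2 * K + 2) * (σ ^ 2 * ℓ)}.indicator 1 t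

theorem measurable_heightKernel {α : Type*} [MeasurableSpace α] {ℓ σ t : α → ℝ}
    (hℓ : Measurable ℓ) (hσ : Measurable σ) (ht : Measurable t) :
    Measurable fun p => heightKernel K (ℓ p) (σ p) (t p) := by
  have : MeasurableSet {p | σ p ^ 2 * ℓ p ≤ t p ∧ t p ≤ (2 * K + 2) * (σ p ^ 2 * ℓ p)} :=
    (measurableSet_le ((hσ.pow_const 2).mul hℓ) ht).inter
      (measurableSet_le ht (((hσ.pow_const 2).mul hℓ).const_mul _))
  exact (measurable_one.indicator this : Measurable (Set.indicator _ (1 : α → ENNReal)))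

/-- For a fixed fraction `σ²` of the way, changing the height `L` of the apex moves the point
vertically; the horizontal displacement is a translation. -/
theorem lintegral_gradSq_tent_le (hγ : LipschitzWith K γ) {φ : Space d → ℝ}
    (hφ : ContDiff ℝ ∞ φ) {h : Hyperplane e} (hh : h ≠ 0) {σ : ℝ} (hσ : 0 < σ) :
    ∫⁻ y : Hyperplane e, ∫⁻ L in Set.Icc ((K : ℝ) + 1) (K + 2),
        ‖∇ φ (graphMap e γ y + σ ^ 2 • tent e γ y h L)‖ₑ ^ 2
      ≤ ENNReal.ofReal (σ ^ 2 * ‖h‖)⁻¹ * ∫⁻ y : Hyperplane e, ∫⁻ t : ℝ,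
        heightKernel K ‖h‖ σ t * gradSq e γ φ y t := by
  have ha : 0 < σ ^ 2 * ‖h‖ := by positivity
  have hG := measurable_gradSq (e := e) hφ hγ.continuous
  have hk : Measurable fun p : Hyperplane e × ℝ =>
      heightKernel K ‖h‖ σ p.2 * gradSq e γ φ p.1 p.2 :=
    (measurable_heightKernel measurable_const measurable_const measurable_snd).mul hG
  have hLip : ∀ y z : Hyperplane e, |γ y - γ z| ≤ K * ‖y - z‖ := fun y z => by
    have := hγ.dist_le_mul (y : Space d) z
    rwa [Real.dist_eq, dist_eq_norm] at this
  have key : ∀ y : Hyperplane e, ∫⁻ L in Set.Icc ((K : ℝ) + 1) (K + 2),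
      ‖∇ φ (graphMap e γ y + σ ^ 2 • tent e γ y h L)‖ₑ ^ 2
      ≤ ENNReal.ofReal (σ ^ 2 * ‖h‖)⁻¹ * ∫⁻ t : ℝ, heightKernel K ‖h‖ σ t
          * gradSq e γ φ (y + (σ ^ 2 / 2) • h) t := fun y => by
    set z : Hyperplane e := y + (σ ^ 2 / 2) • h with hz
    set b : ℝ := γ y - γ z + σ ^ 2 * ((γ (y + h : Hyperplane e) - γ y) / 2) with hb
    have hpt : ∀ L, graphMap e γ y + σ ^ 2 • tent e γ y h L
        = lift e z (γ z + (b + (σ ^ 2 * ‖h‖) * L)) := fun L => by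
      simp only [graphMap, tent, lift, hz, hb]
      push_cast
      module
    have hb' : |b| ≤ K * (σ ^ 2 * ‖h‖) := by
      have h1 := hLip y z
      have h2 := hLip (y + h) y
      have h3 : ‖y - z‖ = σ ^ 2 / 2 * ‖h‖ := by
        rw [hz, sub_add_cancel_left, norm_neg, norm_smul, Real.norm_of_nonneg (by positivity)]
      rw [h3] at h1
      rw [add_sub_cancel_left] at h2
      have h4 : |σ ^ 2 * ((γ (y + h : Hyperplane e) - γ y) / 2)| ≤ σ ^ 2 * (K * ‖h‖ / 2) := by
        rw [abs_mul, abs_of_nonneg (sq_nonneg σ), abs_div, abs_two]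
        gcongr
      refine (abs_add_le _ _).trans ((add_le_add h1 h4).trans (le_of_eq (by ring)))
    have hmeas : Measurable fun t : ℝ => heightKernel K ‖h‖ σ t * gradSq e γ φ z t :=
      hk.comp measurable_prodMk_left
    rw [← lintegral_comp_affine (b := b) ha hmeas, ← lintegral_indicator measurableSet_Icc]
    refine lintegral_mono fun L => ?_
    rw [Set.indicator_apply]
    split_ifs with hL
    swap
    · exact zero_le
    have hin : heightKernel K ‖h‖ σ (b + σ ^ 2 * ‖h‖ * L) = 1 := by
      have h5 := abs_le.1 hb'
      rw [heightKernel, Set.indicator_of_mem, Pi.one_apply]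
      constructor
      · nlinarith [hL.1, mul_le_mul_of_nonneg_left hL.1 ha.le]
      · nlinarith [hL.2, mul_le_mul_of_nonneg_left hL.2 ha.le]
    rw [hin, one_mul, hpt, gradSq]
  refine (lintegral_mono key).trans (le_of_eq ?_)
  rw [lintegral_const_mul' _ _ ENNReal.ofReal_ne_top]
  congr 1
  exact lintegral_add_right_eq_self (fun y : Hyperplane e => ∫⁻ t : ℝ, heightKernel K ‖h‖ σ t
    * gradSq e γ φ y t) ((σ ^ 2 / 2) • h)

theorem continuous_tent (hγ : Continuous γ) :
    Continuous fun p : Hyperplane e × Hyperplane e × ℝ => tent e γ p.1 p.2.1 p.2.2 := by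
  unfold tent lift
  fun_prop

theorem continuous_graphMap (hγ : Continuous γ) : Continuous (graphMap e γ) := by
  unfold graphMap lift
  fun_prop

/-- The increments of `φ` along one leg of the tents of width `h`, averaged over the foot `y` and
over the height `L` of the apex. The leg is parametrised by `σ²`: the weight `(2σ)²` cancels the
factor `σ⁻²` of `lintegral_gradSq_tent_le`, which would not be integrable at the foot. -/
theorem lintegral_tent_le (he : ‖e‖ = 1) (hγ : LipschitzWith K γ) {φ : Space d → ℝ}
    (hφ : ContDiff ℝ ∞ φ) {h : Hyperplane e} (hh : h ≠ 0) :
    ∫⁻ y : Hyperplane e, ∫⁻ L in Set.Icc ((K : ℝ) + 1) (K + 2),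
        ‖φ (graphMap e γ y + tent e γ y h L) - φ (graphMap e γ y)‖ₑ ^ 2
      ≤ ENNReal.ofReal (4 * (3 + 2 * K) ^ 2 * ‖h‖) * ∫⁻ σ in Set.Ioc (0 : ℝ) 1,
        ∫⁻ y : Hyperplane e, ∫⁻ t : ℝ, heightKernel K ‖h‖ σ t * gradSq e γ φ y t := by
  have hpos : 0 < ‖h‖ := norm_pos_iff.2 hh
  obtain ⟨M, hM⟩ : ∃ M : Hyperplane e → ℝ → ℝ → ENNReal, M = fun y L σ =>
    ENNReal.ofReal (4 * σ ^ 2 * ((3 + 2 * K) * ‖h‖) ^ 2)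
      * ‖∇ φ (graphMap e γ y + σ ^ 2 • tent e γ y h L)‖ₑ ^ 2 := ⟨_, rfl⟩
  have hMm : Measurable fun p : Hyperplane e × ℝ × ℝ => M p.1 p.2.1 p.2.2 := by
    have h1 : Continuous fun p : Hyperplane e × ℝ × ℝ =>
        ∇ φ (graphMap e γ p.1 + p.2.2 ^ 2 • tent e γ p.1 h p.2.1) := by
      have := continuous_graphMap (e := e) hγ.continuous
      have h2 : Continuous fun p : Hyperplane e × ℝ × ℝ => tent e γ p.1 h p.2.1 :=
        (continuous_tent (e := e) hγ.continuous).comp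
          (g := fun p => tent e γ p.1 p.2.1 p.2.2)
          (f := fun p : Hyperplane e × ℝ × ℝ => ((p.1, h, p.2.1) : Hyperplane e × Hyperplane e × ℝ))
          (by fun_prop)
      exact (continuous_gradient hφ).comp (by fun_prop)
    rw [hM]
    refine Measurable.mul ?_ (h1.enorm.measurable.pow_const 2)
    fun_prop
  calc _ ≤ ∫⁻ y : Hyperplane e, ∫⁻ L in Set.Icc ((K : ℝ) + 1) (K + 2),
        ∫⁻ σ in Set.Ioc (0 : ℝ) 1, M y L σ := by
        refine lintegral_mono fun y => setLIntegral_mono' measurableSet_Icc fun L hL => ?_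
        refine (enorm_sub_sq_le_lintegral hφ (s := fun σ => σ ^ 2) (s' := fun σ => 2 * σ)
          (fun σ => by simpa using hasDerivAt_pow 2 σ) (by fun_prop) (by simp) (by simp) _ _).trans ?_
        refine lintegral_mono fun σ => ?_
        simp only [hM]
        have := norm_tent_le he hγ y h hL
        gcongr
        nlinarith
    _ = ∫⁻ y : Hyperplane e, ∫⁻ σ in Set.Ioc (0 : ℝ) 1,
          ∫⁻ L in Set.Icc ((K : ℝ) + 1) (K + 2), M y L σ :=
        lintegral_congr fun y => lintegral_lintegral_swap
          (hMm.comp (g := fun p : Hyperplane e × ℝ × ℝ => M p.1 p.2.1 p.2.2)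
            (measurable_prodMk_left (x := y))).aemeasurable
    _ = ∫⁻ σ in Set.Ioc (0 : ℝ) 1, ∫⁻ y : Hyperplane e,
          ∫⁻ L in Set.Icc ((K : ℝ) + 1) (K + 2), M y L σ := by
        refine lintegral_lintegral_swap (Measurable.aemeasurable ?_)
        have h3 : Measurable fun q : (Hyperplane e × ℝ) × ℝ => M q.1.1 q.2 q.1.2 :=
          hMm.comp (g := fun p : Hyperplane e × ℝ × ℝ => M p.1 p.2.1 p.2.2)
            (f := fun q : (Hyperplane e × ℝ) × ℝ => (q.1.1, q.2, q.1.2)) (by fun_prop)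
        exact h3.lintegral_prod_right'
    _ ≤ ∫⁻ σ in Set.Ioc (0 : ℝ) 1, ENNReal.ofReal (4 * (3 + 2 * K) ^ 2 * ‖h‖)
          * ∫⁻ y : Hyperplane e, ∫⁻ t : ℝ, heightKernel K ‖h‖ σ t * gradSq e γ φ y t := by
        refine setLIntegral_mono' measurableSet_Ioc fun σ hσ => ?_
        simp only [hM]
        simp_rw [lintegral_const_mul' _ _ ENNReal.ofReal_ne_top]
        refine (mul_le_mul_right (lintegral_gradSq_tent_le hγ hφ hh hσ.1) _).trans (le_of_eq ?_)
        rw [← mul_assoc, ← ENNReal.ofReal_mul (by positivity)]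
        congr 2
        have : σ ≠ 0 := hσ.1.ne'
        field_simp
    _ = _ := lintegral_const_mul' _ _ ENNReal.ofReal_ne_top

end Graph

section GraphTrace

variable {d : ℕ} {e : Space d} {K : NNReal} {γ : Space d → ℝ}

/-- The integral over the widths `h` that reach a given height `t` at the fraction `σ²`. These `h`
lie in a shell of radius comparable to `ρ = t / σ²` in dimension `d - 1`, and the kernel `‖h‖ ·
‖h‖⁻ᵈ` has exactly the degree `-(d - 1)`, so that the bound does not depend on `t` and `σ`. -/
theorem lintegral_heightKernel_le (he : ‖e‖ = 1) (K : NNReal) {σ : ℝ} (hσ : 0 < σ) (t : ℝ) :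
    ∫⁻ h : Hyperplane e, ENNReal.ofReal (‖h‖ * (‖h‖ ^ d)⁻¹) * heightKernel K ‖h‖ σ t
      ≤ ENNReal.ofReal ((2 * K + 2) ^ (d - 1)) * volume (Metric.ball (0 : Hyperplane e) 1) := by
  have hc : (0 : ℝ) < 2 * K + 2 := by have := K.2; positivity
  set ρ : ℝ := t / σ ^ 2 with hρ
  have hd := one_le_dim he
  have hpt : ∀ h : Hyperplane e, ENNReal.ofReal (‖h‖ * (‖h‖ ^ d)⁻¹) * heightKernel K ‖h‖ σ t
      ≤ (Metric.closedBall (0 : Hyperplane e) ρ).indicator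
        (fun _ => ENNReal.ofReal (((2 * K + 2) / ρ) ^ (d - 1))) h := fun h => by
    by_cases hk : σ ^ 2 * ‖h‖ ≤ t ∧ t ≤ (2 * K + 2) * (σ ^ 2 * ‖h‖)
    swap
    · rw [heightKernel, Set.indicator_of_notMem (by exact hk), mul_zero]; exact zero_le
    rcases eq_or_ne h 0 with rfl | hh
    · simp
    have hpos : 0 < ‖h‖ := norm_pos_iff.2 hh
    have h1 : ‖h‖ ≤ ρ := by rw [hρ, le_div_iff₀ (by positivity), mul_comm]; exact hk.1
    have h2 : ρ ≤ (2 * K + 2) * ‖h‖ := by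
      rw [hρ, div_le_iff₀ (by positivity)]; linarith [hk.2]
    rw [heightKernel, Set.indicator_of_mem (by exact hk), Pi.one_apply, mul_one,
      Set.indicator_of_mem (mem_closedBall_zero_iff.2 h1)]
    refine ENNReal.ofReal_le_ofReal ?_
    have hρ0 : 0 < ρ := hpos.trans_le h1
    have h3 : ‖h‖ * (‖h‖ ^ d)⁻¹ = (‖h‖⁻¹) ^ (d - 1) := by
      obtain ⟨n, rfl⟩ : ∃ n, d = n + 1 := ⟨d - 1, by omega⟩
      rw [Nat.add_sub_cancel, pow_succ, inv_pow]
      field_simp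
    rw [h3]
    gcongr
    rw [inv_eq_one_div, div_le_div_iff₀ hpos hρ0]
    linarith
  refine (lintegral_mono hpt).trans ?_
  rw [lintegral_indicator Metric.isClosed_closedBall.measurableSet, setLIntegral_const]
  rcases lt_or_ge ρ 0 with h0 | h0
  · rw [Metric.closedBall_eq_empty.2 h0]; simp
  rw [Measure.addHaar_closedBall _ _ h0, finrank_hyperplane he, ← mul_assoc,
    ← ENNReal.ofReal_mul (by positivity)]
  gcongr
  rw [← mul_pow]
  refine pow_le_pow_left₀ (by positivity) ?_ _
  rcases h0.eq_or_lt with h0 | h0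
  · rw [← h0]; simpa using hc.le
  · rw [div_mul_cancel₀ _ h0.ne']

/-- The constant in the estimate of the tent increments. -/
def tentConst (e : Space d) (K : NNReal) : ENNReal :=
  ENNReal.ofReal (4 * (3 + 2 * K) ^ 2) *
    (ENNReal.ofReal ((2 * K + 2) ^ (d - 1)) * volume (Metric.ball (0 : Hyperplane e) 1))

theorem tentConst_ne_top : tentConst e K ≠ ⊤ :=
  ENNReal.mul_ne_top ENNReal.ofReal_ne_top
    (ENNReal.mul_ne_top ENNReal.ofReal_ne_top measure_ball_lt_top.ne)

/-- The increments along one leg of all tents, weighted with the kernel `‖h‖⁻ᵈ` of the `H^{1/2}`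
seminorm, are controlled by the gradient: integrate over `h` first. -/
theorem lintegral_lintegral_tent_le (he : ‖e‖ = 1) (hγ : LipschitzWith K γ) {φ : Space d → ℝ}
    (hφ : ContDiff ℝ ∞ φ) :
    ∫⁻ h : Hyperplane e, ENNReal.ofReal (‖h‖ ^ d)⁻¹ * ∫⁻ y : Hyperplane e,
        ∫⁻ L in Set.Icc ((K : ℝ) + 1) (K + 2),
        ‖φ (graphMap e γ y + tent e γ y h L) - φ (graphMap e γ y)‖ₑ ^ 2
      ≤ tentConst e K * ∫⁻ x, ‖∇ φ x‖ₑ ^ 2 := by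
  have hd := one_le_dim he
  obtain ⟨u, hu⟩ : ∃ u : Hyperplane e → ENNReal, u = fun h =>
    ENNReal.ofReal (‖h‖ * (‖h‖ ^ d)⁻¹) := ⟨_, rfl⟩
  obtain ⟨F, hF⟩ : ∃ F : Hyperplane e × ℝ → ENNReal, F = fun p => gradSq e γ φ p.1 p.2 := ⟨_, rfl⟩
  have hum : Measurable u := by rw [hu]; fun_prop
  have hFm : Measurable F := by rw [hF]; exact measurable_gradSq hφ hγ.continuous
  have hkm : Measurable fun q : Hyperplane e × ℝ × Hyperplane e × ℝ =>
      u q.1 * (heightKernel K ‖q.1‖ q.2.1 q.2.2.2 * F q.2.2) :=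
    (hum.comp measurable_fst).mul ((measurable_heightKernel (by fun_prop) (by fun_prop)
      (by fun_prop)).mul (hFm.comp (by fun_prop)))
  have hprod : ∀ (ℓ σ : ℝ), ∫⁻ y : Hyperplane e, ∫⁻ t : ℝ,
      heightKernel K ℓ σ t * gradSq e γ φ y t
      = ∫⁻ p : Hyperplane e × ℝ, heightKernel K ℓ σ p.2 * F p := fun ℓ σ => by
    have hm : Measurable fun p : Hyperplane e × ℝ => heightKernel K ℓ σ p.2 * F p :=
      (measurable_heightKernel measurable_const measurable_const measurable_snd).mul hFm
    rw [Measure.volume_eq_prod, lintegral_prod _ hm.aemeasurable, hF]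
  calc _ ≤ ∫⁻ h : Hyperplane e, ENNReal.ofReal (4 * (3 + 2 * K) ^ 2) *
        ∫⁻ σ in Set.Ioc (0 : ℝ) 1, ∫⁻ p : Hyperplane e × ℝ,
          u h * (heightKernel K ‖h‖ σ p.2 * F p) := by
        refine lintegral_mono fun h => ?_
        rcases eq_or_ne h 0 with rfl | hh
        · have : d ≠ 0 := by omega
          simp [this]
        refine (mul_le_mul_right (lintegral_tent_le he hγ hφ hh) _).trans (le_of_eq ?_)
        have h1 : ∀ σ : ℝ, ∫⁻ p : Hyperplane e × ℝ, u h * (heightKernel K ‖h‖ σ p.2 * F p)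
            = u h * ∫⁻ p : Hyperplane e × ℝ, heightKernel K ‖h‖ σ p.2 * F p := fun σ =>
          lintegral_const_mul' _ _ (by rw [hu]; exact ENNReal.ofReal_ne_top)
        simp_rw [h1, hprod]
        rw [lintegral_const_mul' _ _ (by rw [hu]; exact ENNReal.ofReal_ne_top), ← mul_assoc,
          ← mul_assoc, hu, ← ENNReal.ofReal_mul (by positivity), ← ENNReal.ofReal_mul (by positivity)]
        congr 2
        ring
    _ = ENNReal.ofReal (4 * (3 + 2 * K) ^ 2) * ∫⁻ h : Hyperplane e,
        ∫⁻ σ in Set.Ioc (0 : ℝ) 1, ∫⁻ p : Hyperplane e × ℝ,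
          u h * (heightKernel K ‖h‖ σ p.2 * F p) :=
        lintegral_const_mul' _ _ ENNReal.ofReal_ne_top
    _ = ENNReal.ofReal (4 * (3 + 2 * K) ^ 2) * ∫⁻ σ in Set.Ioc (0 : ℝ) 1,
        ∫⁻ p : Hyperplane e × ℝ, ∫⁻ h : Hyperplane e,
          u h * (heightKernel K ‖h‖ σ p.2 * F p) := by
        congr 1
        rw [lintegral_lintegral_swap]
        · refine lintegral_congr fun σ => lintegral_lintegral_swap ?_
          exact (hkm.comp (g := fun q : Hyperplane e × ℝ × Hyperplane e × ℝ =>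
              u q.1 * (heightKernel K ‖q.1‖ q.2.1 q.2.2.2 * F q.2.2))
            (f := fun q : Hyperplane e × (Hyperplane e × ℝ) => (q.1, σ, q.2))
            (by fun_prop)).aemeasurable
        · have h3 : Measurable fun q : (Hyperplane e × ℝ) × (Hyperplane e × ℝ) =>
              u q.1.1 * (heightKernel K ‖q.1.1‖ q.1.2 q.2.2 * F q.2) :=
            hkm.comp (g := fun q : Hyperplane e × ℝ × Hyperplane e × ℝ =>
              u q.1 * (heightKernel K ‖q.1‖ q.2.1 q.2.2.2 * F q.2.2))
              (f := fun q : (Hyperplane e × ℝ) × (Hyperplane e × ℝ) => (q.1.1, q.1.2, q.2))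
              (by fun_prop)
          exact h3.lintegral_prod_right'.aemeasurable
    _ ≤ ENNReal.ofReal (4 * (3 + 2 * K) ^ 2) * ∫⁻ _ in Set.Ioc (0 : ℝ) 1,
        ∫⁻ p : Hyperplane e × ℝ, (ENNReal.ofReal ((2 * K + 2) ^ (d - 1))
          * volume (Metric.ball (0 : Hyperplane e) 1)) * F p := by
        gcongr _ * ?_
        refine setLIntegral_mono' measurableSet_Ioc fun σ hσ => lintegral_mono fun p => ?_
        simp_rw [← mul_assoc]
        have hm : Measurable fun h : Hyperplane e => u h * heightKernel K ‖h‖ σ p.2 :=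
          hum.mul (measurable_heightKernel (by fun_prop) (by fun_prop) (by fun_prop))
        rw [lintegral_mul_const _ hm]
        gcongr
        rw [hu]
        exact lintegral_heightKernel_le he K hσ.1 p.2
    _ = _ := by
        rw [lintegral_const, lintegral_const_mul _ hFm, Measure.restrict_apply_univ,
          Real.volume_Ioc, sub_zero, ENNReal.ofReal_one, mul_one, Measure.volume_eq_prod,
          lintegral_prod _ hFm.aemeasurable, hF, lintegral_gradSq he hφ, tentConst]
        simp only [mul_assoc]

theorem enorm_sub_sq_le_two {E : Type*} [NormedAddCommGroup E] (a b m : E) :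
    ‖a - b‖ₑ ^ 2 ≤ 2 * ‖m - a‖ₑ ^ 2 + 2 * ‖m - b‖ₑ ^ 2 := by
  have h1 : ‖a - b‖ ≤ ‖m - a‖ + ‖m - b‖ := by
    rw [norm_sub_rev m a]
    simpa using norm_add_le (a - m) (m - b)
  have h2 : ‖a - b‖ ^ 2 ≤ 2 * ‖m - a‖ ^ 2 + 2 * ‖m - b‖ ^ 2 := by
    nlinarith [sq_nonneg (‖m - a‖ - ‖m - b‖), norm_nonneg (a - b), norm_nonneg (m - a),
      norm_nonneg (m - b)]
  simp only [← ofReal_norm]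
  rw [← ENNReal.ofReal_pow (norm_nonneg _), ← ENNReal.ofReal_pow (norm_nonneg _),
    ← ENNReal.ofReal_pow (norm_nonneg _), show (2 : ENNReal) = ENNReal.ofReal 2 by simp,
    ← ENNReal.ofReal_mul (by norm_num), ← ENNReal.ofReal_mul (by norm_num),
    ← ENNReal.ofReal_add (by positivity) (by positivity)]
  exact ENNReal.ofReal_le_ofReal h2

/-- The Gagliardo seminorm of `φ` on a Lipschitz graph, in the parametrisation over the
hyperplane, is controlled by the gradient of `φ`. -/
theorem lintegral_graph_seminorm_le (he : ‖e‖ = 1) (hγ : LipschitzWith K γ) {φ : Space d → ℝ}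
    (hφ : ContDiff ℝ ∞ φ) :
    ∫⁻ y : Hyperplane e, ∫⁻ z : Hyperplane e,
        ENNReal.ofReal (‖z - y‖ ^ d)⁻¹ * ‖φ (graphMap e γ y) - φ (graphMap e γ z)‖ₑ ^ 2
      ≤ 4 * tentConst e K * ∫⁻ x, ‖∇ φ x‖ₑ ^ 2 := by
  obtain ⟨J, hJ⟩ : ∃ J : Hyperplane e → Hyperplane e → ENNReal, J = fun y h =>
    ∫⁻ L in Set.Icc ((K : ℝ) + 1) (K + 2),
      ‖φ (graphMap e γ y + tent e γ y h L) - φ (graphMap e γ y)‖ₑ ^ 2 := ⟨_, rfl⟩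
  obtain ⟨w, hw⟩ : ∃ w : Hyperplane e → ENNReal, w = fun h =>
    ENNReal.ofReal (‖h‖ ^ d)⁻¹ := ⟨_, rfl⟩
  have hwm : Measurable w := by rw [hw]; fun_prop
  have hcont : Continuous fun q : (Hyperplane e × Hyperplane e) × ℝ =>
      φ (graphMap e γ q.1.1 + tent e γ q.1.1 q.1.2 q.2) - φ (graphMap e γ q.1.1) := by
    have h1 := continuous_graphMap (e := e) hγ.continuous
    have h2 : Continuous fun q : (Hyperplane e × Hyperplane e) × ℝ => tent e γ q.1.1 q.1.2 q.2 :=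
      (continuous_tent (e := e) hγ.continuous).comp
        (g := fun p => tent e γ p.1 p.2.1 p.2.2)
        (f := fun q : (Hyperplane e × Hyperplane e) × ℝ => (q.1.1, q.1.2, q.2)) (by fun_prop)
    have h3 := hφ.continuous
    fun_prop
  have hJm : Measurable fun p : Hyperplane e × Hyperplane e => J p.1 p.2 := by
    rw [hJ]
    exact (hcont.enorm.measurable.pow_const 2).lintegral_prod_right'
  have hJm' : Measurable fun p : Hyperplane e × Hyperplane e => w (p.2 - p.1) * J p.1 (p.2 - p.1) :=
    (hwm.comp (by fun_prop)).mul (hJm.comp (g := fun p : Hyperplane e × Hyperplane e => J p.1 p.2)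
      (f := fun p : Hyperplane e × Hyperplane e => (p.1, p.2 - p.1)) (by fun_prop))
  have hJm'' : Measurable fun p : Hyperplane e × Hyperplane e =>
      w (p.1 - p.2) * J p.2 (p.1 - p.2) :=
    hJm'.comp (g := fun p : Hyperplane e × Hyperplane e => w (p.2 - p.1) * J p.1 (p.2 - p.1))
      (f := Prod.swap) measurable_swap
  have hone : volume (Set.Icc ((K : ℝ) + 1) (K + 2)) = 1 := by
    rw [Real.volume_Icc]; norm_num
  -- the two legs of the tent over the segment from `y` to `z`
  have hpt : ∀ y z : Hyperplane e, w (z - y) * ‖φ (graphMap e γ y) - φ (graphMap e γ z)‖ₑ ^ 2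
      ≤ 2 * (w (z - y) * J y (z - y)) + 2 * (w (y - z) * J z (y - z)) := fun y z => by
    have hws : w (y - z) = w (z - y) := by rw [hw]; simp only [norm_sub_rev]
    have hb : ‖φ (graphMap e γ y) - φ (graphMap e γ z)‖ₑ ^ 2
        ≤ 2 * J y (z - y) + 2 * J z (y - z) := by
      have m1 : Measurable fun L => ‖φ (graphMap e γ y + tent e γ y (z - y) L)
          - φ (graphMap e γ y)‖ₑ ^ 2 :=
        (hcont.comp (Continuous.prodMk continuous_const continuous_id)
          (f := fun L : ℝ => ((y, z - y), L))).enorm.measurable.pow_const 2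
      have h1 : ‖φ (graphMap e γ y) - φ (graphMap e γ z)‖ₑ ^ 2
          = ∫⁻ _ in Set.Icc ((K : ℝ) + 1) (K + 2),
            ‖φ (graphMap e γ y) - φ (graphMap e γ z)‖ₑ ^ 2 := by
        rw [setLIntegral_const, hone, mul_one]
      rw [h1, hJ, ← lintegral_const_mul' _ _ (by norm_num), ← lintegral_const_mul' _ _ (by norm_num),
        ← lintegral_add_left (m1.const_mul 2)]
      refine lintegral_mono fun L => ?_
      have h2 := graphMap_add_tent_symm (γ := γ) y (z - y) L
      rw [add_sub_cancel, neg_sub] at h2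
      simp only [h2]
      exact enorm_sub_sq_le_two _ _ _
    rw [hws]
    refine (mul_le_mul_right hb _).trans (le_of_eq ?_)
    ring
  have hmain : ∫⁻ y : Hyperplane e, ∫⁻ z : Hyperplane e, w (z - y) * J y (z - y)
      ≤ tentConst e K * ∫⁻ x, ‖∇ φ x‖ₑ ^ 2 := by
    have h1 : ∀ y : Hyperplane e, ∫⁻ z : Hyperplane e, w (z - y) * J y (z - y)
        = ∫⁻ h : Hyperplane e, w h * J y h := fun y =>
      lintegral_sub_right_eq_self (fun h => w h * J y h) y
    simp_rw [h1]
    rw [lintegral_lintegral_swap ((hwm.comp measurable_snd).mul hJm).aemeasurable]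
    refine le_trans (le_of_eq ?_) (lintegral_lintegral_tent_le he hγ hφ)
    refine lintegral_congr fun h => ?_
    rw [lintegral_const_mul' _ _ (by rw [hw]; exact ENNReal.ofReal_ne_top), hw, hJ]
  have hswap : ∫⁻ y : Hyperplane e, ∫⁻ z : Hyperplane e, w (y - z) * J z (y - z)
      = ∫⁻ y : Hyperplane e, ∫⁻ z : Hyperplane e, w (z - y) * J y (z - y) :=
    lintegral_lintegral_swap hJm''.aemeasurable
  calc _ ≤ ∫⁻ y : Hyperplane e, ∫⁻ z : Hyperplane e,
        (2 * (w (z - y) * J y (z - y)) + 2 * (w (y - z) * J z (y - z))) := by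
        refine lintegral_mono fun y => lintegral_mono fun z => ?_
        have := hpt y z
        rw [hw] at this ⊢
        exact this
    _ = 2 * (∫⁻ y : Hyperplane e, ∫⁻ z : Hyperplane e, w (z - y) * J y (z - y))
        + 2 * ∫⁻ y : Hyperplane e, ∫⁻ z : Hyperplane e, w (y - z) * J z (y - z) := by
        have h1 : ∀ y : Hyperplane e, ∫⁻ z : Hyperplane e,
            (2 * (w (z - y) * J y (z - y)) + 2 * (w (y - z) * J z (y - z)))
            = 2 * (∫⁻ z : Hyperplane e, w (z - y) * J y (z - y))
              + 2 * ∫⁻ z : Hyperplane e, w (y - z) * J z (y - z) := fun y => by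
          have m1 : Measurable fun z => w (z - y) * J y (z - y) :=
            hJm'.comp (measurable_prodMk_left (x := y))
          rw [lintegral_add_left (m1.const_mul 2),
            lintegral_const_mul' _ _ (by norm_num), lintegral_const_mul' _ _ (by norm_num)]
        simp_rw [h1]
        have m2 : Measurable fun y => ∫⁻ z : Hyperplane e, w (z - y) * J y (z - y) :=
          hJm'.lintegral_prod_right'
        rw [lintegral_add_left (m2.const_mul 2),
          lintegral_const_mul' _ _ (by norm_num), lintegral_const_mul' _ _ (by norm_num)]
    _ ≤ _ := by
        rw [hswap, ← two_mul, ← mul_assoc, mul_assoc 4]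
        refine (mul_le_mul_right hmain _).trans (le_of_eq ?_)
        norm_num

end GraphTrace

section GraphMeasure

variable {d : ℕ} {e : Space d} {K : NNReal} {γ : Space d → ℝ}

/-- The surface measure on the graph of `γ`. -/
def graphMeasure (e : Space d) (γ : Space d → ℝ) : Measure (Space d) :=
  (Measure.euclideanHausdorffMeasure (d - 1) : Measure (Space d)).restrict (graph e γ)

set_option maxHeartbeats 800000 in
/-- The `L²` norm on the graph: the value at the graph differs from the values at heights `0 < t ≤
1` above it by an integral of the gradient, and one averages over `t`. -/
theorem lintegral_graph_sq_le (he : ‖e‖ = 1) (hγ : LipschitzWith K γ) {φ : Space d → ℝ}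
    (hφ : ContDiff ℝ ∞ φ) :
    ∫⁻ y : Hyperplane e, ‖φ (graphMap e γ y)‖ₑ ^ 2
      ≤ 2 * (∫⁻ x, ‖∇ φ x‖ₑ ^ 2) + 2 * ∫⁻ x, ‖φ x‖ₑ ^ 2 := by
  have hGm := measurable_gradSq (e := e) hφ hγ.continuous
  have hVm : Measurable fun p : Hyperplane e × ℝ => ‖φ (lift e p.1 (γ p.1 + p.2))‖ₑ ^ 2 := by
    have h1 := hφ.continuous
    have h2 := hγ.continuous
    have : Continuous fun p : Hyperplane e × ℝ => φ (lift e p.1 (γ p.1 + p.2)) := by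
      unfold lift; fun_prop
    exact this.enorm.measurable.pow_const 2
  have hpt : ∀ y : Hyperplane e, ∀ t ∈ Set.Ioc (0 : ℝ) 1, ‖φ (graphMap e γ y)‖ₑ ^ 2
      ≤ 2 * (∫⁻ τ, gradSq e γ φ y τ) + 2 * ‖φ (lift e y (γ y + t))‖ₑ ^ 2 := fun y t ht => by
    have h1 := enorm_sub_sq_le_two (φ (graphMap e γ y)) 0 (φ (lift e y (γ y + t)))
    rw [sub_zero, sub_zero] at h1
    refine h1.trans ?_
    gcongr
    have h2 : lift e y (γ y + t) = graphMap e γ y + t • e := by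
      simp only [graphMap, lift]; module
    have h3 : ∀ σ : ℝ, graphMap e γ y + σ • (t • e) = lift e y (γ y + (0 + t * σ)) := fun σ => by
      simp only [graphMap, lift]; module
    have h4 := enorm_sub_sq_le_lintegral hφ (s := fun σ => σ) (s' := fun _ => 1)
      (fun σ => hasDerivAt_id σ) continuous_const rfl rfl (graphMap e γ y) (t • e)
    rw [h2]
    refine h4.trans ?_
    simp only [h3, norm_smul, he, mul_one, one_pow, one_mul]
    rw [lintegral_const_mul' _ _ ENNReal.ofReal_ne_top]
    have h5 : ∫⁻ σ in Set.Ioc (0 : ℝ) 1, ‖∇ φ (lift e y (γ y + (0 + t * σ)))‖ₑ ^ 2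
        ≤ ENNReal.ofReal t⁻¹ * ∫⁻ τ, gradSq e γ φ y τ := by
      have hm : Measurable fun τ => gradSq e γ φ y τ := hGm.comp (g := fun p : Hyperplane e × ℝ => gradSq e γ φ p.1 p.2)
        (f := fun τ => (y, τ)) measurable_prodMk_left
      rw [← lintegral_comp_affine (b := 0) ht.1 hm]
      exact setLIntegral_le_lintegral _ _
    refine (mul_le_mul_right h5 _).trans ?_
    rw [← mul_assoc, ← ENNReal.ofReal_mul (by positivity)]
    refine mul_le_of_le_one_left zero_le ?_
    rw [ENNReal.ofReal_le_one, Real.norm_of_nonneg ht.1.le]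
    have := ht.1.ne'
    field_simp
    exact ht.2
  have hone : volume (Set.Ioc (0 : ℝ) 1) = 1 := by rw [Real.volume_Ioc]; norm_num
  calc ∫⁻ y : Hyperplane e, ‖φ (graphMap e γ y)‖ₑ ^ 2
      = ∫⁻ y : Hyperplane e, ∫⁻ _ in Set.Ioc (0 : ℝ) 1, ‖φ (graphMap e γ y)‖ₑ ^ 2 := by
        simp_rw [setLIntegral_const, hone, mul_one]
    _ ≤ ∫⁻ y : Hyperplane e, (2 * (∫⁻ τ, gradSq e γ φ y τ)
          + 2 * ∫⁻ t : ℝ, ‖φ (lift e y (γ y + t))‖ₑ ^ 2) := by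
        refine lintegral_mono fun y => ?_
        refine (setLIntegral_mono' measurableSet_Ioc (hpt y)).trans ?_
        rw [lintegral_add_left measurable_const, setLIntegral_const, hone, mul_one,
          lintegral_const_mul' _ _ (by norm_num)]
        gcongr
        exact Measure.restrict_le_self
    _ = _ := by
        have m1 : Measurable fun y : Hyperplane e => ∫⁻ τ, gradSq e γ φ y τ :=
          hGm.lintegral_prod_right'
        rw [lintegral_add_left (m1.const_mul 2), lintegral_const_mul' _ _ (by norm_num),
          lintegral_const_mul' _ _ (by norm_num), lintegral_gradSq he hφ,
          ← lintegral_eq_graph he γ (hφ.continuous.enorm.measurable.pow_const 2)]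

theorem lintegral_graphMeasure_le (he : ‖e‖ = 1) (hγ : LipschitzWith K γ) {F : Space d → ENNReal}
    (hF : Measurable F) : ∫⁻ x, F x ∂(graphMeasure e γ)
      ≤ ((1 + K : NNReal) ^ (d - 1) : NNReal) * ∫⁻ y : Hyperplane e, F (graphMap e γ y) := by
  refine (lintegral_mono' (measure_graph_le he hγ) le_rfl).trans ?_
  rw [lintegral_smul_measure, lintegral_map hF (continuous_graphMap hγ.continuous).measurable]
  rfl

/-- The integrand of the Gagliardo seminorm of `φ`. -/
def slobodeckij (φ : Space d → ℝ) (x y : Space d) : ENNReal :=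
  ‖(φ x - φ y) / ‖x - y‖ ^ ((d : ℝ) / 2)‖ₑ ^ 2

theorem measurable_slobodeckij {φ : Space d → ℝ} (hφ : Measurable φ) :
    Measurable fun p : Space d × Space d => slobodeckij φ p.1 p.2 := by
  unfold slobodeckij
  have : Measurable fun p : Space d × Space d =>
      (φ p.1 - φ p.2) / ‖p.1 - p.2‖ ^ ((d : ℝ) / 2) := by
    have h1 : Measurable fun p : Space d × Space d => φ p.1 := hφ.comp measurable_fst
    have h2 : Measurable fun p : Space d × Space d => φ p.2 := hφ.comp measurable_snd
    exact (h1.sub h2).div ((measurable_fst.sub measurable_snd).norm.pow_const _)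
  exact this.enorm.pow_const 2

theorem slobodeckij_le {φ : Space d → ℝ} {x y : Space d} {r : ℝ} (hr : 0 < r)
    (h : r ≤ ‖x - y‖) : slobodeckij φ x y ≤ ENNReal.ofReal (r ^ d)⁻¹ * ‖φ x - φ y‖ₑ ^ 2 := by
  have h0 : 0 < ‖x - y‖ := hr.trans_le h
  rw [slobodeckij, ← ofReal_norm, ← ofReal_norm, ← ENNReal.ofReal_pow (norm_nonneg _),
    ← ENNReal.ofReal_pow (norm_nonneg _), ← ENNReal.ofReal_mul (by positivity)]
  refine ENNReal.ofReal_le_ofReal ?_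
  have h1 : ‖‖x - y‖ ^ ((d : ℝ) / 2)‖ ^ 2 = ‖x - y‖ ^ d := by
    rw [Real.norm_of_nonneg (by positivity), ← Real.rpow_natCast, ← Real.rpow_mul h0.le]
    norm_num
  rw [norm_div, div_pow, h1, div_eq_inv_mul]
  gcongr

theorem slobodeckij_self (φ : Space d → ℝ) (x : Space d) : slobodeckij φ x x = 0 := by
  simp [slobodeckij]

/-- Projection to the hyperplane decreases distances. -/
theorem slobodeckij_graphMap_le (φ : Space d → ℝ) (y z : Hyperplane e) :
    slobodeckij φ (graphMap e γ y) (graphMap e γ z)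
      ≤ ENNReal.ofReal (‖z - y‖ ^ d)⁻¹ * ‖φ (graphMap e γ y) - φ (graphMap e γ z)‖ₑ ^ 2 := by
  rcases eq_or_ne z y with rfl | hne
  · rw [slobodeckij_self]; exact zero_le
  refine slobodeckij_le (norm_pos_iff.2 (sub_ne_zero.2 hne)) ?_
  have h1 : graphMap e γ y - graphMap e γ z = lift e (y - z) (γ y - γ z) := by
    simp only [graphMap, lift]; push_cast; module
  rw [h1, norm_sub_rev]
  exact norm_le_norm_lift _ _

theorem lintegral_lintegral_graphMeasure_le (he : ‖e‖ = 1) (hγ : LipschitzWith K γ)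
    {F : Space d → Space d → ENNReal} (hF : Measurable fun p : Space d × Space d => F p.1 p.2)
    {c : ENNReal} (hc : c = (((1 + K : NNReal) ^ (d - 1) : NNReal) : ENNReal)) :
    ∫⁻ x, ∫⁻ y, F x y ∂(graphMeasure e γ) ∂(graphMeasure e γ)
      ≤ c * (c * ∫⁻ y : Hyperplane e, ∫⁻ z : Hyperplane e,
          F (graphMap e γ y) (graphMap e γ z)) := by
  have hG : Measurable (graphMap e γ) := (continuous_graphMap hγ.continuous).measurable
  have hm1 : Measurable fun x => ∫⁻ z : Hyperplane e, F x (graphMap e γ z) := by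
    have : Measurable fun p : Space d × Hyperplane e => F p.1 (graphMap e γ p.2) :=
      hF.comp (g := fun p : Space d × Space d => F p.1 p.2)
        (f := fun p : Space d × Hyperplane e => (p.1, graphMap e γ p.2))
        (measurable_fst.prodMk (hG.comp measurable_snd))
    exact this.lintegral_prod_right'
  have h1 : ∀ x, ∫⁻ y, F x y ∂(graphMeasure e γ)
      ≤ c * ∫⁻ z : Hyperplane e, F x (graphMap e γ z) := fun x => by
    rw [hc]
    exact lintegral_graphMeasure_le (F := fun y => F x y) he hγ
      (hF.comp (g := fun p : Space d × Space d => F p.1 p.2)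
        (f := fun y => (x, y)) measurable_prodMk_left)
  refine (lintegral_mono h1).trans ?_
  have h2 := lintegral_graphMeasure_le he hγ (hm1.const_mul c)
  rw [← hc] at h2
  refine h2.trans (le_of_eq ?_)
  rw [lintegral_const_mul' _ _ (by rw [hc]; exact ENNReal.coe_ne_top)]

theorem lintegral_graphMeasure_slobodeckij_le (he : ‖e‖ = 1) (hγ : LipschitzWith K γ)
    {φ : Space d → ℝ} (hφ : ContDiff ℝ ∞ φ) :
    ∫⁻ x, ∫⁻ y, slobodeckij φ x y ∂(graphMeasure e γ) ∂(graphMeasure e γ)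
      ≤ ((1 + K : NNReal) ^ (d - 1) : NNReal) * (((1 + K : NNReal) ^ (d - 1) : NNReal) *
        (4 * tentConst e K * ∫⁻ x, ‖∇ φ x‖ₑ ^ 2)) := by
  refine (lintegral_lintegral_graphMeasure_le he hγ
    (measurable_slobodeckij hφ.continuous.measurable) rfl).trans ?_
  gcongr
  refine le_trans ?_ (lintegral_graph_seminorm_le he hγ hφ)
  gcongr with y z
  exact slobodeckij_graphMap_le φ y z

theorem isClosed_graph (hγ : Continuous γ) : IsClosed (graph e γ) :=
  isClosed_eq (by fun_prop) (by fun_prop)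

end GraphMeasure

/-! ### The trace inequality on a Lipschitz boundary -/

section Boundary

variable {d : ℕ} {Ω : Set (Space d)}

/-- Inside the ball of a chart, the boundary lies on the graph. -/
theorem frontier_inter_ball_subset_graph {e : Space d} {K : NNReal} {γ : Space d → ℝ} {x₀ : Space d}
    {r : ℝ} (hγ : LipschitzWith K γ)
    (h : ∀ x ∈ Metric.ball x₀ r, x ∈ Ω ↔ γ (x - inner ℝ x e • e) < inner ℝ x e) :
    frontier Ω ∩ Metric.ball x₀ r ⊆ graph e γ := by
  rintro x ⟨hx, hxr⟩
  have hcont : Continuous fun x : Space d => γ (x - inner ℝ x e • e) :=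
    hγ.continuous.comp (by fun_prop)
  have hcont2 : Continuous fun x : Space d => (inner ℝ x e : ℝ) := by fun_prop
  have hball : Metric.ball x₀ r ∈ 𝓝 x := Metric.isOpen_ball.mem_nhds hxr
  rcases lt_trichotomy (γ (x - inner ℝ x e • e)) (inner ℝ x e) with hlt | heq | hgt
  · refine absurd (mem_interior_iff_mem_nhds.2 ?_) hx.2
    filter_upwards [hball, hcont.continuousAt.eventually_lt hcont2.continuousAt hlt] with y h1 h2
    exact (h y h1).2 h2
  · exact heq.symm
  · refine absurd hx.1 ?_
    rw [mem_closure_iff_frequently, not_frequently]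
    filter_upwards [hball, hcont2.continuousAt.eventually_lt hcont.continuousAt hgt] with y h1 h2
    exact fun hy => lt_asymm ((h y h1).1 hy) h2

/-- A Lipschitz boundary of a bounded set is covered by finitely many Lipschitz graphs such that
any two points that are close enough lie on a common graph. -/
theorem exists_finite_charts (hb : Bornology.IsBounded Ω) (hΩ : HasLipschitzBoundary Ω) :
    ∃ (n : ℕ) (e : Fin n → Space d) (K : Fin n → NNReal) (γ : Fin n → Space d → ℝ) (δ : ℝ),
      0 < δ ∧ (∀ i, ‖e i‖ = 1) ∧ (∀ i, LipschitzWith (K i) (γ i)) ∧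
      ∀ x ∈ frontier Ω, ∃ i, frontier Ω ∩ Metric.ball x δ ⊆ graph (e i) (γ i) := by
  have hc : IsCompact (frontier Ω) := Metric.isCompact_of_isClosed_isBounded isClosed_frontier
    (hb.closure.subset frontier_subset_closure)
  choose! e r K γ he hr hγ h using hΩ
  obtain ⟨t, ht, hcov⟩ := hc.elim_nhds_subcover (fun x => Metric.ball x (r x))
    fun x hx => Metric.ball_mem_nhds x (hr x hx)
  obtain ⟨δ, hδ, hL⟩ := lebesgue_number_lemma_of_metric hc
    (c := fun i : t => Metric.ball (i : Space d) (r i)) (fun i => Metric.isOpen_ball)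
    (hcov.trans (by simp [Set.subset_def]))
  let f := t.equivFin.symm
  refine ⟨t.card, fun i => e (f i), fun i => K (f i), fun i => γ (f i), δ, hδ,
    fun i => he _ (ht _ (f i).2), fun i => hγ _ (ht _ (f i).2), fun x hx => ?_⟩
  obtain ⟨i, hi⟩ := hL x hx
  refine ⟨t.equivFin i, ?_⟩
  have hfi : f (t.equivFin i) = i := t.equivFin.symm_apply_apply i
  simp only [hfi]
  exact (Set.inter_subset_inter_right _ hi).trans
    (frontier_inter_ball_subset_graph (hγ _ (ht _ i.2)) (h _ (ht _ i.2)))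

/-- The square of the `H^1` norm of a smooth function, as a lower integral. -/
def energySq (φ : Space d → ℝ) : ENNReal := (∫⁻ x, ‖∇ φ x‖ₑ ^ 2) + ∫⁻ x, ‖φ x‖ₑ ^ 2

/-- The trace inequality `H^1 → L²(∂Ω)` for smooth functions. -/
theorem exists_lintegral_surface_sq_le (hb : Bornology.IsBounded Ω) (hΩ : HasLipschitzBoundary Ω) :
    ∃ C : ENNReal, C ≠ ⊤ ∧ ∀ φ : Space d → ℝ, ContDiff ℝ ∞ φ →
      ∫⁻ x, ‖φ x‖ₑ ^ 2 ∂(surfaceMeasure Ω) ≤ C * energySq φ := by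
  obtain ⟨n, e, K, γ, δ, hδ, he, hγ, hcov⟩ := exists_finite_charts hb hΩ
  refine ⟨∑ i, (((1 + K i : NNReal) ^ (d - 1) : NNReal) : ENNReal) * 2, ?_, fun φ hφ => ?_⟩
  · exact ENNReal.sum_ne_top.2 fun i _ => ENNReal.mul_ne_top ENNReal.coe_ne_top (by norm_num)
  have hsub : frontier Ω ⊆ ⋃ i, graph (e i) (γ i) := fun x hx => by
    obtain ⟨i, hi⟩ := hcov x hx
    exact Set.mem_iUnion.2 ⟨i, hi ⟨hx, Metric.mem_ball_self hδ⟩⟩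
  calc _ ≤ ∫⁻ x in ⋃ i, graph (e i) (γ i), ‖φ x‖ₑ ^ 2
          ∂(Measure.euclideanHausdorffMeasure (d - 1)) :=
        lintegral_mono_set hsub
    _ ≤ ∑ i, ∫⁻ x, ‖φ x‖ₑ ^ 2 ∂(graphMeasure (e i) (γ i)) := by
        refine (lintegral_iUnion_le _ _).trans ?_
        rw [tsum_fintype]
        rfl
    _ ≤ ∑ i, (((1 + K i : NNReal) ^ (d - 1) : NNReal) : ENNReal) * 2 * energySq φ := by
        refine Finset.sum_le_sum fun i _ => ?_
        refine (lintegral_graphMeasure_le (he i) (hγ i)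
          (hφ.continuous.enorm.measurable.pow_const 2)).trans ?_
        rw [mul_assoc, energySq, mul_add]
        gcongr
        exact lintegral_graph_sq_le (he i) (hγ i) hφ
    _ = _ := by rw [Finset.sum_mul]

theorem energySq_ne_top (φ : TestFn d) : energySq (φ : Space d → ℝ) ≠ ⊤ := by
  rw [energySq, ← eLpNorm_two_sq, ← eLpNorm_two_sq]
  exact ENNReal.add_ne_top.2 ⟨ENNReal.pow_ne_top (φ.memLp_gradient 2 volume).eLpNorm_ne_top,
    ENNReal.pow_ne_top (φ.memLp 2 volume).eLpNorm_ne_top⟩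

/-- The trace inequality for a test function that equals `1` on `∂Ω` bounds the area. -/
theorem isFiniteMeasure_surfaceMeasure (hb : Bornology.IsBounded Ω)
    (hΩ : HasLipschitzBoundary Ω) : IsFiniteMeasure (surfaceMeasure Ω) := by
  obtain ⟨C, hC, h⟩ := exists_lintegral_surface_sq_le hb hΩ
  obtain ⟨R, hR⟩ := hb.closure.exists_norm_le
  obtain ⟨n, hn⟩ := exists_nat_ge R
  have h1 := h _ (cutoff d n).contDiff
  refine ⟨lt_of_le_of_lt ?_ (ENNReal.mul_lt_top hC.lt_top (energySq_ne_top (cutoff d n)).lt_top)⟩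
  refine le_trans (le_of_eq ?_) h1
  have h2 : ∀ᵐ x ∂(surfaceMeasure Ω), ‖cutoff d n x‖ₑ ^ 2 = 1 := by
    rw [surfaceMeasure, ae_restrict_iff' isClosed_frontier.measurableSet]
    refine Eventually.of_forall fun x hx => ?_
    rw [cutoff_eq_one (by linarith [hR x (frontier_subset_closure hx)])]
    simp
  rw [lintegral_congr_ae h2, lintegral_one]

end Boundary

/-! ### The space `H^{1/2}(∂Ω)` and the trace operator -/

section Trace

variable {d : ℕ} {Ω : Set (Space d)}

/-- The Gagliardo seminorm on `∂Ω` is controlled by the `H^1` norm: close pairs of points lie on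
a common graph, and for distant pairs the kernel is bounded. -/
theorem exists_lintegral_surface_slobodeckij_le (hb : Bornology.IsBounded Ω)
    (hΩ : HasLipschitzBoundary Ω) :
    ∃ C : ENNReal, C ≠ ⊤ ∧ ∀ φ : Space d → ℝ, ContDiff ℝ ∞ φ →
      ∫⁻ p, slobodeckij φ p.1 p.2 ∂((surfaceMeasure Ω).prod (surfaceMeasure Ω))
        ≤ C * energySq φ := by
  have hfin := isFiniteMeasure_surfaceMeasure hb hΩ
  obtain ⟨C₀, hC₀, h₀⟩ := exists_lintegral_surface_sq_le hb hΩ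
  obtain ⟨n, e, K, γ, δ, hδ, he, hγ, hcov⟩ := exists_finite_charts hb hΩ
  obtain ⟨k, hk⟩ : ∃ k : ENNReal, k = ENNReal.ofReal (δ ^ d)⁻¹ * 2 := ⟨_, rfl⟩
  have hkt : k ≠ ⊤ := hk ▸ ENNReal.mul_ne_top ENNReal.ofReal_ne_top (by norm_num)
  obtain ⟨c, hc⟩ : ∃ c : Fin n → ENNReal, c = fun i => (((1 + K i : NNReal) ^ (d - 1) : NNReal) *
    (((1 + K i : NNReal) ^ (d - 1) : NNReal) * (4 * tentConst (e i) (K i)))) := ⟨_, rfl⟩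
  have hct : ∀ i, c i ≠ ⊤ := fun i => by
    rw [hc]
    exact ENNReal.mul_ne_top ENNReal.coe_ne_top (ENNReal.mul_ne_top ENNReal.coe_ne_top
      (ENNReal.mul_ne_top (by norm_num) tentConst_ne_top))
  obtain ⟨σ, hσ⟩ : ∃ σ, σ = surfaceMeasure Ω := ⟨_, rfl⟩
  rw [← hσ] at hfin h₀ ⊢
  refine ⟨(∑ i, c i) + k * σ Set.univ * (2 * C₀), ?_, fun φ hφ => ?_⟩
  · exact ENNReal.add_ne_top.2 ⟨ENNReal.sum_ne_top.2 fun i _ => hct i,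
      ENNReal.mul_ne_top (ENNReal.mul_ne_top hkt (measure_ne_top _ _))
        (ENNReal.mul_ne_top (by norm_num) hC₀)⟩
  have hm := measurable_slobodeckij (φ := φ) hφ.continuous.measurable
  have hmx : ∀ x, Measurable fun y => slobodeckij φ x y := fun x =>
    hm.comp (g := fun p : Space d × Space d => slobodeckij φ p.1 p.2)
      (f := fun y => (x, y)) measurable_prodMk_left
  have hφm : Measurable fun x => ‖φ x‖ₑ ^ 2 := hφ.continuous.enorm.measurable.pow_const 2
  have hgm : ∀ i, MeasurableSet (graph (e i) (γ i)) := fun i =>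
    (isClosed_graph (hγ i).continuous).measurableSet
  have hF : ∀ᵐ x ∂σ, x ∈ frontier Ω := by
    rw [hσ]; exact ae_restrict_mem isClosed_frontier.measurableSet
  have hrestr : ∀ i, σ.restrict (graph (e i) (γ i)) ≤ graphMeasure (e i) (γ i) := fun i => by
    rw [hσ]; exact Measure.restrict_mono_measure Measure.restrict_le_self _
  obtain ⟨J, hJ⟩ : ∃ J : Fin n → Space d → ENNReal, J = fun i =>
      (graph (e i) (γ i)).indicator fun x => ∫⁻ y in graph (e i) (γ i), slobodeckij φ x y ∂σ := ⟨_, rfl⟩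
  have hmG : ∀ i, Measurable fun x => ∫⁻ y in graph (e i) (γ i), slobodeckij φ x y ∂σ :=
    fun i => hm.lintegral_prod_right'
  have hpt : ∀ x ∈ frontier Ω, ∫⁻ y, slobodeckij φ x y ∂σ
      ≤ (∑ i, J i x) + ∫⁻ y, k * (‖φ x‖ₑ ^ 2 + ‖φ y‖ₑ ^ 2) ∂σ := fun x hx => by
    obtain ⟨i, hi⟩ := hcov x hx
    have hxi : x ∈ graph (e i) (γ i) := hi ⟨hx, Metric.mem_ball_self hδ⟩
    have h1 : ∀ᵐ y ∂σ, slobodeckij φ x y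
        ≤ (graph (e i) (γ i)).indicator (fun y => slobodeckij φ x y) y
          + k * (‖φ x‖ₑ ^ 2 + ‖φ y‖ₑ ^ 2) := by
      filter_upwards [hF] with y hy
      by_cases hd : dist y x < δ
      · rw [Set.indicator_of_mem (hi ⟨hy, hd⟩)]
        exact le_self_add
      · refine le_trans ?_ le_add_self
        rw [not_lt, dist_comm, dist_eq_norm] at hd
        refine (slobodeckij_le hδ hd).trans ?_
        rw [hk, mul_assoc, mul_add]
        gcongr
        have := enorm_sub_sq_le_two (φ x) (φ y) 0
        simpa using this
    refine (lintegral_mono_ae h1).trans ?_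
    rw [lintegral_add_left ((hmx x).indicator (hgm i)), lintegral_indicator (hgm i)]
    gcongr
    have h2 : J i x = ∫⁻ y in graph (e i) (γ i), slobodeckij φ x y ∂σ := by
      rw [hJ]; exact Set.indicator_of_mem hxi _
    rw [← h2]
    exact Finset.single_le_sum (f := fun i => J i x) (fun _ _ => zero_le) (Finset.mem_univ i)
  have hJm : ∀ i, Measurable (J i) := fun i => by
    rw [hJ]; exact (hmG i).indicator (hgm i)
  rw [lintegral_prod _ hm.aemeasurable]
  refine (lintegral_mono_ae (hF.mono hpt)).trans ?_
  rw [lintegral_add_left (Finset.measurable_sum _ fun i _ => hJm i),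
    lintegral_finsetSum _ fun i _ => hJm i, add_mul, Finset.sum_mul]
  refine add_le_add (Finset.sum_le_sum fun i _ => ?_) ?_
  · rw [hJ]
    simp only
    rw [lintegral_indicator (hgm i)]
    refine (lintegral_mono' (hrestr i) fun x => lintegral_mono' (hrestr i) le_rfl).trans ?_
    refine (lintegral_graphMeasure_slobodeckij_le (he i) (hγ i) hφ).trans ?_
    rw [hc]
    simp only [mul_assoc]
    gcongr
    exact le_self_add
  · simp_rw [lintegral_const_mul' k _ hkt]
    simp_rw [lintegral_add_left measurable_const, lintegral_const]
    rw [lintegral_add_left (hφm.mul_const _), lintegral_mul_const _ hφm, lintegral_const]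
    have h3 := h₀ φ hφ
    calc _ ≤ k * ((C₀ * energySq φ) * σ Set.univ + (C₀ * energySq φ) * σ Set.univ) := by gcongr
      _ = _ := by ring

/-- The difference quotient of the Slobodeckij seminorm. -/
def diffQuot (f : Space d → ℝ) (p : Space d × Space d) : ℝ :=
  (f p.1 - f p.2) / ‖p.1 - p.2‖ ^ ((d : ℝ) / 2)

theorem diffQuot_congr [SFinite (surfaceMeasure Ω)] {f g : Space d → ℝ}
    (h : f =ᵐ[surfaceMeasure Ω] g) :
    diffQuot f =ᵐ[(surfaceMeasure Ω).prod (surfaceMeasure Ω)] diffQuot g := by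
  filter_upwards [Measure.quasiMeasurePreserving_fst.ae_eq_comp h,
    Measure.quasiMeasurePreserving_snd.ae_eq_comp h] with p h1 h2
  simp only [Function.comp_apply] at h1 h2
  rw [diffQuot, diffQuot, h1, h2]

/-- Membership does not depend on the representative of the boundary values. -/
theorem mem_sobolevHalf_iff [SFinite (surfaceMeasure Ω)] {w : WithLp 2 (L2Boundary Ω ×
      Lp ℝ 2 ((surfaceMeasure Ω).prod (surfaceMeasure Ω)))} :
    w ∈ sobolevHalf Ω ↔
      w.snd =ᵐ[(surfaceMeasure Ω).prod (surfaceMeasure Ω)] diffQuot (w.fst : Space d → ℝ) := by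
  refine ⟨fun ⟨f, h1, h2⟩ => h2.trans (diffQuot_congr h1.symm), fun h => ⟨_, EventuallyEq.rfl, h⟩⟩

theorem HHalf.toL2_injective [SFinite (surfaceMeasure Ω)] :
    Function.Injective (HHalf.toL2 Ω) := by
  refine (injective_iff_map_eq_zero _).2 fun w hw => ?_
  have h0 : w.1.fst = 0 := hw
  have h1 := mem_sobolevHalf_iff.1 w.2
  have h2 : w.1.snd = 0 := by
    refine Lp.ext (h1.trans ((diffQuot_congr (g := 0) ?_).trans ?_))
    · rw [h0]; exact Lp.coeFn_zero _ _ _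
    · refine EventuallyEq.trans (Eventually.of_forall fun p => ?_) (Lp.coeFn_zero _ _ _).symm
      simp [diffQuot]
  exact Subtype.ext (WithLp.ofLp_injective 2 (Prod.ext h0 h2))

theorem isClosed_sobolevHalf [SFinite (surfaceMeasure Ω)] :
    IsClosed (sobolevHalf Ω : Set (WithLp 2 (L2Boundary Ω ×
      Lp ℝ 2 ((surfaceMeasure Ω).prod (surfaceMeasure Ω))))) := by
  refine IsSeqClosed.isClosed fun w w₀ hw hlim => mem_sobolevHalf_iff.2 ?_
  have hf : Tendsto (fun n => (w n).fst) atTop (𝓝 w₀.fst) :=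
    ((WithLp.fstL 2 ℝ (L2Boundary Ω) _).continuous.tendsto w₀).comp hlim
  have hs : Tendsto (fun n => (w n).snd) atTop (𝓝 w₀.snd) :=
    ((WithLp.sndL 2 ℝ (L2Boundary Ω) _).continuous.tendsto w₀).comp hlim
  obtain ⟨a, ha, hfa⟩ := (tendstoInMeasure_of_tendsto_Lp hf).exists_seq_tendsto_ae
  obtain ⟨b, hb, hsb⟩ := (tendstoInMeasure_of_tendsto_Lp
    (hs.comp ha.tendsto_atTop)).exists_seq_tendsto_ae
  filter_upwards [hsb, Measure.quasiMeasurePreserving_fst.ae hfa,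
    Measure.quasiMeasurePreserving_snd.ae hfa,
    ae_all_iff.2 fun n => mem_sobolevHalf_iff.1 (hw n)] with p h1 h2 h3 h4
  refine tendsto_nhds_unique h1 ?_
  simp only [h4, Function.comp_apply]
  exact ((h2.comp hb.tendsto_atTop).sub (h3.comp hb.tendsto_atTop)).div_const _

theorem completeSpace_HHalf [SFinite (surfaceMeasure Ω)] : CompleteSpace (HHalf Ω) :=
  isClosed_sobolevHalf.completeSpace_coe

theorem memLp_two_of_lintegral {α : Type*} [MeasurableSpace α] {μ : Measure α} {f : α → ℝ}
    (hf : AEStronglyMeasurable f μ) (h : ∫⁻ x, ‖f x‖ₑ ^ 2 ∂μ ≠ ⊤) : MemLp f 2 μ := by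
  refine ⟨hf, lt_top_iff_ne_top.2 fun htop => h ?_⟩
  rw [← eLpNorm_two_sq, htop]; rfl

theorem energySq_eq (φ : TestFn d) :
    energySq (φ : Space d → ℝ) = ENNReal.ofReal (‖H1.ofTest φ‖ ^ 2) := by
  have h1 : ENNReal.ofReal (‖H1.toL2 d (H1.ofTest φ)‖ ^ 2) = ∫⁻ x, ‖φ x‖ₑ ^ 2 := by
    rw [← eLpNorm_two_sq, ENNReal.ofReal_pow (norm_nonneg _), ofReal_norm, Lp.enorm_def,
      eLpNorm_congr_ae (H1.coeFn_toL2_ofTest φ)]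
  have h2 : ENNReal.ofReal (‖H1.grad d (H1.ofTest φ)‖ ^ 2)
      = ∫⁻ x, ‖∇ (φ : Space d → ℝ) x‖ₑ ^ 2 := by
    rw [← eLpNorm_two_sq, ENNReal.ofReal_pow (norm_nonneg _), ofReal_norm, Lp.enorm_def,
      eLpNorm_congr_ae (H1.coeFn_grad_ofTest φ)]
  rw [energySq, H1.norm_sq_eq, ENNReal.ofReal_add (by positivity) (by positivity), h1, h2, add_comm]

/-- The trace theorem `H^1(ℝ^d) → H^{1/2}(∂Ω)`. -/
theorem exists_trace (hb : Bornology.IsBounded Ω) (hΩ : HasLipschitzBoundary Ω) :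
    ∃ tr : H1 d →L[ℝ] HHalf Ω, ∀ φ : TestFn d,
      HHalf.toL2 Ω (tr (H1.ofTest φ)) =ᵐ[surfaceMeasure Ω] (φ : Space d → ℝ) := by
  have hfin := isFiniteMeasure_surfaceMeasure hb hΩ
  have := completeSpace_HHalf (Ω := Ω)
  obtain ⟨C₁, hC₁, h₁⟩ := exists_lintegral_surface_sq_le hb hΩ
  obtain ⟨C₂, hC₂, h₂⟩ := exists_lintegral_surface_slobodeckij_le hb hΩ
  have m1 : ∀ φ : TestFn d, MemLp (φ : Space d → ℝ) 2 (surfaceMeasure Ω) := fun φ => φ.memLp 2 _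
  have m2 : ∀ φ : TestFn d, MemLp (diffQuot (φ : Space d → ℝ)) 2
      ((surfaceMeasure Ω).prod (surfaceMeasure Ω)) := fun φ => by
    refine memLp_two_of_lintegral ?_ (ne_top_of_le_ne_top
      (ENNReal.mul_ne_top hC₂ (energySq_ne_top φ)) (h₂ φ φ.contDiff))
    have h1 : Measurable fun p : Space d × Space d => φ p.1 :=
      φ.contDiff.continuous.measurable.comp measurable_fst
    have h2 : Measurable fun p : Space d × Space d => φ p.2 :=
      φ.contDiff.continuous.measurable.comp measurable_snd
    exact ((h1.sub h2).div ((measurable_fst.sub measurable_snd).norm.pow_const _)).aestronglyMeasurable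
  have hmem : ∀ φ : TestFn d, (WithLp.toLp 2 ((m1 φ).toLp _, (m2 φ).toLp _) : WithLp 2
      (L2Boundary Ω × Lp ℝ 2 ((surfaceMeasure Ω).prod (surfaceMeasure Ω)))) ∈ sobolevHalf Ω :=
    fun φ => ⟨φ, (m1 φ).coeFn_toLp, (m2 φ).coeFn_toLp⟩
  let T₀ : TestFn d →ₗ[ℝ] HHalf Ω :=
    { toFun := fun φ => ⟨_, hmem φ⟩
      map_add' := fun φ ψ => HHalf.toL2_injective rfl
      map_smul' := fun r φ => HHalf.toL2_injective rfl }
  have hT₀ : ∀ φ : TestFn d, HHalf.toL2 Ω (T₀ φ) =ᵐ[surfaceMeasure Ω] (φ : Space d → ℝ) :=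
    fun φ => (m1 φ).coeFn_toLp
  have hbound : ∀ φ : TestFn d, ‖T₀ φ‖ ≤ √((C₁ + C₂).toReal) * ‖H1.ofTest φ‖ := fun φ => by
    have hsq : ‖T₀ φ‖ ^ 2 = ‖(m1 φ).toLp _‖ ^ 2 + ‖(m2 φ).toLp _‖ ^ 2 :=
      WithLp.prod_norm_sq_eq_of_L2 _
    rw [← abs_of_nonneg (norm_nonneg (T₀ φ)), ← abs_of_nonneg (a := √_ * _) (by positivity),
      ← sq_le_sq, mul_pow, Real.sq_sqrt ENNReal.toReal_nonneg, hsq]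
    refine (ENNReal.ofReal_le_ofReal_iff (by positivity)).1 ?_
    rw [ENNReal.ofReal_add (by positivity) (by positivity), ENNReal.ofReal_mul
      ENNReal.toReal_nonneg, ENNReal.ofReal_toReal (ENNReal.add_ne_top.2 ⟨hC₁, hC₂⟩),
      ← energySq_eq, add_mul, ENNReal.ofReal_pow (norm_nonneg _), ENNReal.ofReal_pow (norm_nonneg _),
      ofReal_norm, ofReal_norm, Lp.enorm_toLp, Lp.enorm_toLp, eLpNorm_two_sq, eLpNorm_two_sq]
    exact add_le_add (h₁ φ φ.contDiff) (h₂ φ φ.contDiff)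
  refine ⟨T₀.extendOfNorm H1.ofTest, fun φ => ?_⟩
  rw [LinearMap.extendOfNorm_eq denseRange_ofTest ⟨_, hbound⟩]
  exact hT₀ φ

theorem exists_seq_test_tendsto (u : H1 d) :
    ∃ φ : ℕ → TestFn d, Tendsto (fun n => H1.ofTest (φ n)) atTop (𝓝 u) := by
  obtain ⟨x, hx, hlim⟩ := mem_closure_iff_seq_limit.1 (denseRange_ofTest u)
  choose φ hφ using hx
  exact ⟨φ, by simpa only [hφ] using hlim⟩

theorem tendsto_toLp_iff {α E : Type*} [MeasurableSpace α] [NormedAddCommGroup E] {μ : Measure α}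
    {f : ℕ → α → E} {F : ℕ → Lp E 2 μ} (hF : ∀ n, F n =ᵐ[μ] f n) (F₀ : Lp E 2 μ) :
    Tendsto F atTop (𝓝 F₀) ↔ Tendsto (fun n => eLpNorm (fun x => f n x - F₀ x) 2 μ) atTop (𝓝 0) := by
  rw [Lp.tendsto_Lp_iff_tendsto_eLpNorm']
  refine tendsto_congr fun n => eLpNorm_congr_ae ?_
  filter_upwards [hF n] with x hx
  rw [Pi.sub_apply, hx]

/-- The relation `IsTrace` is the graph of the trace operator. Hence traces exist and are unique. -/
theorem isTrace_iff {tr : H1 d →L[ℝ] HHalf Ω}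
    (htr : ∀ φ : TestFn d,
      HHalf.toL2 Ω (tr (H1.ofTest φ)) =ᵐ[surfaceMeasure Ω] (φ : Space d → ℝ))
    (u : H1 d) (f : L2Boundary Ω) : IsTrace Ω u f ↔ f = HHalf.toL2 Ω (tr u) := by
  constructor
  · rintro ⟨φ, hφ, h1, h2, h3⟩
    let ψ : ℕ → TestFn d := fun n => ⟨φ n, hφ n⟩
    have hu : Tendsto (fun n => H1.ofTest (ψ n)) atTop (𝓝 u) := H1.tendsto_iff.2
      ⟨(tendsto_toLp_iff (fun n => H1.coeFn_toL2_ofTest (ψ n)) _).2 h1,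
        (tendsto_toLp_iff (fun n => H1.coeFn_grad_ofTest (ψ n)) _).2 h2⟩
    refine tendsto_nhds_unique ((tendsto_toLp_iff (fun n => htr (ψ n)) f).2 h3) ?_
    exact (((HHalf.toL2 Ω).comp tr).continuous.tendsto u).comp hu
  · rintro rfl
    obtain ⟨φ, hφ⟩ := exists_seq_test_tendsto u
    have h := H1.tendsto_iff.1 hφ
    exact ⟨fun n => φ n, fun n => (φ n).2,
      (tendsto_toLp_iff (fun n => H1.coeFn_toL2_ofTest (φ n)) _).1 h.1,
      (tendsto_toLp_iff (fun n => H1.coeFn_grad_ofTest (φ n)) _).1 h.2,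
      (tendsto_toLp_iff (fun n => htr (φ n)) _).1
        ((((HHalf.toL2 Ω).comp tr).continuous.tendsto u).comp hφ)⟩

/-- Cutting off away from `∂Ω` leaves no trace. -/
theorem trace_mul_eq_zero [SFinite (surfaceMeasure Ω)] {tr : H1 d →L[ℝ] HHalf Ω}
    (htr : ∀ φ : TestFn d,
      HHalf.toL2 Ω (tr (H1.ofTest φ)) =ᵐ[surfaceMeasure Ω] (φ : Space d → ℝ))
     (χ : TestFn d)
    (hχ : ∀ x ∈ frontier Ω, χ x = 0) (u : H1 d) : tr (H1.mul χ u) = 0 := by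
  refine denseRange_ofTest.induction_on u (p := fun u => tr (H1.mul χ u) = 0)
    (isClosed_eq (by fun_prop) continuous_const) fun φ => HHalf.toL2_injective ?_
  rw [map_zero, H1.mul_ofTest]
  refine Lp.ext ((htr _).trans (EventuallyEq.trans ?_ (Lp.coeFn_zero _ _ _).symm))
  filter_upwards [ae_restrict_mem (μ := (Measure.euclideanHausdorffMeasure (d - 1) :
    Measure (Space d))) (s := frontier Ω) isClosed_frontier.measurableSet] with x hx
  rw [TestFn.mul_apply, hχ x hx, zero_mul, Pi.zero_apply]

end Trace

/-! ### Primitives of vector-valued functions of time -/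

section Time

variable {E F G : Type*} [NormedAddCommGroup E] [NormedSpace ℝ E] [NormedAddCommGroup F]
  [NormedSpace ℝ F] [NormedAddCommGroup G] [NormedSpace ℝ G] {T : ℝ}

instance : IsFiniteMeasure (timeMeasure T) := by unfold timeMeasure; infer_instance

theorem integral_timeMeasure (hT : 0 ≤ T) (f : ℝ → E) :
    ∫ t, f t ∂(timeMeasure T) = ∫ t in 0..T, f t := by
  rw [timeMeasure, integral_Icc_eq_integral_Ioc, intervalIntegral.integral_of_le hT]

theorem ae_mem_Icc : ∀ᵐ t ∂(timeMeasure T), t ∈ Set.Icc 0 T :=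
  ae_restrict_mem measurableSet_Icc

theorem intervalIntegrable_of_time {X : Type*} [NormedAddCommGroup X] {f : ℝ → X}
    (hf : Integrable f (timeMeasure T)) {s t : ℝ}
    (hs : s ∈ Set.Icc 0 T) (ht : t ∈ Set.Icc 0 T) : IntervalIntegrable f volume s t := by
  rw [intervalIntegrable_iff]
  exact IntegrableOn.mono_set (t := Set.Icc 0 T) hf
    (Set.uIoc_subset_uIcc.trans (Set.uIcc_subset_Icc hs ht))

theorem integrable_bilin (B : E →L[ℝ] F →L[ℝ] G) {x : ℝ → E} {y : ℝ → F}
    (hx : Integrable x (timeMeasure T)) (hy : ContinuousOn y (Set.Icc 0 T)) :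
    Integrable (fun t => B (x t) (y t)) (timeMeasure T) := by
  obtain ⟨C, hC⟩ := isCompact_Icc.exists_bound_of_continuousOn hy
  refine (hx.norm.const_mul (‖B‖ * C)).mono'
    (B.aestronglyMeasurable_comp₂ hx.1 (hy.aestronglyMeasurable measurableSet_Icc)) ?_
  filter_upwards [ae_mem_Icc] with t ht
  refine (B.le_opNorm₂ _ _).trans ?_
  nlinarith [mul_le_mul_of_nonneg_left (hC t ht) (mul_nonneg (norm_nonneg B) (norm_nonneg (x t)))]

/-- `u` is absolutely continuous on `[0,T]` with integrable derivative `u'`. -/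
structure IsPrimitive (T : ℝ) (u u' : ℝ → E) : Prop where
  integrable : Integrable u' (timeMeasure T)
  eq : ∀ t ∈ Set.Icc 0 T, u t = u 0 + ∫ s in 0..t, u' s

theorem continuousOn_primitive {u' : ℝ → E} (h : Integrable u' (timeMeasure T)) :
    ContinuousOn (fun t => ∫ s in 0..t, u' s) (Set.Icc 0 T) :=
  (intervalIntegral.continuousOn_primitive (a := 0) (b := T) h).congr fun t ht => by
    rw [intervalIntegral.integral_of_le ht.1]

theorem isPrimitive_integral {u' : ℝ → E} (h : Integrable u' (timeMeasure T)) :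
    IsPrimitive T (fun t => ∫ s in 0..t, u' s) u' :=
  ⟨h, fun t _ => by simp⟩

namespace IsPrimitive

variable {u u' v v' : ℝ → E} {w w' : ℝ → F}

theorem continuousOn (h : IsPrimitive T u u') : ContinuousOn u (Set.Icc 0 T) :=
  (continuousOn_const.add (continuousOn_primitive h.integrable)).congr h.eq

theorem memLp (h : IsPrimitive T u u') (p : ENNReal) : MemLp u p (timeMeasure T) := by
  obtain ⟨C, hC⟩ := isCompact_Icc.exists_bound_of_continuousOn h.continuousOn
  refine MemLp.of_bound (h.continuousOn.aestronglyMeasurable measurableSet_Icc) C ?_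
  filter_upwards [ae_mem_Icc] with t ht using hC t ht

theorem of_hasDerivAt [CompleteSpace E] (h : ∀ t, HasDerivAt u (u' t) t) (hc : Continuous u') :
    IsPrimitive T u u' where
  integrable := hc.continuousOn.integrableOn_compact isCompact_Icc
  eq t _ := by
    rw [intervalIntegral.integral_eq_sub_of_hasDerivAt (fun s _ => h s)
      (hc.intervalIntegrable _ _)]
    abel

theorem add (h : IsPrimitive T u u') (h' : IsPrimitive T v v') :
    IsPrimitive T (fun t => u t + v t) (fun t => u' t + v' t) where
  integrable := h.integrable.add h'.integrable
  eq t ht := by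
    have h0 : (0 : ℝ) ∈ Set.Icc 0 T := ⟨le_rfl, ht.1.trans ht.2⟩
    rw [h.eq t ht, h'.eq t ht, intervalIntegral.integral_add
      (intervalIntegrable_of_time h.integrable h0 ht)
      (intervalIntegrable_of_time h'.integrable h0 ht)]
    abel

variable [CompleteSpace E] [CompleteSpace F] [CompleteSpace G]

theorem clm_comp (h : IsPrimitive T u u') (L : E →L[ℝ] F) :
    IsPrimitive T (fun t => L (u t)) (fun t => L (u' t)) where
  integrable := L.integrable_comp h.integrable
  eq t ht := by
    have h0 : (0 : ℝ) ∈ Set.Icc 0 T := ⟨le_rfl, ht.1.trans ht.2⟩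
    rw [L.intervalIntegral_comp_comm (intervalIntegrable_of_time h.integrable h0 ht), ← map_add,
      h.eq t ht]

/-- The product of two primitives that vanish at `0`, by Fubini's theorem on the two triangles
of the square `[0,t]²`. -/
theorem bilin_integral_integral (B : E →L[ℝ] F →L[ℝ] G) {f : ℝ → E} {g : ℝ → F}
    (hf : Integrable f (timeMeasure T)) (hg : Integrable g (timeMeasure T)) {t : ℝ}
    (ht : t ∈ Set.Icc 0 T) :
    B (∫ s in 0..t, f s) (∫ s in 0..t, g s)
      = (∫ s in 0..t, B (f s) (∫ r in 0..s, g r)) + ∫ s in 0..t, B (∫ r in 0..s, f r) (g s) := by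
  have h0 : (0 : ℝ) ∈ Set.Icc 0 T := ⟨le_rfl, ht.1.trans ht.2⟩
  obtain ⟨μ, hμ⟩ : ∃ μ : Measure ℝ, μ = volume.restrict (Set.Ioc 0 t) := ⟨_, rfl⟩
  have hf' : Integrable f μ := hμ ▸ (intervalIntegrable_iff_integrableOn_Ioc_of_le ht.1).1
    (intervalIntegrable_of_time hf h0 ht)
  have hg' : Integrable g μ := hμ ▸ (intervalIntegrable_iff_integrableOn_Ioc_of_le ht.1).1
    (intervalIntegrable_of_time hg h0 ht)
  have hμs : SFinite μ := by rw [hμ]; infer_instance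
  have hI : Integrable (fun p : ℝ × ℝ => B (f p.1) (g p.2)) (μ.prod μ) :=
    hf'.op_fst_snd (op := fun x y => B x y) (by fun_prop) ⟨‖B‖, B.le_opNorm₂⟩ hg'
  have hmem : ∀ᵐ s ∂μ, s ∈ Set.Ioc 0 t := by rw [hμ]; exact ae_restrict_mem measurableSet_Ioc
  obtain ⟨S, hS⟩ : ∃ S : Set (ℝ × ℝ), S = {p | p.2 ≤ p.1} := ⟨_, rfl⟩
  have hSm : MeasurableSet S := hS ▸ measurableSet_le measurable_snd measurable_fst
  have e1 : ∫ p in S, B (f p.1) (g p.2) ∂(μ.prod μ) = ∫ s, B (f s) (∫ r in 0..s, g r) ∂μ := by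
    rw [← integral_indicator hSm, integral_prod _ (hI.indicator hSm)]
    refine integral_congr_ae ?_
    filter_upwards [hmem] with s hs
    have h1 : ∀ r, S.indicator (fun p => B (f p.1) (g p.2)) (s, r)
        = B (f s) ((Set.Iic s).indicator g r) := fun r => by
      by_cases h : r ≤ s
      · rw [Set.indicator_of_mem (by rw [hS]; exact h), Set.indicator_of_mem (by exact h)]
      · rw [Set.indicator_of_notMem (by rw [hS]; exact h),
          Set.indicator_of_notMem (by exact h), map_zero]
    simp_rw [h1]
    rw [(B (f s)).integral_comp_comm (hg'.indicator measurableSet_Iic),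
      integral_indicator measurableSet_Iic, intervalIntegral.integral_of_le hs.1.le, hμ,
      Measure.restrict_restrict measurableSet_Iic, Set.inter_comm, Set.Ioc_inter_Iic,
      min_eq_right hs.2]
  have e2 : ∫ p in Sᶜ, B (f p.1) (g p.2) ∂(μ.prod μ) = ∫ r, B (∫ s in 0..r, f s) (g r) ∂μ := by
    rw [← integral_indicator hSm.compl, integral_prod_symm _ (hI.indicator hSm.compl)]
    refine integral_congr_ae ?_
    filter_upwards [hmem] with r hr
    have h1 : ∀ s, Sᶜ.indicator (fun p => B (f p.1) (g p.2)) (s, r)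
        = B.flip (g r) ((Set.Iio r).indicator f s) := fun s => by
      by_cases h : s < r
      · rw [Set.indicator_of_mem (by rw [hS]; simpa using h), Set.indicator_of_mem (by exact h)]
        rfl
      · rw [Set.indicator_of_notMem (by rw [hS]; simpa using h),
          Set.indicator_of_notMem (by exact h), map_zero]
    simp_rw [h1]
    rw [(B.flip (g r)).integral_comp_comm (hf'.indicator measurableSet_Iio),
      integral_indicator measurableSet_Iio, intervalIntegral.integral_of_le hr.1.le, hμ,
      Measure.restrict_restrict measurableSet_Iio, integral_Ioc_eq_integral_Ioo]
    have : Set.Iio r ∩ Set.Ioc 0 t = Set.Ioo 0 r := by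
      ext s; simp only [Set.mem_inter_iff, Set.mem_Iio, Set.mem_Ioc, Set.mem_Ioo]
      exact ⟨fun h => ⟨h.2.1, h.1⟩, fun h => ⟨h.2, h.1, h.2.le.trans hr.2⟩⟩
    rw [this]
    rfl
  rw [intervalIntegral.integral_of_le ht.1, intervalIntegral.integral_of_le ht.1,
    intervalIntegral.integral_of_le ht.1, intervalIntegral.integral_of_le ht.1, ← hμ, ← e1, ← e2,
    integral_add_compl hSm hI, integral_prod_bilin B hf' hg']

/-- The product rule for absolutely continuous functions. -/
theorem bilin (B : E →L[ℝ] F →L[ℝ] G) (hu : IsPrimitive T u u') (hw : IsPrimitive T w w') :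
    IsPrimitive T (fun t => B (u t) (w t)) (fun t => B (u' t) (w t) + B (u t) (w' t)) := by
  have i1 := integrable_bilin B hu.integrable hw.continuousOn
  have i2 := integrable_bilin B.flip hw.integrable hu.continuousOn
  simp only [ContinuousLinearMap.flip_apply] at i2
  refine ⟨i1.add i2, fun t ht => ?_⟩
  have h0 : (0 : ℝ) ∈ Set.Icc 0 T := ⟨le_rfl, ht.1.trans ht.2⟩
  have j1 := integrable_bilin B hu.integrable (continuousOn_primitive hw.integrable)
  have j2 := integrable_bilin B.flip hw.integrable (continuousOn_primitive hu.integrable)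
  simp only [ContinuousLinearMap.flip_apply] at j2
  have k1 : Integrable (fun t => B (u' t) (w 0)) (timeMeasure T) := integrable_bilin B hu.integrable continuousOn_const
  have k2 : Integrable (fun t => B (u 0) (w' t)) (timeMeasure T) := (B (u 0)).integrable_comp hw.integrable
  have hs : ∀ s ∈ Set.uIcc 0 t, B (u' s) (w s) + B (u s) (w' s)
      = (B (u' s) (w 0) + B (u 0) (w' s))
        + (B (u' s) (∫ r in 0..s, w' r) + B (∫ r in 0..s, u' r) (w' s)) := fun s hs => by
    have hs' : s ∈ Set.Icc 0 T := Set.uIcc_subset_Icc h0 ht hs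
    rw [hw.eq s hs', hu.eq s hs', map_add, map_add, _root_.add_apply]
    abel
  rw [intervalIntegral.integral_congr hs]
  have k12 : IntervalIntegrable (fun s => B (u' s) (w 0) + B (u 0) (w' s)) volume 0 t :=
    intervalIntegrable_of_time (k1.add k2) h0 ht
  have j12 : IntervalIntegrable (fun s => B (u' s) (∫ r in 0..s, w' r)
      + B (∫ r in 0..s, u' r) (w' s)) volume 0 t := intervalIntegrable_of_time (j1.add j2) h0 ht
  rw [intervalIntegral.integral_add k12 j12,
    intervalIntegral.integral_add (intervalIntegrable_of_time k1 h0 ht)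
    (intervalIntegrable_of_time k2 h0 ht),
    intervalIntegral.integral_add (intervalIntegrable_of_time j1 h0 ht)
    (intervalIntegrable_of_time j2 h0 ht), ← bilin_integral_integral B hu.integrable hw.integrable ht,
    hu.eq t ht, hw.eq t ht, map_add, map_add, _root_.add_apply]
  have l1 := (B (u 0)).intervalIntegral_comp_comm (intervalIntegrable_of_time hw.integrable h0 ht)
  have l2 := (B.flip (w 0)).intervalIntegral_comp_comm
    (intervalIntegrable_of_time hu.integrable h0 ht)
  simp only [ContinuousLinearMap.flip_apply] at l2
  rw [l1, l2, _root_.add_apply]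
  abel

end IsPrimitive

/-! ### Weak time derivatives -/

variable [CompleteSpace E] [CompleteSpace F]

/-- Integration by parts against a smooth scalar function. -/
theorem IsPrimitive.integral_deriv_smul {u u' : ℝ → E} (h : IsPrimitive T u u') (hT : 0 ≤ T)
    {η : ℝ → ℝ} (hη : ContDiff ℝ 1 η) :
    ∫ t, deriv η t • u t ∂(timeMeasure T)
      = η T • u T - η 0 • u 0 - ∫ t, η t • u' t ∂(timeMeasure T) := by
  have hd : ∀ t, HasDerivAt η (deriv η t) t := fun t =>
    (hη.differentiable (by simp) t).hasDerivAt
  have hp := IsPrimitive.of_hasDerivAt (T := T) hd (hη.continuous_deriv (by simp))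
  have h1 := IsPrimitive.bilin (ContinuousLinearMap.lsmul ℝ ℝ) hp h
  have h2 := h1.eq T ⟨hT, le_rfl⟩
  simp only [ContinuousLinearMap.lsmul_apply] at h1 h2
  have i1 : Integrable (fun t => deriv η t • u t) (timeMeasure T) := by
    obtain ⟨C, hC⟩ := isCompact_Icc.exists_bound_of_continuousOn
      (hη.continuous_deriv (n := 1) (by simp)).continuousOn (s := Set.Icc 0 T)
    refine ((memLp_one_iff_integrable.1 (h.memLp 1)).bdd_smul C ?_ ?_)
    · exact (hη.continuous_deriv (by simp)).aestronglyMeasurable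
    · filter_upwards [ae_mem_Icc] with t ht using hC t ht
  have i2 : Integrable (fun t => η t • u' t) (timeMeasure T) := by
    obtain ⟨C, hC⟩ := isCompact_Icc.exists_bound_of_continuousOn
      hη.continuous.continuousOn (s := Set.Icc 0 T)
    refine (h.integrable.bdd_smul C ?_ ?_)
    · exact hη.continuous.aestronglyMeasurable
    · filter_upwards [ae_mem_Icc] with t ht using hC t ht
  rw [← integral_timeMeasure hT, integral_add i1 i2] at h2
  rw [h2]
  abel

theorem eqOn_of_ae_eq {X : Type*} [TopologicalSpace X] [T2Space X] (hT : 0 < T) {u w : ℝ → X}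
    (hu : ContinuousOn u (Set.Icc 0 T)) (hw : ContinuousOn w (Set.Icc 0 T))
    (h : u =ᵐ[timeMeasure T] w) : Set.EqOn u w (Set.Icc 0 T) :=
  Measure.eqOn_Icc_of_ae_eq volume hT.ne h hu hw

theorem integrable_smul_of_contDiff {X : Type*} [NormedAddCommGroup X] [NormedSpace ℝ X]
    {g : ℝ → ℝ} (hg : ContDiff ℝ ∞ g) {f : ℝ → X}
    (hf : Integrable f (timeMeasure T)) : Integrable (fun t => g t • f t) (timeMeasure T) := by
  obtain ⟨C, hC⟩ := isCompact_Icc.exists_bound_of_continuousOn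
    hg.continuous.continuousOn (s := Set.Icc 0 T)
  refine hf.bdd_smul C hg.continuous.aestronglyMeasurable ?_
  filter_upwards [ae_mem_Icc] with t ht using hC t ht

/-- The fundamental lemma of the calculus of variations on `(0, T)`. -/
theorem ae_eq_zero_of_forall_smul {u : ℝ → E} (hu : Integrable u (timeMeasure T))
    (h : ∀ g : ℝ → ℝ, ContDiff ℝ ∞ g → HasCompactSupport g → tsupport g ⊆ Set.Ioo 0 T →
      ∫ t, g t • u t ∂(timeMeasure T) = 0) : u =ᵐ[timeMeasure T] 0 := by
  have key : ∀ᵐ t, t ∈ Set.Ioo 0 T → u t = 0 := by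
    refine isOpen_Ioo.ae_eq_zero_of_integral_contDiff_smul_eq_zero ?_ fun g hg hgc hgs => ?_
    · exact (IntegrableOn.mono_set (t := Set.Icc 0 T) hu Set.Ioo_subset_Icc_self).locallyIntegrableOn
    rw [← h g hg hgc hgs, timeMeasure]
    refine (setIntegral_eq_integral_of_forall_compl_eq_zero fun t ht => ?_).symm
    rw [image_eq_zero_of_notMem_tsupport fun h' => ht (Set.Ioo_subset_Icc_self (hgs h')), zero_smul]
  rw [timeMeasure, ← restrict_Ioo_eq_restrict_Icc, EventuallyEq, ae_restrict_iff' measurableSet_Ioo]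
  exact key

theorem contDiff_integral {g : ℝ → ℝ} (hg : ContDiff ℝ ∞ g) (a : ℝ) :
    ContDiff ℝ ∞ (fun t => ∫ s in a..t, g s) ∧ deriv (fun t => ∫ s in a..t, g s) = g := by
  have hgd : ∀ t, HasDerivAt (fun t => ∫ s in a..t, g s) (g t) t := fun t =>
    intervalIntegral.integral_hasDerivAt_right (hg.continuous.intervalIntegrable _ _)
      (hg.continuous.stronglyMeasurableAtFilter _ _) hg.continuous.continuousAt
  have h := funext fun t => (hgd t).deriv
  refine ⟨contDiff_infty_iff_deriv.2 ⟨fun t => (hgd t).differentiableAt, ?_⟩, h⟩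
  rwa [h]

/-- The du Bois-Reymond lemma, with test functions that vanish at `T` but not at `0`: the initial
value of the primitive is then zero. -/
theorem ae_eq_primitive_of_forall {u w : ℝ → E} (hT : 0 ≤ T) (hu : Integrable u (timeMeasure T))
    (hw : Integrable w (timeMeasure T))
    (h : ∀ η : ℝ → ℝ, ContDiff ℝ ∞ η → η T = 0 →
      ∫ t, deriv η t • u t ∂(timeMeasure T) = -∫ t, η t • w t ∂(timeMeasure T)) :
    u =ᵐ[timeMeasure T] fun t => ∫ s in 0..t, w s := by
  have hp := isPrimitive_integral hw
  have hpi := memLp_one_iff_integrable.1 (hp.memLp 1)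
  have hd : Integrable (fun t => u t - ∫ s in 0..t, w s) (timeMeasure T) := hu.sub hpi
  suffices h0 : (fun t => u t - ∫ s in 0..t, w s) =ᵐ[timeMeasure T] 0 by
    filter_upwards [h0] with t ht using sub_eq_zero.1 ht
  refine ae_eq_zero_of_forall_smul hd fun g hg _ _ => ?_
  obtain ⟨hη, hgd⟩ := contDiff_integral hg T
  have h1 := h _ hη (by simp)
  have h2 := hp.integral_deriv_smul hT (hη.of_le (by simp))
  simp only [intervalIntegral.integral_same, zero_smul, smul_zero, sub_zero, zero_sub] at h2
  rw [← h2, ← sub_eq_zero, hgd, ← integral_sub (integrable_smul_of_contDiff hg hu)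
    (integrable_smul_of_contDiff hg hpi)] at h1
  simpa only [smul_sub] using h1

/-- A function with vanishing weak derivative is constant. -/
theorem ae_eq_const_of_weakDeriv_zero {u : ℝ → E} (hT : 0 < T)
    (hu : Integrable u (timeMeasure T)) (h : IsWeakTimeDeriv T u fun _ => 0) :
    ∃ k : E, u =ᵐ[timeMeasure T] fun _ => k := by
  obtain ⟨g₀, hsub, hcs, hsm, hone⟩ : ∃ g₀ : ℝ → ℝ, tsupport g₀ ⊆ Set.Ioo 0 T ∧
      HasCompactSupport g₀ ∧ ContDiff ℝ ∞ g₀ ∧ ∫ t, g₀ t = 1 := by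
    let b : ContDiffBump (T / 2) := ⟨T / 8, T / 4, by positivity, by linarith⟩
    refine ⟨b.normed volume, ?_, b.hasCompactSupport_normed, b.contDiff_normed, b.integral_normed⟩
    rw [b.tsupport_normed_eq]
    intro x hx
    rw [Metric.mem_closedBall, Real.dist_eq, abs_le] at hx
    change -(T / 4) ≤ _ ∧ _ ≤ T / 4 at hx
    constructor <;> linarith
  refine ⟨∫ t, g₀ t • u t ∂(timeMeasure T), ?_⟩
  obtain ⟨k, hk⟩ : ∃ k, k = ∫ t, g₀ t • u t ∂(timeMeasure T) := ⟨_, rfl⟩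
  rw [← hk]
  have hd : Integrable (fun t => u t - k) (timeMeasure T) := hu.sub (integrable_const k)
  suffices h0 : (fun t => u t - k) =ᵐ[timeMeasure T] 0 by
    filter_upwards [h0] with t ht using sub_eq_zero.1 ht
  refine ae_eq_zero_of_forall_smul hd fun g hg hgc hgs => ?_
  -- `g - (∫ g) g₀` is the derivative of a test function
  obtain ⟨m, hm⟩ : ∃ m : ℝ, m = ∫ t, g t := ⟨_, rfl⟩
  obtain ⟨f, hf⟩ : ∃ f : ℝ → ℝ, f = fun t => g t - m * g₀ t := ⟨_, rfl⟩
  have hfs : ContDiff ℝ ∞ f := hf ▸ hg.sub (contDiff_const.mul hsm)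
  obtain ⟨hη, hηd⟩ := contDiff_integral hfs 0
  have hK : IsCompact (insert (T / 2) (tsupport g ∪ tsupport g₀)) := (hgc.union hcs).insert _
  obtain ⟨a, ha, hal⟩ := hK.exists_isLeast (Set.insert_nonempty _ _)
  obtain ⟨b, hb, hbl⟩ := hK.exists_isGreatest (Set.insert_nonempty _ _)
  have hKs : insert (T / 2) (tsupport g ∪ tsupport g₀) ⊆ Set.Ioo 0 T :=
    Set.insert_subset ⟨by linarith, by linarith⟩ (Set.union_subset hgs hsub)
  have hf0 : ∀ t, t ∉ Set.Icc a b → f t = 0 := fun t ht => by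
    have h1 : t ∉ tsupport g := fun h' =>
      ht ⟨hal (Or.inr (Or.inl h')), hbl (Or.inr (Or.inl h'))⟩
    have h2 : t ∉ tsupport g₀ := fun h' =>
      ht ⟨hal (Or.inr (Or.inr h')), hbl (Or.inr (Or.inr h'))⟩
    simp only [hf]
    rw [image_eq_zero_of_notMem_tsupport h1, image_eq_zero_of_notMem_tsupport h2, mul_zero, sub_zero]
  have hint : ∀ {φ : ℝ → ℝ}, ContDiff ℝ ∞ φ → HasCompactSupport φ → Integrable φ := fun h1 h2 =>
    h1.continuous.integrable_of_hasCompactSupport h2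
  have hftot : ∫ t, f t = 0 := by
    rw [hf, integral_sub (hint hg hgc) ((hint hsm hcs).const_mul m), integral_const_mul, hone, ← hm]
    ring
  have ha0 : 0 < a := (hKs ha).1
  have hbT : b < T := (hKs hb).2
  have hη0 : ∀ t, t ∉ Set.Icc a b → ∫ s in 0..t, f s = 0 := fun t ht => by
    rcases lt_or_ge t a with h1 | h1
    · refine (intervalIntegral.integral_congr (g := fun _ => 0) fun s hs => hf0 s fun h' => ?_).trans
        (by simp)
      rcases Set.mem_uIcc.1 hs with h2 | h2 <;> linarith [h'.1, h2.1, h2.2]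
    · have h2 : b < t := lt_of_not_ge fun h' => ht ⟨h1, h'⟩
      rw [intervalIntegral.integral_of_le (ha0.le.trans h1)]
      refine Eq.trans ?_ hftot
      refine setIntegral_eq_integral_of_forall_compl_eq_zero fun s hs => hf0 s fun h' => hs ?_
      exact ⟨ha0.trans_le h'.1, h'.2.trans h2.le⟩
  have hts : tsupport (fun t => ∫ s in 0..t, f s) ⊆ Set.Icc a b :=
    closure_minimal (fun t ht => by_contra fun h' => ht (hη0 t h')) isClosed_Icc
  have h1 := h _ hη (isCompact_Icc.of_isClosed_subset (isClosed_tsupport _) hts)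
    (hts.trans (Set.Icc_subset_Ioo ha0 hbT))
  simp only [hηd, smul_zero, integral_zero, neg_zero] at h1
  have e1 : ∀ t, f t • u t = g t • u t - m • (g₀ t • u t) := fun t => by
    rw [hf, sub_smul, mul_smul]
  have hgm : ∫ t, g t ∂(timeMeasure T) = m := by
    rw [hm, timeMeasure]
    refine setIntegral_eq_integral_of_forall_compl_eq_zero fun t ht => ?_
    exact image_eq_zero_of_notMem_tsupport fun h' => ht (Set.Ioo_subset_Icc_self (hgs h'))
  simp_rw [e1] at h1
  rw [integral_sub (integrable_smul_of_contDiff hg hu)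
    (f := fun t => g t • u t) (g := fun t => m • (g₀ t • u t))
    ((integrable_smul_of_contDiff hsm hu).smul m), integral_smul, ← hk] at h1
  simp_rw [smul_sub]
  rw [integral_sub (integrable_smul_of_contDiff hg hu)
    (integrable_smul_of_contDiff hg (integrable_const k)), integral_smul_const, hgm, h1]

theorem eq_zero_of_tsupport_subset_Ioo {η : ℝ → ℝ} (h : tsupport η ⊆ Set.Ioo 0 T) :
    η 0 = 0 ∧ η T = 0 :=
  ⟨image_eq_zero_of_notMem_tsupport fun h' => lt_irrefl _ (h h').1,
    image_eq_zero_of_notMem_tsupport fun h' => lt_irrefl _ (h h').2⟩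

theorem IsPrimitive.isWeakTimeDeriv {u u' w : ℝ → E} (h : IsPrimitive T u u') (hT : 0 ≤ T)
    (hw : w =ᵐ[timeMeasure T] u) : IsWeakTimeDeriv T w u' := by
  intro η hη _ hηs
  obtain ⟨h0, h1⟩ := eq_zero_of_tsupport_subset_Ioo hηs
  have h2 := h.integral_deriv_smul hT (hη.of_le (by simp))
  rw [h0, h1, zero_smul, zero_smul, sub_zero, zero_sub] at h2
  rw [← h2]
  refine integral_congr_ae ?_
  filter_upwards [hw] with t ht
  rw [ht]

theorem IsPrimitive.vanishesAtZero {X : Type*} [NormedAddCommGroup X] [NormedSpace ℝ X]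
    {u u' w : ℝ → X} (h : IsPrimitive T u u')
    (hw : w =ᵐ[timeMeasure T] u) (h0 : u 0 = 0) : VanishesAtZero T w :=
  ⟨u, ⟨h.continuousOn, hw⟩, h0⟩

/-- A function of class `H^1` in time agrees almost everywhere with a primitive. -/
theorem exists_isPrimitive {u w : ℝ → E} (hT : 0 < T) (hu : MemLp u 2 (timeMeasure T))
    (hw : MemLp w 2 (timeMeasure T)) (h : IsWeakTimeDeriv T u w) :
    ∃ u' : ℝ → E, u =ᵐ[timeMeasure T] u' ∧ IsPrimitive T u' w := by
  replace hu : Integrable u (timeMeasure T) := hu.integrable (by norm_num)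
  replace hw : Integrable w (timeMeasure T) := hw.integrable (by norm_num)
  have hp := isPrimitive_integral hw
  have hpi := memLp_one_iff_integrable.1 (hp.memLp 1)
  obtain ⟨k, hk⟩ := ae_eq_const_of_weakDeriv_zero hT (hu.sub hpi) (by
    intro η hη hηc hηs
    have h1 := h η hη hηc hηs
    have h2 := hp.isWeakTimeDeriv hT.le EventuallyEq.rfl η hη hηc hηs
    simp only [Pi.sub_apply, smul_sub, smul_zero, integral_zero, neg_zero]
    have hη' : ContDiff ℝ ∞ (deriv η) := (contDiff_infty_iff_deriv.1 hη).2
    rw [integral_sub (integrable_smul_of_contDiff hη' hu) (integrable_smul_of_contDiff hη' hpi),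
      h1, h2, sub_self])
  refine ⟨fun t => k + ∫ s in 0..t, w s, ?_, hw, fun t _ => by simp⟩
  filter_upwards [hk] with t ht
  rw [← ht, Pi.sub_apply, sub_add_cancel]

/-- A function with a weak derivative and vanishing initial value is the primitive of its weak
derivative. -/
theorem ae_eq_primitive_of_vanishesAtZero {u w : ℝ → E} (hT : 0 < T)
    (hu : MemLp u 2 (timeMeasure T)) (hw : MemLp w 2 (timeMeasure T))
    (h : IsWeakTimeDeriv T u w) (h0 : VanishesAtZero T u) :
    u =ᵐ[timeMeasure T] fun t => ∫ s in 0..t, w s := by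
  obtain ⟨u', hu', hp⟩ := exists_isPrimitive hT hu hw h
  obtain ⟨w₀, ⟨hc, hae⟩, hz⟩ := h0
  have hE := eqOn_of_ae_eq hT hc hp.continuousOn (hae.symm.trans hu')
  have h00 : u' 0 = 0 := by rw [← hE ⟨le_rfl, hT.le⟩, hz]
  filter_upwards [hu', ae_mem_Icc] with t h1 ht
  rw [h1, hp.eq t ht, h00, zero_add]

/-- If a primitive vanishes almost everywhere, so does its derivative. -/
theorem ae_eq_zero_of_primitive_eq_zero {w : ℝ → E} (hT : 0 ≤ T)
    (hw : Integrable w (timeMeasure T))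
    (h : ∀ᵐ t ∂(timeMeasure T), ∫ s in 0..t, w s = 0) : w =ᵐ[timeMeasure T] 0 := by
  refine ae_eq_zero_of_forall_smul hw fun g hg hgc hgs => ?_
  have h1 := (isPrimitive_integral hw).isWeakTimeDeriv hT EventuallyEq.rfl g hg hgc hgs
  rw [eq_neg_iff_add_eq_zero, integral_congr_ae (g := fun _ => 0)
    (by filter_upwards [h] with t ht; rw [ht, smul_zero])] at h1
  simpa using h1

end Time

/-! ### Lions' projection theorem and the abstract damped wave equation -/

section Lions

/-- Lions' projection theorem: a variational problem whose form is coercive along the graph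
`θ ↦ w θ` of test functions has a solution, with the corresponding bound. -/
theorem exists_mem_inner_eq {X Θ : Type*} [NormedAddCommGroup X] [InnerProductSpace ℝ X]
    [CompleteSpace X] [AddCommGroup Θ] [Module ℝ Θ] (M : Submodule ℝ X)
    [M.HasOrthogonalProjection] (k : Θ →ₗ[ℝ] X) (L : Θ →ₗ[ℝ] ℝ) (w : Θ → X) (N : Θ → ℝ) {α C : ℝ}
    (hα : 0 < α) (hC : 0 ≤ C) (hw : ∀ θ, w θ ∈ M) (hN : ∀ θ, ‖w θ‖ ≤ N θ)
    (hco : ∀ θ, α * N θ ^ 2 ≤ inner ℝ (w θ) (k θ)) (hL : ∀ θ, |L θ| ≤ C * N θ) :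
    ∃ q ∈ M, ‖q‖ ≤ C / α ∧ ∀ θ, inner ℝ q (k θ) = L θ := by
  let P : X →L[ℝ] X := M.starProjection
  let e : Θ →ₗ[ℝ] X := (P : X →ₗ[ℝ] X).comp k
  have hNe : ∀ θ, N θ ≤ α⁻¹ * ‖e θ‖ := fun θ => by
    have h1 : inner ℝ (w θ) (k θ) = inner ℝ (w θ) (e θ) := by
      change _ = inner ℝ (w θ) (M.starProjection (k θ))
      rw [← Submodule.inner_starProjection_left_eq_right, Submodule.starProjection_eq_self_iff.2 (hw θ)]
    have h2 : inner ℝ (w θ) (e θ) ≤ N θ * ‖e θ‖ :=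
      (real_inner_le_norm _ _).trans (by gcongr; exact hN θ)
    have h0 : 0 ≤ N θ := (norm_nonneg _).trans (hN θ)
    have h3 := hco θ
    rw [h1] at h3
    rw [inv_mul_eq_div, le_div_iff₀ hα]
    rcases h0.eq_or_lt with h4 | h4
    · rw [← h4, zero_mul]; exact norm_nonneg _
    · nlinarith
  have hLe : ∀ θ, ‖L θ‖ ≤ C / α * ‖e θ‖ := fun θ => by
    refine (hL θ).trans ?_
    rw [div_eq_mul_inv, mul_assoc]
    exact mul_le_mul_of_nonneg_left (hNe θ) hC
  let ℓ := L.compLeftInverse e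
  have hℓ : ∀ θ, ℓ ⟨e θ, ⟨θ, rfl⟩⟩ = L θ := fun θ =>
    L.compLeftInverse_apply_of_bdd e ⟨_, hLe⟩ θ _ rfl
  have hℓn : ‖ℓ‖ ≤ C / α := by
    refine ℓ.opNorm_le_bound (by positivity) ?_
    rintro ⟨_, θ, rfl⟩
    rw [hℓ]
    exact hLe θ
  obtain ⟨g, hg, hgn⟩ := exists_extension_norm_eq (LinearMap.range e) ℓ
  let q₀ := (InnerProductSpace.toDual ℝ X).symm g
  refine ⟨P q₀, Submodule.starProjection_apply_mem _ _, ?_, fun θ => ?_⟩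
  · calc ‖P q₀‖ ≤ ‖q₀‖ := M.norm_starProjection_apply_le q₀
      _ = ‖g‖ := LinearIsometryEquiv.norm_map _ _
      _ ≤ C / α := hgn.le.trans hℓn
  · have h1 : inner ℝ (P q₀) (k θ) = inner ℝ q₀ (e θ) :=
      Submodule.inner_starProjection_left_eq_right M q₀ (k θ)
    rw [h1, InnerProductSpace.toDual_symm_apply, ← hℓ θ, ← hg]

variable {V H : Type*} [NormedAddCommGroup V] [InnerProductSpace ℝ V]
  [NormedAddCommGroup H] [InnerProductSpace ℝ H] {T : ℝ}

/-- The map `H → V'`, `h ↦ (ψ ↦ ⟨h, ι ψ⟩)`. -/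
def dualEmb (ι : V →L[ℝ] H) : H →L[ℝ] StrongDual ℝ V :=
  ((ContinuousLinearMap.compL ℝ V H ℝ).flip ι).comp (innerSL ℝ)

@[simp] theorem dualEmb_apply (ι : V →L[ℝ] H) (h : H) (ψ : V) :
    dualEmb ι h ψ = inner ℝ h (ι ψ) := rfl

theorem memLp_of_continuous {E : Type*} [NormedAddCommGroup E] {f : ℝ → E} (hf : Continuous f)
    [SecondCountableTopologyEither ℝ E] :
    MemLp f 2 (timeMeasure T) := by
  obtain ⟨C, hC⟩ := isCompact_Icc.exists_bound_of_continuousOn hf.continuousOn (s := Set.Icc 0 T)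
  refine MemLp.of_bound hf.aestronglyMeasurable C ?_
  filter_upwards [ae_mem_Icc] with t ht using hC t ht

theorem integral_mul_le_sqrt {a b : ℝ → ℝ} (ha : MemLp a 2 (timeMeasure T))
    (hb : MemLp b 2 (timeMeasure T)) :
    ∫ t, a t * b t ∂(timeMeasure T)
      ≤ √(∫ t, a t ^ 2 ∂(timeMeasure T)) * √(∫ t, b t ^ 2 ∂(timeMeasure T)) := by
  have h1 : ∀ {f : ℝ → ℝ} (hf : MemLp f 2 (timeMeasure T)),
      ‖hf.toLp f‖ = √(∫ t, f t ^ 2 ∂(timeMeasure T)) := fun {f} hf => by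
    rw [norm_eq_sqrt_real_inner, L2.inner_def]
    congr 1
    refine integral_congr_ae ?_
    filter_upwards [hf.coeFn_toLp] with t ht
    rw [ht, real_inner_self_eq_norm_sq, Real.norm_eq_abs, sq_abs]
  rw [← h1 ha, ← h1 hb]
  refine le_trans (le_of_eq ?_) (real_inner_le_norm _ _)
  rw [L2.inner_def]
  refine integral_congr_ae ?_
  filter_upwards [ha.coeFn_toLp, hb.coeFn_toLp] with t h2 h3
  rw [h2, h3]
  simp [mul_comm]

/-- The pair of two square integrable functions of time, as an element of the Hilbert sum. -/
def timePair {q : ℝ → V} {v : ℝ → H} (hq : MemLp q 2 (timeMeasure T))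
    (hv : MemLp v 2 (timeMeasure T)) :
    WithLp 2 (Lp V 2 (timeMeasure T) × Lp H 2 (timeMeasure T)) :=
  WithLp.toLp 2 (hq.toLp q, hv.toLp v)

theorem inner_timePair (w : WithLp 2 (Lp V 2 (timeMeasure T) × Lp H 2 (timeMeasure T)))
    {q : ℝ → V} {v : ℝ → H} (hq : MemLp q 2 (timeMeasure T)) (hv : MemLp v 2 (timeMeasure T)) :
    inner ℝ w (timePair hq hv) = (∫ t, inner ℝ (w.fst t) (q t) ∂(timeMeasure T))
      + ∫ t, inner ℝ (w.snd t) (v t) ∂(timeMeasure T) := by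
  have h : inner ℝ w (timePair hq hv) = inner ℝ w.fst (hq.toLp q) + inner ℝ w.snd (hv.toLp v) :=
    WithLp.prod_inner_apply _ _
  rw [h, L2.inner_def, L2.inner_def]
  congr 1
  · refine integral_congr_ae ?_
    filter_upwards [hq.coeFn_toLp] with t ht
    rw [ht]
  · refine integral_congr_ae ?_
    filter_upwards [hv.coeFn_toLp] with t ht
    rw [ht]

theorem norm_sq_time (w : WithLp 2 (Lp V 2 (timeMeasure T) × Lp H 2 (timeMeasure T))) :
    ‖w‖ ^ 2 = (∫ t, ‖w.fst t‖ ^ 2 ∂(timeMeasure T)) + ∫ t, ‖w.snd t‖ ^ 2 ∂(timeMeasure T) := by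
  rw [WithLp.prod_norm_sq_eq_of_L2, ← real_inner_self_eq_norm_sq, ← real_inner_self_eq_norm_sq,
    L2.inner_def, L2.inner_def]
  simp_rw [real_inner_self_eq_norm_sq]

theorem integrable_inner_time {E : Type*} [NormedAddCommGroup E] [InnerProductSpace ℝ E]
    {f g : ℝ → E} (hf : MemLp f 2 (timeMeasure T)) (hg : MemLp g 2 (timeMeasure T)) :
    Integrable (fun t => (inner ℝ (f t) (g t) : ℝ)) (timeMeasure T) := by
  refine (L2.integrable_inner (𝕜 := ℝ) (hf.toLp f) (hg.toLp g)).congr ?_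
  filter_upwards [hf.coeFn_toLp, hg.coeFn_toLp] with t h1 h2
  rw [h1, h2]

/-- The coercivity estimate behind the existence of solutions. With the multiplier
`φ' = e^{2t} θ`, the form is the integral of an exact derivative plus a positive quantity. -/
theorem lions_coercive (hT : 0 ≤ T) {ι : V →L[ℝ] H} {S : V →L[ℝ] V} {A B : H →L[ℝ] H} {β : ℝ}
    (hβ : 0 < β) (hS : ∀ u w, inner ℝ (S u) w = inner ℝ u (S w))
    (hSn : ∀ u, 0 ≤ inner ℝ (S u) u)
    (hV : ∀ u, ‖u‖ ^ 2 = ‖ι u‖ ^ 2 + inner ℝ (S u) u) (hA : ∀ h, 0 ≤ inner ℝ (A h) h)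
    (hB : ∀ h h', inner ℝ (B h) h' = inner ℝ h (B h')) (hBβ : ∀ h, β * ‖h‖ ^ 2 ≤ inner ℝ (B h) h)
    {θ φ : ℝ → V} (hθ : ContDiff ℝ 1 θ) (hθT : θ T = 0)
    (hφ : ∀ t, HasDerivAt φ (Real.exp (2 * t) • θ t) t) (hφ0 : φ 0 = 0) :
    min (1 / 2) (β / 2) * Real.exp (-2 * T) * ((∫ t, ‖φ t‖ ^ 2 ∂(timeMeasure T))
      + (∫ t, ‖ι (Real.exp (2 * t) • θ t)‖ ^ 2 ∂(timeMeasure T)) + ‖φ T‖ ^ 2)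
    ≤ (∫ t, inner ℝ (φ t) (S (θ t)) ∂(timeMeasure T))
      + ∫ t, inner ℝ (ι (Real.exp (2 * t) • θ t)) (A (ι (θ t)) - B (ι (deriv θ t)))
        ∂(timeMeasure T) := by
  obtain ⟨m, hm⟩ : ∃ m, m = min (1 / 2) (β / 2) := ⟨_, rfl⟩
  have hm1 : m ≤ 1 / 2 := hm ▸ min_le_left _ _
  have hm2 : m ≤ β / 2 := hm ▸ min_le_right _ _
  have hm0 : 0 < m := hm ▸ lt_min (by norm_num) (by positivity)
  rw [← hm]
  have hθd : ∀ t, HasDerivAt θ (deriv θ t) t := fun t =>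
    (hθ.differentiable (by simp) t).hasDerivAt
  have cθ := hθ.continuous
  have cθ' := hθ.continuous_deriv le_rfl
  have cφ : Continuous φ := continuous_iff_continuousAt.2 fun t => (hφ t).continuousAt
  have cE : Continuous fun t : ℝ => Real.exp (2 * t) := by fun_prop
  have ce : Continuous fun t : ℝ => Real.exp (-2 * t) := by fun_prop
  -- `F 0 ≤ 0` as `φ 0 = 0`, and `F T` controls `‖φ T‖²` as `θ T = 0`
  obtain ⟨F, hF⟩ : ∃ F : ℝ → ℝ, F = fun t => 1 / 2 * (Real.exp (-2 * t) * inner ℝ (S (φ t)) (φ t))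
      + β / 2 * (Real.exp (-2 * t) * inner ℝ (ι (φ t)) (ι (φ t)))
      - 1 / 2 * (Real.exp (2 * t) * inner ℝ (B (ι (θ t))) (ι (θ t))) := ⟨_, rfl⟩
  obtain ⟨F', hF'⟩ : ∃ F' : ℝ → ℝ, F' = fun t =>
      (inner ℝ (φ t) (S (θ t)) - Real.exp (-2 * t) * inner ℝ (S (φ t)) (φ t))
      + β * (inner ℝ (ι (φ t)) (ι (θ t)) - Real.exp (-2 * t) * inner ℝ (ι (φ t)) (ι (φ t)))
      - Real.exp (2 * t) * (inner ℝ (ι (θ t)) (B (ι (deriv θ t)))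
        + inner ℝ (B (ι (θ t))) (ι (θ t))) := ⟨_, rfl⟩
  have hee : ∀ t : ℝ, Real.exp (-2 * t) * Real.exp (2 * t) = 1 := fun t => by
    rw [← Real.exp_add]; simp
  have hdF : ∀ t, HasDerivAt F (F' t) t := fun t => by
    have he : HasDerivAt (fun t : ℝ => Real.exp (-2 * t)) (Real.exp (-2 * t) * (-2)) t := by
      simpa using ((hasDerivAt_id t).const_mul (-2 : ℝ)).exp
    have hE : HasDerivAt (fun t : ℝ => Real.exp (2 * t)) (Real.exp (2 * t) * 2) t := by
      simpa using ((hasDerivAt_id t).const_mul (2 : ℝ)).exp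
    have h1 := (S.hasFDerivAt.comp_hasDerivAt t (hφ t)).inner ℝ (hφ t)
    have h2 := (ι.hasFDerivAt.comp_hasDerivAt t (hφ t)).inner ℝ
      (ι.hasFDerivAt.comp_hasDerivAt t (hφ t))
    have hιθ := ι.hasFDerivAt.comp_hasDerivAt t (hθd t)
    have h3 := (B.hasFDerivAt.comp_hasDerivAt t hιθ).inner ℝ hιθ
    have := (((he.mul h1).const_mul (1 / 2)).add ((he.mul h2).const_mul (β / 2))).sub
      ((hE.mul h3).const_mul (1 / 2))
    rw [hF]
    refine this.congr_deriv ?_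
    simp only [hF', Function.comp_apply, map_smul, inner_smul_left, inner_smul_right,
      conj_trivial]
    rw [hS (θ t) (φ t), real_inner_comm (S (φ t)), hS (φ t) (θ t), hB (ι (deriv θ t)),
      real_inner_comm (B (ι (θ t))), real_inner_comm (ι (φ t)) (ι (θ t))]
    linear_combination (inner ℝ (φ t) (S (θ t)) + β * inner ℝ (ι (φ t)) (ι (θ t))) * hee t
      - Real.exp (2 * t) * hB (ι (θ t)) (ι (deriv θ t))
  have cF' : Continuous F' := by rw [hF']; fun_prop
  obtain ⟨J, hJ⟩ : ∃ J : ℝ → ℝ, J = fun t => inner ℝ (φ t) (S (θ t))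
    + inner ℝ (ι (Real.exp (2 * t) • θ t)) (A (ι (θ t)) - B (ι (deriv θ t))) := ⟨_, rfl⟩
  have cJ : Continuous J := by rw [hJ]; fun_prop
  have hpt : ∀ t ∈ Set.Icc 0 T, m * Real.exp (-2 * T)
      * (‖φ t‖ ^ 2 + ‖ι (Real.exp (2 * t) • θ t)‖ ^ 2) ≤ J t - F' t := fun t ht => by
    have hr : 0 ≤ ‖Real.exp (-2 * t) • ι (φ t) - ι (θ t)‖ ^ 2 := by positivity
    rw [norm_sub_sq_real, norm_smul, real_inner_smul_left, Real.norm_eq_abs, Real.abs_exp] at hr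
    have e1 : Real.exp (-2 * T) ≤ Real.exp (-2 * t) :=
      Real.exp_le_exp.2 (by linarith [ht.2])
    have h1 := hV (φ t)
    have h2 := hSn (φ t)
    have h3 := hA (ι (θ t))
    have h4 := hBβ (ι (θ t))
    have h5 := hee t
    rw [hJ, hF', map_smul, norm_smul, Real.norm_eq_abs, Real.abs_exp, h1]
    simp only [map_smul, real_inner_smul_left, inner_sub_right]
    rw [real_inner_self_eq_norm_sq, real_inner_comm (A (ι (θ t)))]
    have hE0 := Real.exp_pos (2 * t)
    have he0 := Real.exp_pos (-2 * t)
    have heT := Real.exp_pos (-2 * T)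
    generalize Real.exp (2 * t) = E at *
    generalize Real.exp (-2 * t) = e at *
    generalize Real.exp (-2 * T) = eT at *
    generalize inner ℝ (S (φ t)) (φ t) = a at *
    generalize inner ℝ (A (ι (θ t))) (ι (θ t)) = Aθ at *
    generalize inner ℝ (B (ι (θ t))) (ι (θ t)) = Bθ at *
    generalize inner ℝ (ι (φ t)) (ι (θ t)) = r at *
    have hp : 0 ≤ ‖ι (φ t)‖ ^ 2 := by positivity
    have hs : 0 ≤ ‖ι (θ t)‖ ^ 2 := by positivity
    rw [mul_pow] at hr ⊢
    generalize ‖ι (φ t)‖ ^ 2 = p at *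
    generalize ‖ι (θ t)‖ ^ 2 = s at *
    -- the square `E ‖e ι φ - ι θ‖²`, which compensates the mixed term of the `L²` part of `F'`
    have k1 : 0 ≤ e * p - 2 * r + E * s := by
      have : e * p - 2 * r + E * s = E * (e ^ 2 * p - 2 * (e * r) + s) := by
        linear_combination (2 * r - e * p) * h5
      rw [this]; positivity
    have k2 : m * eT * a ≤ e * a := by
      have : m * eT ≤ e := by nlinarith
      gcongr
    have k3 : m * eT * p ≤ β / 2 * (e * p) := by
      have : m * eT ≤ β / 2 * e := by gcongr
      nlinarith
    have k4 : m * eT * (E ^ 2 * s) ≤ β / 2 * (E * s) := by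
      have h6 : m * eT ≤ β / 2 * e := by gcongr
      have h7 : m * eT * (E ^ 2 * s) ≤ β / 2 * e * (E ^ 2 * s) := by gcongr
      have h8 : β / 2 * e * (E ^ 2 * s) = β / 2 * (E * s) := by
        linear_combination β / 2 * E * s * h5
      linarith
    have k5 : 0 ≤ E * Aθ := by positivity
    have k6 : β * (E * s) ≤ E * Bθ := by nlinarith
    have k7 : E * (e * r) = r := by linear_combination r * h5
    have k8 := mul_nonneg hβ.le k1
    linarith
  have c1 : Continuous fun t => ‖φ t‖ ^ 2 := by fun_prop
  have c2 : Continuous fun t => ‖ι (Real.exp (2 * t) • θ t)‖ ^ 2 := by fun_prop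
  have i1 : (∫ t, inner ℝ (φ t) (S (θ t)) ∂(timeMeasure T))
      + ∫ t, inner ℝ (ι (Real.exp (2 * t) • θ t)) (A (ι (θ t)) - B (ι (deriv θ t)))
        ∂(timeMeasure T) = ∫ t in 0..T, J t := by
    rw [integral_timeMeasure hT, integral_timeMeasure hT, hJ, ← intervalIntegral.integral_add]
    · exact Continuous.intervalIntegrable (by fun_prop) _ _
    · exact Continuous.intervalIntegrable (by fun_prop) _ _
  have i2 : ∫ t in 0..T, F' t = F T - F 0 :=
    intervalIntegral.integral_eq_sub_of_hasDerivAt (fun t _ => hdF t) (cF'.intervalIntegrable _ _)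
  have i3 := intervalIntegral.integral_mono_on (μ := volume) hT
    (((c1.add c2).const_smul (m * Real.exp (-2 * T))).intervalIntegrable 0 T)
    ((cJ.sub cF').intervalIntegrable 0 T) hpt
  have i4 : ∫ t in 0..T, (m * Real.exp (-2 * T)) • ((fun t => ‖φ t‖ ^ 2)
      + fun t => ‖ι (Real.exp (2 * t) • θ t)‖ ^ 2) t = m * Real.exp (-2 * T)
        * ((∫ t in 0..T, ‖φ t‖ ^ 2) + ∫ t in 0..T, ‖ι (Real.exp (2 * t) • θ t)‖ ^ 2) := by
    rw [intervalIntegral.integral_smul, smul_eq_mul, ← intervalIntegral.integral_add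
      (c1.intervalIntegrable _ _) (c2.intervalIntegrable _ _)]
    rfl
  have i5 : ∫ t in 0..T, (J - F') t = (∫ t in 0..T, J t) - ∫ t in 0..T, F' t :=
    intervalIntegral.integral_sub (cJ.intervalIntegrable _ _) (cF'.intervalIntegrable _ _)
  have i6 : m * Real.exp (-2 * T) * ((∫ t in 0..T, ‖φ t‖ ^ 2)
      + ∫ t in 0..T, ‖ι (Real.exp (2 * t) • θ t)‖ ^ 2) ≤ (∫ t in 0..T, J t) - (F T - F 0) := by
    rw [← i2, ← i5, ← i4]; exact i3
  have hF0 : F 0 ≤ 0 := by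
    have := hBβ (ι (θ 0))
    have h0 : 0 ≤ ‖ι (θ 0)‖ ^ 2 := by positivity
    rw [hF]
    simp only [hφ0, map_zero, inner_zero_left, mul_zero, Real.exp_zero]
    nlinarith
  have hFT : m * Real.exp (-2 * T) * ‖φ T‖ ^ 2 ≤ F T := by
    rw [hF]
    simp only [hθT, map_zero, inner_zero_left, mul_zero, sub_zero]
    rw [hV, real_inner_self_eq_norm_sq]
    have h0 : 0 ≤ ‖ι (φ T)‖ ^ 2 := by positivity
    have h1 := hSn (φ T)
    have h2 := Real.exp_pos (-2 * T)
    have h3 := mul_le_mul_of_nonneg_right hm1 (mul_nonneg h2.le h1)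
    have h4 := mul_le_mul_of_nonneg_right hm2 (mul_nonneg h2.le h0)
    nlinarith
  rw [i1, integral_timeMeasure hT, integral_timeMeasure hT]
  linarith

theorem sqrt_integral_add_sq_le {x y : ℝ → ℝ} (hx : MemLp x 2 (timeMeasure T))
    (hy : MemLp y 2 (timeMeasure T)) (a b : ℝ) :
    √(∫ t, (a * x t + b * y t) ^ 2 ∂(timeMeasure T))
      ≤ √(a ^ 2 + b ^ 2) * √(∫ t, (x t ^ 2 + y t ^ 2) ∂(timeMeasure T)) := by
  rw [← Real.sqrt_mul (by positivity), ← integral_const_mul]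
  refine Real.sqrt_le_sqrt (integral_mono ((hx.const_mul a).add (hy.const_mul b)).integrable_sq
    ((hx.integrable_sq.add hy.integrable_sq).const_mul _) fun t => ?_)
  change (a * x t + b * y t) ^ 2 ≤ (a ^ 2 + b ^ 2) * (x t ^ 2 + y t ^ 2)
  nlinarith [sq_nonneg (a * y t - b * x t)]

/-- The value at the final time is controlled by the `H^1` norm in time. -/
theorem norm_final_le {E : Type*} [NormedAddCommGroup E] [NormedSpace ℝ E] [CompleteSpace E]
    (hT : 0 < T) {f f' : ℝ → E} (hf : IsPrimitive T f f') (hf' : MemLp f' 2 (timeMeasure T)) :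
    ‖f T‖ ≤ √(1 + T ^ 2) * √T / T
      * √(∫ t, (‖f t‖ ^ 2 + ‖f' t‖ ^ 2) ∂(timeMeasure T)) := by
  have hid : IsPrimitive T (fun t : ℝ => t) fun _ => 1 :=
    IsPrimitive.of_hasDerivAt (fun t => hasDerivAt_id t) continuous_const
  have h1 := (IsPrimitive.bilin (ContinuousLinearMap.lsmul ℝ ℝ) hid hf).eq T ⟨hT.le, le_rfl⟩
  simp only [ContinuousLinearMap.lsmul_apply, zero_smul, zero_add, one_smul] at h1
  have hm := (hf.memLp 2).norm
  have hm' := hf'.norm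
  have h2 : T * ‖f T‖ ≤ √(1 + T ^ 2) * √(∫ t, (‖f t‖ ^ 2 + ‖f' t‖ ^ 2) ∂(timeMeasure T)) * √T := by
    calc T * ‖f T‖ = ‖T • f T‖ := by rw [norm_smul, Real.norm_of_nonneg hT.le]
      _ = ‖∫ t, (f t + t • f' t) ∂(timeMeasure T)‖ := by rw [h1, integral_timeMeasure hT.le]
      _ ≤ ∫ t, (1 * ‖f t‖ + T * ‖f' t‖) * 1 ∂(timeMeasure T) := by
        refine norm_integral_le_of_norm_le (g := fun t => (1 * ‖f t‖ + T * ‖f' t‖) * 1) ?_ ?_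
        · exact (((hm.const_mul 1).add (hm'.const_mul T)).integrable (by norm_num)).mul_const 1
        filter_upwards [ae_mem_Icc] with t ht
        rw [mul_one, one_mul]
        refine (norm_add_le _ _).trans ?_
        rw [norm_smul, Real.norm_of_nonneg ht.1]
        gcongr
        exact ht.2
      _ ≤ √(∫ t, (1 * ‖f t‖ + T * ‖f' t‖) ^ 2 ∂(timeMeasure T))
          * √(∫ _, (1 : ℝ) ^ 2 ∂(timeMeasure T)) :=
        integral_mul_le_sqrt ((hm.const_mul 1).add (hm'.const_mul T)) (memLp_const 1)
      _ ≤ _ := by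
        have h3 := sqrt_integral_add_sq_le hm hm' 1 T
        have h4 : ∫ _, (1 : ℝ) ^ 2 ∂(timeMeasure T) = T := by
          rw [integral_timeMeasure hT.le]; simp
        rw [one_pow] at h3
        rw [h4]
        gcongr
  have h5 : ‖f T‖ = (T * ‖f T‖) / T := by field_simp
  rw [h5, div_le_iff₀ hT]
  refine h2.trans (le_of_eq ?_)
  field_simp

/-- The load `∫ f(θ)` is bounded by the energy of `φ`: an integration by parts moves the time
derivative from `φ' = e^{2t} θ` to `f`. -/
theorem abs_load_le (hT : 0 < T) [CompleteSpace V] {f f' : ℝ → StrongDual ℝ V}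
    (hf : IsPrimitive T f f') (hf' : MemLp f' 2 (timeMeasure T)) {θ φ : ℝ → V} (hθ : Continuous θ)
    (hφ : ∀ t, HasDerivAt φ (Real.exp (2 * t) • θ t) t) (hφ0 : φ 0 = 0) {N : ℝ} (hN : 0 ≤ N)
    (hN1 : ∫ t, ‖φ t‖ ^ 2 ∂(timeMeasure T) ≤ N ^ 2) (hN2 : ‖φ T‖ ≤ N) :
    |∫ t, f t (θ t) ∂(timeMeasure T)| ≤ (√(2 ^ 2 + 1 ^ 2) + √(1 + T ^ 2) * √T / T)
      * √(∫ t, (‖f t‖ ^ 2 + ‖f' t‖ ^ 2) ∂(timeMeasure T)) * N := by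
  have he : ∀ t, HasDerivAt (fun t : ℝ => Real.exp (-2 * t)) (-2 * Real.exp (-2 * t)) t := fun t => by
    simpa [mul_comm] using ((hasDerivAt_id t).const_mul (-2 : ℝ)).exp
  have hep : IsPrimitive T (fun t : ℝ => Real.exp (-2 * t)) fun t => -2 * Real.exp (-2 * t) :=
    IsPrimitive.of_hasDerivAt he (by fun_prop)
  have hφp : IsPrimitive T φ fun t => Real.exp (2 * t) • θ t :=
    IsPrimitive.of_hasDerivAt hφ (by fun_prop)
  have hF := IsPrimitive.bilin (ContinuousLinearMap.lsmul ℝ ℝ) hep hf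
  have h1 := IsPrimitive.bilin (ContinuousLinearMap.id ℝ (StrongDual ℝ V)) hF hφp
  have h2 := h1.eq T ⟨hT.le, le_rfl⟩
  simp only [ContinuousLinearMap.lsmul_apply, ContinuousLinearMap.id_apply, hφ0, map_zero,
    zero_add, map_smul, smul_eq_mul, _root_.add_apply, _root_.smul_apply] at h1 h2
  have hee : ∀ t x : ℝ, Real.exp (2 * t) * (Real.exp (-2 * t) * x) = x := fun t x => by
    rw [← mul_assoc, ← Real.exp_add]; simp
  simp only [hee] at h1 h2
  have hm := (hf.memLp 2).norm
  have hm' := hf'.norm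
  have hφm := (hφp.memLp 2).norm
  have b1 : Integrable (fun t => (2 * ‖f t‖ + 1 * ‖f' t‖) * ‖φ t‖) (timeMeasure T) :=
    ((hm.const_mul 2).add (hm'.const_mul 1)).integrable_mul hφm
  have i1 : Integrable (fun t => f t (θ t)) (timeMeasure T) := by
    refine integrable_bilin (ContinuousLinearMap.id ℝ (StrongDual ℝ V))
      ((hf.memLp 2).integrable (by norm_num)) hθ.continuousOn
  have hpt : ∀ᵐ t ∂(timeMeasure T), ‖-2 * Real.exp (-2 * t) * f t (φ t)
      + Real.exp (-2 * t) * f' t (φ t)‖ ≤ (2 * ‖f t‖ + 1 * ‖f' t‖) * ‖φ t‖ := by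
    filter_upwards [ae_mem_Icc] with t ht
    have e0 := Real.exp_pos (-2 * t)
    have e1 : Real.exp (-2 * t) ≤ 1 := Real.exp_le_one_iff.2 (by linarith [ht.1])
    refine (norm_add_le _ _).trans ?_
    rw [norm_mul, norm_mul, norm_mul, Real.norm_of_nonneg e0.le, norm_neg, Real.norm_ofNat]
    have k1 := (f t).le_opNorm (φ t)
    have k2 := (f' t).le_opNorm (φ t)
    have k3 : Real.exp (-2 * t) * ‖f t (φ t)‖ ≤ 1 * (‖f t‖ * ‖φ t‖) := by gcongr
    have k4 : Real.exp (-2 * t) * ‖f' t (φ t)‖ ≤ 1 * (‖f' t‖ * ‖φ t‖) := by gcongr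
    nlinarith
  have i2 : Integrable (fun t => -2 * Real.exp (-2 * t) * f t (φ t)
      + Real.exp (-2 * t) * f' t (φ t)) (timeMeasure T) :=
    (h1.integrable.sub i1).congr (Eventually.of_forall fun t => by
      simp only [Pi.sub_apply, add_sub_cancel_right])
  have h3 : ∫ t, f t (θ t) ∂(timeMeasure T) = Real.exp (-2 * T) * f T (φ T)
      - ∫ t, (-2 * Real.exp (-2 * t) * f t (φ t) + Real.exp (-2 * t) * f' t (φ t))
        ∂(timeMeasure T) := by
    rw [h2, ← integral_timeMeasure hT.le, integral_add i2 i1]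
    ring
  have h4 := norm_integral_le_of_norm_le b1 hpt
  have h5 : ∫ t, (2 * ‖f t‖ + 1 * ‖f' t‖) * ‖φ t‖ ∂(timeMeasure T)
      ≤ √(2 ^ 2 + 1 ^ 2) * √(∫ t, (‖f t‖ ^ 2 + ‖f' t‖ ^ 2) ∂(timeMeasure T)) * N := by
    refine (integral_mul_le_sqrt ((hm.const_mul 2).add (hm'.const_mul 1)) hφm).trans ?_
    have := sqrt_integral_add_sq_le hm hm' 2 1
    exact mul_le_mul this (Real.sqrt_le_iff.2 ⟨hN, hN1⟩) (Real.sqrt_nonneg _) (by positivity)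
  have h6 : ‖Real.exp (-2 * T) * f T (φ T)‖ ≤ √(1 + T ^ 2) * √T / T
      * √(∫ t, (‖f t‖ ^ 2 + ‖f' t‖ ^ 2) ∂(timeMeasure T)) * N := by
    have e1 : Real.exp (-2 * T) ≤ 1 := Real.exp_le_one_iff.2 (by linarith)
    rw [norm_mul, Real.norm_of_nonneg (Real.exp_pos _).le]
    refine (mul_le_of_le_one_left (norm_nonneg _) e1).trans (((f T).le_opNorm _).trans ?_)
    have := norm_final_le hT hf hf'
    gcongr
  rw [h3, ← Real.norm_eq_abs]
  refine (norm_sub_le _ _).trans ?_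
  rw [add_mul, add_mul]
  exact (add_le_add h6 (h4.trans h5)).trans (le_of_eq (add_comm _ _))

end Lions

section AbstractWave

variable {V H : Type*} [NormedAddCommGroup V] [InnerProductSpace ℝ V]
  [NormedAddCommGroup H] [InnerProductSpace ℝ H] {T : ℝ}

/-- The test functions of Lions' theorem: `C^1` functions of time that vanish at the final time. -/
def timeTests (V : Type*) [NormedAddCommGroup V] [InnerProductSpace ℝ V] (T : ℝ) :
    Submodule ℝ (ℝ → V) where
  carrier := {θ | ContDiff ℝ 1 θ ∧ θ T = 0}
  zero_mem' := ⟨contDiff_const, rfl⟩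
  add_mem' := fun ha hb => ⟨ha.1.add hb.1, by simp [ha.2, hb.2]⟩
  smul_mem' := fun r _ ha => ⟨contDiff_const.smul ha.1, by simp [ha.2]⟩

theorem continuous_timeTests (θ : timeTests V T) : Continuous (θ : ℝ → V) := θ.2.1.continuous

theorem continuous_deriv_timeTests (θ : timeTests V T) : Continuous (deriv (θ : ℝ → V)) :=
  θ.2.1.continuous_deriv le_rfl

theorem timePair_congr {X Y : Type*} [NormedAddCommGroup X] [NormedAddCommGroup Y]
    {q q' : ℝ → X} {v v' : ℝ → Y} (h : q = q') (h' : v = v')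
    (hq : MemLp q 2 (timeMeasure T)) (hv : MemLp v 2 (timeMeasure T))
    (hq' : MemLp q' 2 (timeMeasure T)) (hv' : MemLp v' 2 (timeMeasure T)) :
    timePair hq hv = timePair hq' hv' := by
  subst h h'; rfl

theorem memLp_waveForm (ι : V →L[ℝ] H) (S : V →L[ℝ] V) (A B : H →L[ℝ] H) (θ : timeTests V T) :
    MemLp (fun t => S (θ.1 t)) 2 (timeMeasure T) ∧
      MemLp (fun t => A (ι (θ.1 t)) - B (ι (deriv θ.1 t))) 2 (timeMeasure T) := by
  have := continuous_timeTests θ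
  have := continuous_deriv_timeTests θ
  exact ⟨memLp_of_continuous (by fun_prop), memLp_of_continuous (by fun_prop)⟩

/-- The form of the variational problem as a function of the test function: the pair that represents
`θ ↦ ∫ ⟨S q, θ⟩ + ⟨A v, ι θ⟩ - ⟨B v, ι θ'⟩` as a functional of `(q, v)`. -/
def waveForm (ι : V →L[ℝ] H) (S : V →L[ℝ] V) (A B : H →L[ℝ] H) (T : ℝ) : timeTests V T →ₗ[ℝ]
    WithLp 2 (Lp V 2 (timeMeasure T) × Lp H 2 (timeMeasure T)) where
  toFun θ := timePair (memLp_waveForm ι S A B θ).1 (memLp_waveForm ι S A B θ).2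
  map_add' θ₁ θ₂ := by
    refine (timePair_congr (funext fun t => ?_) (funext fun t => ?_) _ _
      ((memLp_waveForm ι S A B θ₁).1.add (memLp_waveForm ι S A B θ₂).1)
      ((memLp_waveForm ι S A B θ₁).2.add (memLp_waveForm ι S A B θ₂).2)).trans rfl
    · simp
    · have : deriv ((θ₁ + θ₂ : timeTests V T) : ℝ → V) t
          = deriv (θ₁ : ℝ → V) t + deriv (θ₂ : ℝ → V) t :=
        deriv_add (θ₁.2.1.differentiable one_ne_zero t) (θ₂.2.1.differentiable one_ne_zero t)
      rw [this]
      simp only [Pi.add_apply, map_add, Submodule.coe_add]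
      abel
  map_smul' r θ := by
    refine (timePair_congr (funext fun t => ?_) (funext fun t => ?_) _ _
      ((memLp_waveForm ι S A B θ).1.const_smul r)
      ((memLp_waveForm ι S A B θ).2.const_smul r)).trans rfl
    · simp
    · have : deriv ((r • θ : timeTests V T) : ℝ → V) t = r • deriv (θ : ℝ → V) t :=
        deriv_const_smul r (θ.2.1.differentiable one_ne_zero t)
      rw [this]
      simp only [Pi.smul_apply, map_smul, Submodule.coe_smul, smul_sub]

theorem inner_waveForm (ι : V →L[ℝ] H) (S : V →L[ℝ] V) (A B : H →L[ℝ] H)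
    (w : WithLp 2 (Lp V 2 (timeMeasure T) × Lp H 2 (timeMeasure T))) (θ : timeTests V T) :
    inner ℝ w (waveForm ι S A B T θ) = (∫ t, inner ℝ (w.fst t) (S (θ.1 t)) ∂(timeMeasure T))
      + ∫ t, inner ℝ (w.snd t) (A (ι (θ.1 t)) - B (ι (deriv θ.1 t))) ∂(timeMeasure T) :=
  inner_timePair w _ _

theorem memLp_smul_const {E : Type*} [NormedAddCommGroup E] [NormedSpace ℝ E] {η : ℝ → ℝ}
    (hη : Continuous η) (x : E) : MemLp (fun t => η t • x) 2 (timeMeasure T) :=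
  memLp_of_continuous (by fun_prop)

variable [CompleteSpace V] [CompleteSpace H]

/-- The closed space of pairs `(q, v)` for which `ι q` is the primitive of `v` that vanishes at
`0`, in weak form. -/
def velocitySpace (ι : V →L[ℝ] H) (T : ℝ) :
    Submodule ℝ (WithLp 2 (Lp V 2 (timeMeasure T) × Lp H 2 (timeMeasure T))) :=
  (Submodule.span ℝ {w | ∃ (η : ℝ → ℝ) (hη : ContDiff ℝ ∞ η) (h : H), η T = 0 ∧
    w = timePair (memLp_smul_const (hη.continuous_deriv (by simp)) (ContinuousLinearMap.adjoint ι h))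
      (memLp_smul_const hη.continuous h)})ᗮ

instance (ι : V →L[ℝ] H) : (velocitySpace ι T).HasOrthogonalProjection := by
  have : CompleteSpace (velocitySpace ι T) :=
    (Submodule.isClosed_orthogonal _).completeSpace_coe
  exact Submodule.HasOrthogonalProjection.ofCompleteSpace _

theorem integral_inner_smul_const {E : Type*} [NormedAddCommGroup E] [InnerProductSpace ℝ E]
    [CompleteSpace E] {η : ℝ → ℝ} (hη : ContDiff ℝ ∞ η) {f : ℝ → E}
    (hf : Integrable f (timeMeasure T)) (h : E) :
    ∫ t, inner ℝ (f t) (η t • h) ∂(timeMeasure T)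
      = inner ℝ (∫ t, η t • f t ∂(timeMeasure T)) h := by
  rw [real_inner_comm, ← integral_inner (integrable_smul_of_contDiff hη hf)]
  refine integral_congr_ae (Eventually.of_forall fun t => ?_)
  simp only [inner_smul_right, real_inner_comm]

/-- The orthogonality relations that define `velocitySpace`, as a weak differential equation in
time. Test functions that do not vanish at `0` encode the initial condition `ι (q 0) = 0`. -/
theorem mem_velocitySpace_iff (ι : V →L[ℝ] H)
    {w : WithLp 2 (Lp V 2 (timeMeasure T) × Lp H 2 (timeMeasure T))} :
    w ∈ velocitySpace ι T ↔ ∀ η : ℝ → ℝ, ContDiff ℝ ∞ η → η T = 0 →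
      ∫ t, deriv η t • ι (w.fst t) ∂(timeMeasure T) = -∫ t, η t • w.snd t ∂(timeMeasure T) := by
  have i1 := (Lp.memLp w.fst).integrable (by norm_num)
  have i2 := (Lp.memLp w.snd).integrable (by norm_num)
  have key : ∀ (η : ℝ → ℝ) (hη : ContDiff ℝ ∞ η) (h : H), inner ℝ w (timePair (memLp_smul_const
      (hη.continuous_deriv (by simp)) (ContinuousLinearMap.adjoint ι h))
      (memLp_smul_const hη.continuous h)) = inner ℝ ((∫ t, deriv η t • ι (w.fst t) ∂(timeMeasure T))
        + ∫ t, η t • w.snd t ∂(timeMeasure T)) h := fun η hη h => by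
    have hη' : ContDiff ℝ ∞ (deriv η) := (contDiff_infty_iff_deriv.1 hη).2
    rw [inner_timePair, integral_inner_smul_const hη' i1, integral_inner_smul_const hη i2,
      ContinuousLinearMap.adjoint_inner_right, ← ContinuousLinearMap.integral_comp_comm _
        (integrable_smul_of_contDiff hη' i1), inner_add_left]
    simp only [map_smul]
  constructor
  · intro hw η hη hηT
    rw [eq_neg_iff_add_eq_zero]
    refine ext_inner_right ℝ fun h => ?_
    rw [inner_zero_left, ← key η hη h]
    refine Submodule.inner_left_of_mem_orthogonal (Submodule.subset_span ?_) hw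
    exact ⟨η, hη, h, hηT, rfl⟩
  · intro hw
    refine (Submodule.mem_orthogonal' _ _).2 fun u hu => ?_
    induction hu using Submodule.span_induction with
    | mem u hu =>
      obtain ⟨η, hη, h, hηT, rfl⟩ := hu
      rw [key η hη h, hw η hη hηT, neg_add_cancel, inner_zero_left]
    | zero => exact inner_zero_right _
    | add x y _ _ hx hy => rw [inner_add_right, hx, hy, add_zero]
    | smul r x _ hx => rw [inner_smul_right, hx, mul_zero]

/-- The abstract damped wave equation `(B ι q')' + A ι q' + S q = f` with zero initial data has a
solution, bounded by the `H^1` norm in time of the load. -/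
theorem exists_abstract_wave (hT : 0 < T) {ι : V →L[ℝ] H} {S : V →L[ℝ] V} {A B : H →L[ℝ] H} {β : ℝ}
    (hβ : 0 < β) (hS : ∀ u w, inner ℝ (S u) w = inner ℝ u (S w))
    (hSn : ∀ u, 0 ≤ inner ℝ (S u) u)
    (hV : ∀ u, ‖u‖ ^ 2 = ‖ι u‖ ^ 2 + inner ℝ (S u) u) (hA : ∀ h, 0 ≤ inner ℝ (A h) h)
    (hAs : ∀ h h', inner ℝ (A h) h' = inner ℝ h (A h'))
    (hB : ∀ h h', inner ℝ (B h) h' = inner ℝ h (B h')) (hBβ : ∀ h, β * ‖h‖ ^ 2 ≤ inner ℝ (B h) h) :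
    ∃ C : ℝ, 0 ≤ C ∧ ∀ f f' : ℝ → StrongDual ℝ V, IsPrimitive T f f' →
      MemLp f' 2 (timeMeasure T) → ∃ (q : ℝ → V) (v : ℝ → H),
        MemLp q 2 (timeMeasure T) ∧ MemLp v 2 (timeMeasure T) ∧
        (∀ᵐ t ∂(timeMeasure T), ι (q t) = ∫ s in 0..t, v s) ∧
        (∀ᵐ t ∂(timeMeasure T), dualEmb ι (B (v t)) = ∫ s in 0..t,
          (f s - dualEmb ι (A (v s)) - innerSL ℝ (S (q s)))) ∧
        (∫ t, ‖q t‖ ^ 2 ∂(timeMeasure T)) + (∫ t, ‖v t‖ ^ 2 ∂(timeMeasure T))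
          ≤ C * ∫ t, (‖f t‖ ^ 2 + ‖f' t‖ ^ 2) ∂(timeMeasure T) := by
  obtain ⟨α, hα⟩ : ∃ α, α = min (1 / 2) (β / 2) * Real.exp (-2 * T) := ⟨_, rfl⟩
  have hα0 : 0 < α := hα ▸ mul_pos (lt_min (by norm_num) (by positivity)) (Real.exp_pos _)
  obtain ⟨c, hc⟩ : ∃ c, c = √(2 ^ 2 + 1 ^ 2) + √(1 + T ^ 2) * √T / T := ⟨_, rfl⟩
  have hc0 : 0 ≤ c := by rw [hc]; positivity
  refine ⟨(c / α) ^ 2, by positivity, fun f f' hf hf' => ?_⟩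
  obtain ⟨R, hR⟩ : ∃ R, R = √(∫ t, (‖f t‖ ^ 2 + ‖f' t‖ ^ 2) ∂(timeMeasure T)) := ⟨_, rfl⟩
  have hR0 : 0 ≤ R := hR ▸ Real.sqrt_nonneg _
  have hRsq : R ^ 2 = ∫ t, (‖f t‖ ^ 2 + ‖f' t‖ ^ 2) ∂(timeMeasure T) := by
    rw [hR, Real.sq_sqrt (integral_nonneg fun t => by positivity)]
  have hf1 : Integrable f (timeMeasure T) := (hf.memLp 2).integrable (by norm_num)
  have hfθ : ∀ {θ : ℝ → V}, Continuous θ → Integrable (fun t => f t (θ t)) (timeMeasure T) :=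
    fun hθ => integrable_bilin (ContinuousLinearMap.id ℝ (StrongDual ℝ V)) hf1 hθ.continuousOn
  let L : timeTests V T →ₗ[ℝ] ℝ :=
    { toFun := fun θ => ∫ t, f t (θ.1 t) ∂(timeMeasure T)
      map_add' := fun θ₁ θ₂ => by
        rw [← integral_add (hfθ (continuous_timeTests θ₁)) (hfθ (continuous_timeTests θ₂))]
        simp
      map_smul' := fun r θ => by
        rw [RingHom.id_apply, smul_eq_mul, ← integral_const_mul]
        simp }
  obtain ⟨φ, hφd⟩ : ∃ φ : timeTests V T → ℝ → V, φ = fun θ t => ∫ s in 0..t,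
    Real.exp (2 * s) • θ.1 s := ⟨_, rfl⟩
  have cφ' : ∀ θ : timeTests V T, Continuous fun s : ℝ => Real.exp (2 * s) • θ.1 s := fun θ => by
    have := continuous_timeTests θ
    fun_prop
  have hφ : ∀ (θ : timeTests V T) (t : ℝ), HasDerivAt (φ θ) (Real.exp (2 * t) • θ.1 t) t :=
    fun θ t => by
      rw [hφd]
      exact intervalIntegral.integral_hasDerivAt_right ((cφ' θ).intervalIntegrable _ _)
        ((cφ' θ).stronglyMeasurableAtFilter _ _) (cφ' θ).continuousAt
  have hφ0 : ∀ θ, φ θ 0 = 0 := fun θ => by rw [hφd]; simp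
  have cφ : ∀ θ, Continuous (φ θ) := fun θ =>
    continuous_iff_continuousAt.2 fun t => (hφ θ t).continuousAt
  have m1 : ∀ θ, MemLp (φ θ) 2 (timeMeasure T) := fun θ => memLp_of_continuous (cφ θ)
  have m2 : ∀ θ : timeTests V T, MemLp (fun t => ι (Real.exp (2 * t) • θ.1 t)) 2 (timeMeasure T) :=
    fun θ => memLp_of_continuous (ι.continuous.comp (cφ' θ))
  have n1 : ∀ θ, ‖timePair (m1 θ) (m2 θ)‖ ^ 2 = (∫ t, ‖φ θ t‖ ^ 2 ∂(timeMeasure T))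
      + ∫ t, ‖ι (Real.exp (2 * t) • θ.1 t)‖ ^ 2 ∂(timeMeasure T) := fun θ => by
    rw [norm_sq_time]
    congr 1
    · refine integral_congr_ae ?_
      filter_upwards [(m1 θ).coeFn_toLp] with t ht
      rw [← ht]; rfl
    · refine integral_congr_ae ?_
      filter_upwards [(m2 θ).coeFn_toLp] with t ht
      rw [← ht]; rfl
  -- coercivity is tested with the multiplier `φ' = e^{2t} θ`; its norm includes the final value of
  -- `φ`, which the boundary terms of the load require
  obtain ⟨w, hwM, hwn, hw⟩ := exists_mem_inner_eq (velocitySpace ι T) (waveForm ι S A B T) L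
    (fun θ => timePair (m1 θ) (m2 θ))
    (fun θ => √(‖timePair (m1 θ) (m2 θ)‖ ^ 2 + ‖φ θ T‖ ^ 2)) hα0 (C := c * R) (by positivity)
    (fun θ => by
      rw [mem_velocitySpace_iff]
      intro η hη hηT
      have hp := ((IsPrimitive.of_hasDerivAt (T := T) (hφ θ) (cφ' θ)).clm_comp ι).integral_deriv_smul
        hT.le (hη.of_le (by simp))
      rw [hηT, hφ0, map_zero, zero_smul, smul_zero, sub_zero, zero_sub] at hp
      rw [integral_congr_ae (g := fun t => deriv η t • ι (φ θ t)), hp]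
      · congr 1
        refine integral_congr_ae ?_
        filter_upwards [(m2 θ).coeFn_toLp] with t ht
        rw [← ht]; rfl
      · filter_upwards [(m1 θ).coeFn_toLp] with t ht
        rw [← ht]; rfl)
    (fun θ => Real.le_sqrt_of_sq_le (by nlinarith [sq_nonneg ‖φ θ T‖]))
    (fun θ => by
      rw [Real.sq_sqrt (by positivity), inner_waveForm, n1, hα]
      refine (lions_coercive hT.le hβ hS hSn hV hA hB hBβ θ.2.1 θ.2.2 (hφ θ) (hφ0 θ)).trans
        (le_of_eq ?_)
      congr 1
      · refine integral_congr_ae ?_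
        filter_upwards [(m1 θ).coeFn_toLp] with t ht
        rw [← ht]; rfl
      · refine integral_congr_ae ?_
        filter_upwards [(m2 θ).coeFn_toLp] with t ht
        rw [← ht]; rfl)
    (fun θ => by
      rw [hc, hR]
      refine abs_load_le hT hf hf' (continuous_timeTests θ) (hφ θ) (hφ0 θ) (Real.sqrt_nonneg _) ?_ ?_
      · rw [Real.sq_sqrt (by positivity), n1, add_assoc]
        exact le_add_of_nonneg_right (add_nonneg (integral_nonneg fun t => by positivity)
          (by positivity))
      · exact Real.le_sqrt_of_sq_le (by nlinarith [sq_nonneg ‖timePair (m1 θ) (m2 θ)‖]))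
  have iq : MemLp w.fst 2 (timeMeasure T) := Lp.memLp w.fst
  have iv : MemLp w.snd 2 (timeMeasure T) := Lp.memLp w.snd
  have iq1 := iq.integrable (q := 2) (by norm_num)
  have iv1 := iv.integrable (q := 2) (by norm_num)
  have iW : Integrable (fun s => f s - dualEmb ι (A (w.snd s)) - innerSL ℝ (S (w.fst s)))
      (timeMeasure T) :=
    (hf1.sub (((dualEmb ι).comp A).integrable_comp iv1)).sub
      (((innerSL ℝ).comp S).integrable_comp iq1)
  refine ⟨w.fst, w.snd, iq, iv, ?_, ?_, ?_⟩
  · exact ae_eq_primitive_of_forall hT.le (ι.integrable_comp iq1) iv1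
      ((mem_velocitySpace_iff ι).1 hwM)
  · refine ae_eq_primitive_of_forall hT.le (((dualEmb ι).comp B).integrable_comp iv1) iW
      fun η hη hηT => ?_
    have hη' : ContDiff ℝ ∞ (deriv η) := (contDiff_infty_iff_deriv.1 hη).2
    have iB : Integrable (fun t => deriv η t • dualEmb ι (B (w.snd t))) (timeMeasure T) :=
      integrable_smul_of_contDiff hη' (((dualEmb ι).comp B).integrable_comp iv1)
    rw [eq_neg_iff_add_eq_zero, ← integral_add iB (integrable_smul_of_contDiff hη iW)]
    ext ψ
    refine (ContinuousLinearMap.integral_apply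
      (iB.add (integrable_smul_of_contDiff hη iW)) ψ).trans ?_
    -- separated test functions suffice to recover the equation in `V'`
    have hθmem : (fun t => η t • ψ) ∈ timeTests V T :=
      ⟨(hη.of_le (by simp)).smul contDiff_const, by simp [hηT]⟩
    have h1 := hw ⟨_, hθmem⟩
    rw [inner_waveForm] at h1
    change _ = ∫ t, f t (η t • ψ) ∂(timeMeasure T) at h1
    have hd : ∀ t, deriv (fun t => η t • ψ) t = deriv η t • ψ := fun t =>
      ((hη.differentiable (by simp) t).hasDerivAt.smul_const ψ).deriv
    simp only [hd] at h1
    have j1 := hfθ (θ := fun t => η t • ψ) (hη.continuous.smul continuous_const)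
    have j2 := integrable_inner_time iq (memLp_waveForm ι S A B ⟨_, hθmem⟩).1
    have j3 := integrable_inner_time iv (memLp_waveForm ι S A B ⟨_, hθmem⟩).2
    simp only [hd] at j2 j3
    have h2 := (integral_sub j1 (j2.add j3)).trans
      (sub_eq_zero.2 (h1.symm.trans (integral_add j2 j3).symm))
    rw [_root_.zero_apply, ← h2]
    refine integral_congr_ae (Eventually.of_forall fun t => ?_)
    simp only [_root_.add_apply, _root_.sub_apply, _root_.smul_apply, dualEmb_apply, innerSL_apply_apply,
      smul_eq_mul, map_smul, inner_smul_right, inner_sub_right, Pi.add_apply, hS, hAs, hB]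
    ring
  · rw [← norm_sq_time, ← hRsq, ← mul_pow]
    refine pow_le_pow_left₀ (norm_nonneg _) (hwn.trans (le_of_eq ?_)) 2
    ring

end AbstractWave

/-! ### Cutoff functions of backward cones -/

section Cone

theorem contDiff_smoothTransition : ContDiff ℝ ∞ Real.smoothTransition :=
  Real.smoothTransition.contDiff

theorem hasCompactSupport_deriv_smoothTransition :
    HasCompactSupport (deriv Real.smoothTransition) := by
  refine HasCompactSupport.intro (K := Set.Icc 0 1) isCompact_Icc fun y hy => ?_
  rw [Set.mem_Icc, not_and_or, not_le, not_le] at hy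
  rcases hy with hy | hy
  · have : Real.smoothTransition =ᶠ[𝓝 y] fun _ => 0 := by
      filter_upwards [Iio_mem_nhds hy] with z hz
      exact Real.smoothTransition.zero_of_nonpos (le_of_lt hz)
    rw [this.deriv_eq, deriv_const]
  · have : Real.smoothTransition =ᶠ[𝓝 y] fun _ => 1 := by
      filter_upwards [Ioi_mem_nhds hy] with z hz
      exact Real.smoothTransition.one_of_one_le (le_of_lt hz)
    rw [this.deriv_eq, deriv_const]

theorem deriv_smoothTransition_nonneg (y : ℝ) : 0 ≤ deriv Real.smoothTransition y :=
  Real.smoothTransition.monotone.deriv_nonneg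

theorem contDiff_deriv_smoothTransition : ContDiff ℝ ∞ (deriv Real.smoothTransition) :=
  (contDiff_infty_iff_deriv.1 contDiff_smoothTransition).2

/-- A common bound for the first derivative of `smoothTransition`, its Lipschitz constant, and the
error of the first-order Taylor expansion. -/
theorem exists_smoothTransition_bounds : ∃ M : ℝ, 0 ≤ M ∧
    (∀ y, ‖deriv Real.smoothTransition y‖ ≤ M) ∧
    (∀ y z, ‖deriv Real.smoothTransition y - deriv Real.smoothTransition z‖ ≤ M * ‖y - z‖) ∧
    ∀ y z, ‖Real.smoothTransition y - Real.smoothTransition z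
      - (y - z) * deriv Real.smoothTransition z‖ ≤ M * ‖y - z‖ ^ 2 := by
  obtain ⟨M₀, h₀⟩ := hasCompactSupport_deriv_smoothTransition.exists_bound_of_continuous
    contDiff_deriv_smoothTransition.continuous
  obtain ⟨M₁, h₁⟩ := hasCompactSupport_deriv_smoothTransition.deriv.exists_bound_of_continuous
    (contDiff_deriv_smoothTransition.continuous_deriv (by simp))
  have p₀ : 0 ≤ M₀ := (norm_nonneg _).trans (h₀ 0)
  have p₁ : 0 ≤ M₁ := (norm_nonneg _).trans (h₁ 0)
  have hL : ∀ y z, ‖deriv Real.smoothTransition y - deriv Real.smoothTransition z‖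
      ≤ M₁ * ‖y - z‖ := fun y z =>
    convex_univ.norm_image_sub_le_of_norm_deriv_le
      (fun x _ => contDiff_deriv_smoothTransition.differentiable (by simp) x)
      (fun x _ => h₁ x) (Set.mem_univ z) (Set.mem_univ y)
  refine ⟨M₀ + M₁, by positivity, fun y => (h₀ y).trans (by linarith), fun y z =>
    (hL y z).trans (by gcongr; linarith), fun y z => ?_⟩
  have h2 : ‖(Real.smoothTransition y - y * deriv Real.smoothTransition z)
      - (Real.smoothTransition z - z * deriv Real.smoothTransition z)‖
      ≤ (M₁ * ‖y - z‖) * ‖y - z‖ := by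
    refine (convex_segment z y).norm_image_sub_le_of_norm_hasDerivWithin_le
      (f := fun x => Real.smoothTransition x - x * deriv Real.smoothTransition z)
      (f' := fun x => deriv Real.smoothTransition x - 1 * deriv Real.smoothTransition z)
      (fun x _ => ?_) (fun x hx => ?_) (left_mem_segment ℝ z y) (right_mem_segment ℝ z y)
    · exact ((contDiff_smoothTransition.differentiable (by simp) x).hasDerivAt.sub
        ((hasDerivAt_id x).mul_const _)).hasDerivWithinAt
    · rw [one_mul]
      refine (hL x z).trans ?_
      gcongr
      rw [norm_sub_rev y z]
      obtain ⟨a, b, ha, hb, hab, rfl⟩ := hx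
      have : a • z + b • y - z = b * (y - z) := by
        simp only [smul_eq_mul]; linear_combination z * hab
      rw [this, norm_mul, Real.norm_of_nonneg hb, norm_sub_rev z y]
      exact mul_le_of_le_one_left (norm_nonneg _) (by linarith)
  have e : Real.smoothTransition y - Real.smoothTransition z
      - (y - z) * deriv Real.smoothTransition z
      = (Real.smoothTransition y - y * deriv Real.smoothTransition z)
      - (Real.smoothTransition z - z * deriv Real.smoothTransition z) := by ring
  rw [e]
  refine h2.trans ?_
  rw [sq, ← mul_assoc]
  gcongr
  linarith

variable {d : ℕ}

/-- A smooth substitute for the distance to `x₀`. -/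
def regDist (x₀ : Space d) (ε : ℝ) (x : Space d) : ℝ := √(‖x - x₀‖ ^ 2 + ε ^ 2)

theorem contDiff_regDist (x₀ : Space d) {ε : ℝ} (hε : 0 < ε) : ContDiff ℝ ∞ (regDist x₀ ε) :=
  ((contDiff_id.sub contDiff_const).norm_sq ℝ |>.add contDiff_const).sqrt fun x => by positivity

theorem norm_le_regDist (x₀ : Space d) (ε : ℝ) (x : Space d) : ‖x - x₀‖ ≤ regDist x₀ ε x :=
  Real.le_sqrt_of_sq_le (by nlinarith [sq_nonneg ε])

theorem lipschitzWith_regDist (x₀ : Space d) (ε : ℝ) : LipschitzWith 1 (regDist x₀ ε) := by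
  refine LipschitzWith.of_le_add fun x y => ?_
  rw [dist_eq_norm]
  refine Real.sqrt_le_iff.2 ⟨add_nonneg (Real.sqrt_nonneg _) (norm_nonneg _), ?_⟩
  have h1 : ‖x - x₀‖ ≤ ‖y - x₀‖ + ‖x - y‖ := by
    have : x - x₀ = (y - x₀) + (x - y) := by abel
    rw [this]; exact norm_add_le _ _
  have h2 : ‖y - x₀‖ ≤ regDist x₀ ε y := norm_le_regDist x₀ ε y
  have h3 : regDist x₀ ε y ^ 2 = ‖y - x₀‖ ^ 2 + ε ^ 2 := Real.sq_sqrt (by positivity)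
  have h4 := pow_le_pow_left₀ (norm_nonneg _) h1 2
  nlinarith [norm_nonneg (x - y)]

/-- The cutoff function at time `t` of the backward cone over the ball of radius `R` about `x₀`,
whose section shrinks with speed `κ`. -/
def coneCutoff (x₀ : Space d) (R κ : ℝ) {ε : ℝ} (hε : 0 < ε) (t : ℝ) : TestFn d :=
  ⟨fun x => Real.smoothTransition (R - κ * t - regDist x₀ ε x),
    contDiff_smoothTransition.comp (contDiff_const.sub (contDiff_regDist x₀ hε)),
    HasCompactSupport.intro (isCompact_closedBall x₀ (R - κ * t)) fun x hx => by
      rw [Metric.mem_closedBall, not_le, dist_eq_norm] at hx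
      exact Real.smoothTransition.zero_of_nonpos (by linarith [norm_le_regDist x₀ ε x])⟩

theorem coneCutoff_apply (x₀ : Space d) (R κ : ℝ) {ε : ℝ} (hε : 0 < ε) (t : ℝ) (x : Space d) :
    coneCutoff x₀ R κ hε t x = Real.smoothTransition (R - κ * t - regDist x₀ ε x) := rfl

theorem coneCutoff_eq_zero {x₀ : Space d} {R κ : ℝ} {ε : ℝ} (hε : 0 < ε) {t : ℝ} (hκ : 0 ≤ κ)
    (ht : 0 ≤ t) {x : Space d} (h : R ≤ ‖x - x₀‖) : coneCutoff x₀ R κ hε t x = 0 :=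
  Real.smoothTransition.zero_of_nonpos
    (by linarith [norm_le_regDist x₀ ε x, mul_nonneg hκ ht])

theorem coneCutoff_nonneg (x₀ : Space d) (R κ : ℝ) {ε : ℝ} (hε : 0 < ε) (t : ℝ) (x : Space d) :
    0 ≤ coneCutoff x₀ R κ hε t x := Real.smoothTransition.nonneg _

/-- The slope of the cutoff in space is at most `1 / κ` times its rate of decrease in time. -/
theorem norm_gradient_coneCutoff_le (x₀ : Space d) (R κ : ℝ) {ε : ℝ} (hε : 0 < ε) (t : ℝ)
    (x : Space d) : ‖∇ (coneCutoff x₀ R κ hε t : Space d → ℝ) x‖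
      ≤ deriv Real.smoothTransition (R - κ * t - regDist x₀ ε x) := by
  have hρ := (contDiff_regDist x₀ hε).differentiable (by simp) x
  have h1 : HasFDerivAt (coneCutoff x₀ R κ hε t : Space d → ℝ)
      (deriv Real.smoothTransition (R - κ * t - regDist x₀ ε x) • -fderiv ℝ (regDist x₀ ε) x) x :=
    (contDiff_smoothTransition.differentiable (by simp) _).hasDerivAt.comp_hasFDerivAt x
      (hρ.hasFDerivAt.const_sub _)
  rw [gradient, LinearIsometryEquiv.norm_map, h1.fderiv, norm_smul, norm_neg,
    Real.norm_of_nonneg (deriv_smoothTransition_nonneg _)]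
  refine mul_le_of_le_one_right (deriv_smoothTransition_nonneg _) ?_
  exact_mod_cast norm_fderiv_le_of_lipschitz ℝ (lipschitzWith_regDist x₀ ε)

/-- The time derivative of the cutoff function of a cone. -/
def coneCutoffDeriv (x₀ : Space d) (R κ : ℝ) {ε : ℝ} (hε : 0 < ε) (t : ℝ) :
    BoundedContinuousFunction (Space d) ℝ :=
  BoundedContinuousFunction.ofNormedAddCommGroup
    (fun x => -κ * deriv Real.smoothTransition (R - κ * t - regDist x₀ ε x))
    (continuous_const.mul (contDiff_deriv_smoothTransition.continuous.comp
      (continuous_const.sub (contDiff_regDist x₀ hε).continuous)))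
    (‖-κ‖ * exists_smoothTransition_bounds.choose) fun x => by
      rw [norm_mul]
      gcongr
      exact exists_smoothTransition_bounds.choose_spec.2.1 _

theorem coneCutoffDeriv_apply (x₀ : Space d) (R κ : ℝ) {ε : ℝ} (hε : 0 < ε) (t : ℝ) (x : Space d) :
    coneCutoffDeriv x₀ R κ hε t x
      = -κ * deriv Real.smoothTransition (R - κ * t - regDist x₀ ε x) := rfl

/-- Differentiability in time in the sense of uniform convergence, by a Taylor expansion that is
uniform in `x`. -/
theorem hasDerivAt_coneCutoff (x₀ : Space d) (R κ : ℝ) {ε : ℝ} (hε : 0 < ε) (t : ℝ) :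
    HasDerivAt (fun t => (coneCutoff x₀ R κ hε t).bcf) (coneCutoffDeriv x₀ R κ hε t) t := by
  obtain ⟨M, hM, -, -, h3⟩ := exists_smoothTransition_bounds
  rw [hasDerivAt_iff_isLittleO]
  refine Asymptotics.IsBigO.trans_isLittleO (g := fun s => ‖s - t‖ ^ 2) ?_
    (Asymptotics.isLittleO_pow_sub_sub t one_lt_two)
  refine Asymptotics.IsBigO.of_bound (M * κ ^ 2) (Eventually.of_forall fun s => ?_)
  refine (BoundedContinuousFunction.norm_le (by positivity)).2 fun x => ?_
  have := h3 (R - κ * s - regDist x₀ ε x) (R - κ * t - regDist x₀ ε x)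
  have e1 : R - κ * s - regDist x₀ ε x - (R - κ * t - regDist x₀ ε x) = -κ * (s - t) := by ring
  rw [e1, norm_mul, mul_pow, norm_neg, Real.norm_eq_abs κ, sq_abs] at this
  simp only [BoundedContinuousFunction.sub_apply, BoundedContinuousFunction.smul_apply,
    TestFn.bcf_apply, coneCutoffDeriv_apply, coneCutoff_apply, smul_eq_mul]
  rw [norm_pow, norm_norm, mul_assoc]
  refine le_trans (le_of_eq ?_) this
  congr 1
  ring

theorem continuous_coneCutoffDeriv (x₀ : Space d) (R κ : ℝ) {ε : ℝ} (hε : 0 < ε) :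
    Continuous (coneCutoffDeriv x₀ R κ hε) := by
  obtain ⟨M, hM, -, h2, -⟩ := exists_smoothTransition_bounds
  refine (LipschitzWith.of_dist_le_mul (K := ⟨M * κ ^ 2, by positivity⟩) fun s t => ?_).continuous
  rw [dist_eq_norm, dist_eq_norm]
  refine (BoundedContinuousFunction.norm_le (mul_nonneg (NNReal.coe_nonneg _) (norm_nonneg _))).2
    fun x => ?_
  have := h2 (R - κ * s - regDist x₀ ε x) (R - κ * t - regDist x₀ ε x)
  have e1 : R - κ * s - regDist x₀ ε x - (R - κ * t - regDist x₀ ε x) = -κ * (s - t) := by ring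
  rw [e1, norm_mul, norm_neg] at this
  rw [BoundedContinuousFunction.sub_apply, coneCutoffDeriv_apply, coneCutoffDeriv_apply, ← mul_sub,
    norm_mul, norm_neg]
  refine (mul_le_mul_of_nonneg_left this (norm_nonneg κ)).trans (le_of_eq ?_)
  change ‖κ‖ * (M * (‖κ‖ * ‖s - t‖)) = M * κ ^ 2 * ‖s - t‖
  rw [← sq_abs κ, ← Real.norm_eq_abs]
  ring

theorem isPrimitive_coneCutoff (x₀ : Space d) (R κ : ℝ) {ε : ℝ} (hε : 0 < ε) (T : ℝ) :
    IsPrimitive T (fun t => (coneCutoff x₀ R κ hε t).bcf) (coneCutoffDeriv x₀ R κ hε) :=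
  IsPrimitive.of_hasDerivAt (hasDerivAt_coneCutoff x₀ R κ hε)
    (continuous_coneCutoffDeriv x₀ R κ hε)

/-! ### Finite speed of propagation -/

theorem integral_add_sub_two_mul {X : Type*} [MeasurableSpace X] {μ : Measure X}
    {f₁ f₂ f₃ f₄ : X → ℝ} (h₁ : Integrable f₁ μ) (h₂ : Integrable f₂ μ) (h₃ : Integrable f₃ μ)
    (h₄ : Integrable f₄ μ) : ∫ x, (f₁ x + f₂ x - 2 * f₃ x - 2 * f₄ x) ∂μ
      = (∫ x, f₁ x ∂μ) + (∫ x, f₂ x ∂μ) - 2 * (∫ x, f₃ x ∂μ) - 2 * ∫ x, f₄ x ∂μ := by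
  have h₁₂ : Integrable (fun x => f₁ x + f₂ x) μ := h₁.add h₂
  have h₁₃ : Integrable (fun x => f₁ x + f₂ x - 2 * f₃ x) μ := h₁₂.sub (h₃.const_mul 2)
  rw [integral_sub h₁₃ (h₄.const_mul 2), integral_sub h₁₂ (h₃.const_mul 2), integral_add h₁ h₂,
    integral_const_mul, integral_const_mul]

/-- The local energy in a backward cone does not increase: the time derivative of the cutoff
dominates the flux through the lateral boundary because the slope `κ` of the cone is at least the
speed `w^{-1/2}`. -/
theorem cone_flux_nonpos {x₀ : Space d} {R κ ε : ℝ} (hε : 0 < ε) (hκ : 0 < κ)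
    {w b : BoundedContinuousFunction (Space d) ℝ} (hw : ∀ x, 0 < w x ∧ 1 ≤ κ ^ 2 * w x)
    (hb : ∀ x, 0 ≤ b x) (t : ℝ) (u : Lp ℝ 2 (volume : Measure (Space d)))
    (P : Lp (Space d) 2 (volume : Measure (Space d))) :
    inner ℝ (scalarMul w (scalarMul (coneCutoffDeriv x₀ R κ hε t) u)) u
      + inner ℝ (scalarMul (coneCutoffDeriv x₀ R κ hε t) P) P
      - 2 * inner ℝ (scalarMul b u) (scalarMul (coneCutoff x₀ R κ hε t).bcf u)
      - 2 * inner ℝ P (H1.mulGrad (coneCutoff x₀ R κ hε t) u) ≤ 0 := by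
  obtain ⟨χ, hχ⟩ : ∃ χ, χ = coneCutoff x₀ R κ hε t := ⟨_, rfl⟩
  obtain ⟨χ', hχ'⟩ : ∃ χ', χ' = coneCutoffDeriv x₀ R κ hε t := ⟨_, rfl⟩
  rw [← hχ, ← hχ']
  have i1 := L2.integrable_inner (𝕜 := ℝ) (scalarMul w (scalarMul χ' u)) u
  have i2 := L2.integrable_inner (𝕜 := ℝ) (scalarMul χ' P) P
  have i3 := L2.integrable_inner (𝕜 := ℝ) (scalarMul b u) (scalarMul χ.bcf u)
  have i4 := L2.integrable_inner (𝕜 := ℝ) P (H1.mulGrad χ u)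
  have e : inner ℝ (scalarMul w (scalarMul χ' u)) u + inner ℝ (scalarMul χ' P) P
      - 2 * inner ℝ (scalarMul b u) (scalarMul χ.bcf u) - 2 * inner ℝ P (H1.mulGrad χ u)
      = ∫ x, (inner ℝ (scalarMul w (scalarMul χ' u) x) (u x) + inner ℝ (scalarMul χ' P x) (P x)
        - 2 * inner ℝ (scalarMul b u x) (scalarMul χ.bcf u x)
        - 2 * inner ℝ (P x) (H1.mulGrad χ u x)) := by
    rw [L2.inner_def, L2.inner_def, L2.inner_def, L2.inner_def]
    exact (integral_add_sub_two_mul i1 i2 i3 i4).symm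
  rw [e]
  refine integral_nonpos_of_ae ?_
  filter_upwards [coeFn_scalarMul w (scalarMul χ' u), coeFn_scalarMul χ' u, coeFn_scalarMul χ' P,
    coeFn_scalarMul b u, coeFn_scalarMul χ.bcf u, H1.coeFn_mulGrad χ u] with x h1 h2 h3 h4 h5 h6
  rw [h1, h2, h3, h4, h5, h6, hχ', coneCutoffDeriv_apply]
  simp only [smul_eq_mul, real_inner_smul_left, real_inner_smul_right, TestFn.bcf_apply,
    Pi.zero_apply, real_inner_self_eq_norm_sq]
  obtain ⟨s, hs⟩ : ∃ s, s = deriv Real.smoothTransition (R - κ * t - regDist x₀ ε x) := ⟨_, rfl⟩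
  have hs0 : 0 ≤ s := hs ▸ deriv_smoothTransition_nonneg _
  have hg : ‖∇ (χ : Space d → ℝ) x‖ ≤ s := by
    rw [hχ, hs]; exact norm_gradient_coneCutoff_le x₀ R κ hε t x
  have hχ0 : 0 ≤ χ x := hχ ▸ coneCutoff_nonneg x₀ R κ hε t x
  rw [← hs]
  have k1 : |inner ℝ (P x) (∇ (χ : Space d → ℝ) x)| ≤ ‖P x‖ * s :=
    (abs_real_inner_le_norm _ _).trans (by gcongr)
  have k2 : -(u x * inner ℝ (P x) (∇ (χ : Space d → ℝ) x)) ≤ |u x| * (‖P x‖ * s) := by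
    refine (neg_le_abs _).trans ?_
    rw [abs_mul]
    gcongr
  -- `2 |u| |P| ≤ κ⁻¹ |u|² + κ |P|²`, and `κ⁻¹ ≤ κ w`
  have k3 : 2 * (|u x| * ‖P x‖) ≤ κ * (w x * u x ^ 2) + κ * ‖P x‖ ^ 2 := by
    have h7 : 0 ≤ (|u x| - κ * ‖P x‖) ^ 2 := sq_nonneg _
    have h8 : |u x| ^ 2 = u x ^ 2 := sq_abs _
    have h9 : u x ^ 2 ≤ κ ^ 2 * w x * u x ^ 2 := le_mul_of_one_le_left (sq_nonneg _) (hw x).2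
    refine le_of_mul_le_mul_left ?_ hκ
    nlinarith
  have k4 := mul_le_mul_of_nonneg_right k3 hs0
  have k5 : 0 ≤ b x * u x * (χ x * u x) := by
    have : b x * u x * (χ x * u x) = b x * χ x * u x ^ 2 := by ring
    rw [this]
    exact mul_nonneg (mul_nonneg (hb x) hχ0) (sq_nonneg _)
  have hin : ∀ y z : ℝ, (inner ℝ y z : ℝ) = y * z := fun y z => by simp [mul_comm]
  rw [hin, hin]
  linarith

theorem scalarMul_mul {E : Type*} [NormedAddCommGroup E] [NormedSpace ℝ E]
    (f g : BoundedContinuousFunction (Space d) ℝ) (u : Lp E 2 (volume : Measure (Space d))) :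
    scalarMul (f * g) u = scalarMul f (scalarMul g u) := by
  refine Lp.ext ?_
  filter_upwards [coeFn_scalarMul (f * g) u, coeFn_scalarMul f (scalarMul g u),
    coeFn_scalarMul g u] with x h1 h2 h3
  rw [h1, h2, h3, smul_smul, BoundedContinuousFunction.mul_apply]

theorem scalarMul_comm {E : Type*} [NormedAddCommGroup E] [NormedSpace ℝ E]
    (f g : BoundedContinuousFunction (Space d) ℝ) (u : Lp E 2 (volume : Measure (Space d))) :
    scalarMul f (scalarMul g u) = scalarMul g (scalarMul f u) := by
  rw [← scalarMul_mul, mul_comm, scalarMul_mul]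

theorem inner_scalarMul_self_nonneg {E : Type*} [NormedAddCommGroup E] [InnerProductSpace ℝ E]
    {f : BoundedContinuousFunction (Space d) ℝ} (hf : ∀ x, 0 ≤ f x)
    (u : Lp E 2 (volume : Measure (Space d))) : 0 ≤ inner ℝ (scalarMul f u) u := by
  rw [inner_scalarMul]
  exact integral_nonneg fun x => mul_nonneg (hf x) real_inner_self_nonneg

/-- A nonpositive local energy `∫ w χ u²` forces `u = 0` where `χ ≠ 0`. -/
theorem scalarMul_eq_zero_of_inner_nonpos {w χ : BoundedContinuousFunction (Space d) ℝ}
    (hw : ∀ x, 0 < w x) (hχ : ∀ x, 0 ≤ χ x) {u : Lp ℝ 2 (volume : Measure (Space d))}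
    (h : inner ℝ (scalarMul w (scalarMul χ u)) u ≤ 0) : scalarMul χ u = 0 := by
  have hn : ∀ x, 0 ≤ (w * χ) x := fun x => mul_nonneg (hw x).le (hχ x)
  have h0 : inner ℝ (scalarMul (w * χ) u) u = 0 :=
    le_antisymm ((scalarMul_mul w χ u).symm ▸ h) (inner_scalarMul_self_nonneg hn u)
  have hi := L2.integrable_inner (𝕜 := ℝ) (scalarMul (w * χ) u) u
  rw [L2.inner_def, integral_eq_zero_iff_of_nonneg_ae ?_ hi] at h0
  · refine Lp.ext ?_
    filter_upwards [h0, coeFn_scalarMul (w * χ) u, coeFn_scalarMul χ u,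
      Lp.coeFn_zero ℝ 2 (volume : Measure (Space d))] with x h1 h2 h3 h4
    rw [h3, h4]
    rw [h2, real_inner_smul_left, BoundedContinuousFunction.mul_apply] at h1
    simpa [(hw x).ne', or_comm] using h1
  · filter_upwards [coeFn_scalarMul (w * χ) u] with x h2
    rw [h2, real_inner_smul_left]
    exact mul_nonneg (hn x) real_inner_self_nonneg

/-- The time derivative of the local energy `∫ w χ u² + ∫ χ |P|²`, where `u' = v` and `P' = G`. -/
theorem deriv_energy_eq {E : Type*} [NormedAddCommGroup E] [InnerProductSpace ℝ E]
    (w χ χ' : BoundedContinuousFunction (Space d) ℝ) (u v : Lp ℝ 2 (volume : Measure (Space d)))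
    (P G : Lp E 2 (volume : Measure (Space d))) :
    inner ℝ (scalarMul w (scalarMul χ' u + scalarMul χ v)) u
      + inner ℝ (scalarMul w (scalarMul χ u)) v
      + (inner ℝ (scalarMul χ' P + scalarMul χ G) P + inner ℝ (scalarMul χ P) G)
    = inner ℝ (scalarMul w (scalarMul χ' u)) u + inner ℝ (scalarMul χ' P) P
      + 2 * inner ℝ (scalarMul w v) (scalarMul χ u) + 2 * inner ℝ P (scalarMul χ G) := by
  have h1 : inner ℝ (scalarMul w (scalarMul χ v)) u = inner ℝ (scalarMul w v) (scalarMul χ u) := by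
    rw [inner_scalarMul_right, scalarMul_comm]
  have h2 : inner ℝ (scalarMul w (scalarMul χ u)) v = inner ℝ (scalarMul w v) (scalarMul χ u) := by
    rw [real_inner_comm, inner_scalarMul_right]
  have h3 : inner ℝ (scalarMul χ G) P = inner ℝ P (scalarMul χ G) := real_inner_comm _ _
  rw [map_add, inner_add_left, inner_add_left, h1, h2, h3, ← inner_scalarMul_right χ P]
  ring

/-- Uniqueness in a backward cone for the wave equation integrated once in time: the equation is
tested with `χ(t) q(t)`, where `χ(t)` is the cutoff function of the cone. -/
theorem scalarMul_coneCutoff_eq_zero {T : ℝ} {x₀ : Space d} {R κ ε : ℝ} (hε : 0 < ε) (hκ : 0 < κ)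
    {w b : BoundedContinuousFunction (Space d) ℝ} (hw : ∀ x, 0 < w x ∧ 1 ≤ κ ^ 2 * w x)
    (hb : ∀ x, 0 ≤ b x) {q : ℝ → H1 d} {v : ℝ → Lp ℝ 2 (volume : Measure (Space d))}
    {u : ℝ → Lp ℝ 2 (volume : Measure (Space d))} {P : ℝ → Lp (Space d) 2 (volume : Measure (Space d))}
    (pu : IsPrimitive T u v) (hu0 : u 0 = 0) (pP : IsPrimitive T P fun t => H1.grad d (q t))
    (hP0 : P 0 = 0) (hqu : ∀ᵐ t ∂(timeMeasure T), H1.toL2 d (q t) = u t)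
    (heq : ∀ᵐ t ∂(timeMeasure T),
      inner ℝ (scalarMul w (v t)) (H1.toL2 d (H1.mul (coneCutoff x₀ R κ hε t) (q t)))
      + inner ℝ (scalarMul b (H1.toL2 d (q t)))
        (H1.toL2 d (H1.mul (coneCutoff x₀ R κ hε t) (q t)))
      + inner ℝ (P t) (H1.grad d (H1.mul (coneCutoff x₀ R κ hε t) (q t))) = 0)
    {t : ℝ} (ht : t ∈ Set.Icc 0 T) :
    scalarMul (coneCutoff x₀ R κ hε t).bcf (u t) = 0 := by
  have pχ := isPrimitive_coneCutoff x₀ R κ hε T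
  have p3 : IsPrimitive T (fun s => scalarMul (coneCutoff x₀ R κ hε s).bcf (u s))
      (fun s => scalarMul (coneCutoffDeriv x₀ R κ hε s) (u s)
        + scalarMul (coneCutoff x₀ R κ hε s).bcf (v s)) :=
    IsPrimitive.bilin (bcfMul (d := d) (ContinuousLinearMap.lsmul ℝ ℝ)) pχ pu
  have p4 : IsPrimitive T (fun s => scalarMul (coneCutoff x₀ R κ hε s).bcf (P s))
      (fun s => scalarMul (coneCutoffDeriv x₀ R κ hε s) (P s)
        + scalarMul (coneCutoff x₀ R κ hε s).bcf (H1.grad d (q s))) :=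
    IsPrimitive.bilin (bcfMul (d := d) (ContinuousLinearMap.lsmul ℝ ℝ)) pχ pP
  have p5 : IsPrimitive T (fun s => scalarMul w (scalarMul (coneCutoff x₀ R κ hε s).bcf (u s)))
      (fun s => scalarMul w (scalarMul (coneCutoffDeriv x₀ R κ hε s) (u s)
        + scalarMul (coneCutoff x₀ R κ hε s).bcf (v s))) := p3.clm_comp (scalarMul w)
  have p1 : IsPrimitive T
      (fun s => inner ℝ (scalarMul w (scalarMul (coneCutoff x₀ R κ hε s).bcf (u s))) (u s))
      (fun s => inner ℝ (scalarMul w (scalarMul (coneCutoffDeriv x₀ R κ hε s) (u s)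
        + scalarMul (coneCutoff x₀ R κ hε s).bcf (v s))) (u s)
      + inner ℝ (scalarMul w (scalarMul (coneCutoff x₀ R κ hε s).bcf (u s))) (v s)) :=
    p5.bilin (innerSL ℝ) pu
  have p2 : IsPrimitive T
      (fun s => inner ℝ (scalarMul (coneCutoff x₀ R κ hε s).bcf (P s)) (P s))
      (fun s => inner ℝ (scalarMul (coneCutoffDeriv x₀ R κ hε s) (P s)
        + scalarMul (coneCutoff x₀ R κ hε s).bcf (H1.grad d (q s))) (P s)
      + inner ℝ (scalarMul (coneCutoff x₀ R κ hε s).bcf (P s)) (H1.grad d (q s))) :=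
    p4.bilin (innerSL ℝ) pP
  have p := p1.add p2
  have hneg : ∀ᵐ s ∂(timeMeasure T),
      inner ℝ (scalarMul w (scalarMul (coneCutoffDeriv x₀ R κ hε s) (u s)
        + scalarMul (coneCutoff x₀ R κ hε s).bcf (v s))) (u s)
      + inner ℝ (scalarMul w (scalarMul (coneCutoff x₀ R κ hε s).bcf (u s))) (v s)
      + (inner ℝ (scalarMul (coneCutoffDeriv x₀ R κ hε s) (P s)
        + scalarMul (coneCutoff x₀ R κ hε s).bcf (H1.grad d (q s))) (P s)
      + inner ℝ (scalarMul (coneCutoff x₀ R κ hε s).bcf (P s)) (H1.grad d (q s))) ≤ 0 := by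
    filter_upwards [hqu, heq] with s h1 h2
    have h3 := cone_flux_nonpos hε hκ hw hb s (u s) (P s) (x₀ := x₀) (R := R) (w := w) (b := b)
    rw [H1.toL2_mul, H1.grad_mul, h1, inner_add_right] at h2
    rw [deriv_energy_eq]
    linarith
  have hE := p.eq t ht
  have hint : (∫ s in 0..t, (
      inner ℝ (scalarMul w (scalarMul (coneCutoffDeriv x₀ R κ hε s) (u s)
        + scalarMul (coneCutoff x₀ R κ hε s).bcf (v s))) (u s)
      + inner ℝ (scalarMul w (scalarMul (coneCutoff x₀ R κ hε s).bcf (u s))) (v s)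
      + (inner ℝ (scalarMul (coneCutoffDeriv x₀ R κ hε s) (P s)
        + scalarMul (coneCutoff x₀ R κ hε s).bcf (H1.grad d (q s))) (P s)
      + inner ℝ (scalarMul (coneCutoff x₀ R κ hε s).bcf (P s)) (H1.grad d (q s))))) ≤ 0 := by
    rw [intervalIntegral.integral_of_le ht.1]
    refine integral_nonpos_of_ae ?_
    refine ae_restrict_of_ae_restrict_of_subset (fun r hr => ?_) hneg
    exact ⟨hr.1.le, hr.2.trans ht.2⟩
  have hE' : inner ℝ (scalarMul w (scalarMul (coneCutoff x₀ R κ hε t).bcf (u t))) (u t)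
      + inner ℝ (scalarMul (coneCutoff x₀ R κ hε t).bcf (P t)) (P t) ≤ 0 := by
    have hz : inner ℝ (scalarMul w (scalarMul (coneCutoff x₀ R κ hε 0).bcf (u 0))) (u 0)
        + inner ℝ (scalarMul (coneCutoff x₀ R κ hε 0).bcf (P 0)) (P 0) = 0 := by
      rw [hu0, hP0, inner_zero_right, inner_zero_right, add_zero]
    exact hE.le.trans (add_nonpos hz.le hint)
  have hPn := inner_scalarMul_self_nonneg (f := (coneCutoff x₀ R κ hε t).bcf)
    (coneCutoff_nonneg x₀ R κ hε t) (P t)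
  exact scalarMul_eq_zero_of_inner_nonpos (w := w) (χ := (coneCutoff x₀ R κ hε t).bcf)
    (fun x => (hw x).1) (coneCutoff_nonneg x₀ R κ hε t) (u := u t) (by linarith)

theorem regDist_le (x₀ : Space d) {ε : ℝ} (hε : 0 ≤ ε) (x : Space d) :
    regDist x₀ ε x ≤ ‖x - x₀‖ + ε :=
  Real.sqrt_le_iff.2 ⟨by positivity, by nlinarith [norm_nonneg (x - x₀)]⟩

/-- As the regularisation `ε` of the distance tends to `0`, the supports of the cutoffs exhaust the
open section of the cone. -/
theorem ae_eq_zero_of_scalarMul_coneCutoff {x₀ : Space d} {R κ t : ℝ}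
    {u : Lp ℝ 2 (volume : Measure (Space d))}
    (h : ∀ (ε : ℝ) (hε : 0 < ε), scalarMul (coneCutoff x₀ R κ hε t).bcf u = 0) :
    ∀ᵐ x : Space d, ‖x - x₀‖ < R - κ * t → u x = 0 := by
  have h' : ∀ n : ℕ, ∀ᵐ x : Space d,
      coneCutoff x₀ R κ (Nat.one_div_pos_of_nat (n := n)) t x * u x = 0 := fun n => by
    filter_upwards [coeFn_scalarMul (coneCutoff x₀ R κ (Nat.one_div_pos_of_nat (n := n)) t).bcf u,
      Lp.coeFn_zero ℝ 2 (volume : Measure (Space d))] with x h1 h2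
    rw [h, h2] at h1
    exact h1.symm
  filter_upwards [ae_all_iff.2 h'] with x hx hlt
  obtain ⟨n, hn⟩ := exists_nat_one_div_lt (sub_pos.2 hlt)
  refine (mul_eq_zero.1 (hx n)).resolve_left (ne_of_gt ?_)
  rw [coneCutoff_apply]
  refine Real.smoothTransition.pos_of_pos ?_
  have := regDist_le x₀ (Nat.one_div_pos_of_nat (n := n) (α := ℝ)).le x
  linarith

end Cone

/-! ### The wave equation integrated once in time -/

section Integrated

variable {d : ℕ}

/-- The product of a smooth function and a test function. -/
def TestFn.smoothMul {f : Space d → ℝ} (hf : ContDiff ℝ ∞ f) (χ : TestFn d) : TestFn d :=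
  ⟨fun x => f x * χ x, hf.mul χ.contDiff, χ.hasCompactSupport.mul_left⟩

theorem TestFn.smoothMul_apply {f : Space d → ℝ} (hf : ContDiff ℝ ∞ f) (χ : TestFn d)
    (x : Space d) : TestFn.smoothMul hf χ x = f x * χ x := rfl

theorem H1.mul_eq_mul {χ₁ χ₂ ψ : TestFn d} (h : ∀ x, χ₁ x * χ₂ x = ψ x) (u : H1 d) :
    H1.mul χ₁ (H1.mul χ₂ u) = H1.mul ψ u := by
  refine H1.toL2_injective (Lp.ext ?_)
  filter_upwards [H1.coeFn_toL2_mul χ₁ (H1.mul χ₂ u), H1.coeFn_toL2_mul χ₂ u,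
    H1.coeFn_toL2_mul ψ u] with x h1 h2 h3
  rw [h1, h2, h3, ← mul_assoc, h]

theorem coeFn_toL2_smoothMul {f : Space d → ℝ} (hf : ContDiff ℝ ∞ f) (χ : TestFn d) (ψ : H1 d) :
    ∀ᵐ x : Space d, H1.toL2 d (H1.mul (TestFn.smoothMul hf χ) ψ) x
      = f x * H1.toL2 d (H1.mul χ ψ) x := by
  filter_upwards [H1.coeFn_toL2_mul χ ψ, H1.coeFn_toL2_mul (TestFn.smoothMul hf χ) ψ] with x h1 h2
  rw [h1, h2, TestFn.smoothMul_apply, mul_assoc]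

theorem cutoff_eq_one_of_mem_closedBall {x₀ : Space d} {R : ℝ} {n : ℕ} (hn : R + ‖x₀‖ ≤ n)
    {x : Space d} (hx : ‖x - x₀‖ ≤ R) : cutoff d n x = 1 := by
  refine cutoff_eq_one ?_
  have : ‖x‖ ≤ ‖x - x₀‖ + ‖x₀‖ := by simpa using norm_add_le (x - x₀) x₀
  linarith

theorem add_add_eq_sub {a b c a₁ b₁ c₁ a₂ b₂ c₂ : ℝ} (ha : a = a₁ - a₂) (hb : b = b₁ - b₂)
    (hc : c = c₁ - c₂) : a + b + c = a₁ + b₁ + c₁ - (a₂ + b₂ + c₂) := by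
  rw [ha, hb, hc]
  ring

theorem add_add_eq_of_eq {a b c e a' b' c' e' : ℝ} (h : a + b + c = e) (ha : a = a') (hb : b = b')
    (hc : c = c') (he : e = e') : a' + b' + c' = e' := by
  rw [← ha, ← hb, ← hc, ← he, h]

/-- The weak form `∫ χ w v ψ + ∫ b u ψ + ∫ P · ∇(χ ψ)` of `χ w v + b u - χ div P`. -/
def waveLhs (w b : BoundedContinuousFunction (Space d) ℝ) (χ : TestFn d)
    (v u : Lp ℝ 2 (volume : Measure (Space d))) (P : Lp (Space d) 2 (volume : Measure (Space d)))
    (ψ : H1 d) : ℝ :=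
  inner ℝ (scalarMul w v) (H1.toL2 d (H1.mul χ ψ)) + inner ℝ (scalarMul b u) (H1.toL2 d ψ)
    + inner ℝ P (H1.grad d (H1.mul χ ψ))

theorem waveLhs_sub (w b : BoundedContinuousFunction (Space d) ℝ) (χ : TestFn d)
    (v u v₂ u₂ : Lp ℝ 2 (volume : Measure (Space d)))
    (P P₂ : Lp (Space d) 2 (volume : Measure (Space d))) (ψ : H1 d) :
    waveLhs w b χ (v - v₂) (u - u₂) (P - P₂) ψ
      = waveLhs w b χ v u P ψ - waveLhs w b χ v₂ u₂ P₂ ψ := by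
  have h1 := inner_sub_left (𝕜 := ℝ) (scalarMul w v) (scalarMul w v₂) (H1.toL2 d (H1.mul χ ψ))
  have h2 := inner_sub_left (𝕜 := ℝ) (scalarMul b u) (scalarMul b u₂) (H1.toL2 d ψ)
  rw [← (scalarMul w).map_sub v v₂] at h1
  rw [← (scalarMul b).map_sub u u₂] at h2
  exact add_add_eq_sub h1 h2 (inner_sub_left P P₂ (H1.grad d (H1.mul χ ψ)))

theorem integral_sub_of_time {E : Type*} [NormedAddCommGroup E] [NormedSpace ℝ E] {T : ℝ}
    {f g : ℝ → E} (hf : Integrable f (timeMeasure T)) (hg : Integrable g (timeMeasure T)) {t : ℝ}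
    (ht : t ∈ Set.Icc 0 T) :
    ∫ s in 0..t, (f s - g s) = (∫ s in 0..t, f s) - ∫ s in 0..t, g s :=
  have h0 : (0 : ℝ) ∈ Set.Icc 0 T := ⟨le_rfl, ht.1.trans ht.2⟩
  intervalIntegral.integral_sub (intervalIntegrable_of_time hf h0 ht)
    (intervalIntegrable_of_time hg h0 ht)

/-- `q` satisfies `q' = v`, and `w v + a q - div ∫₀ᵗ ∇q = F`, with vanishing initial values, in the
sense of distributions in space and for almost every time. -/
structure IsIntegratedWave (w : BoundedContinuousFunction (Space d) ℝ) {a : Space d → ℝ}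
    (ha : ContDiff ℝ ∞ a) (T : ℝ) (q : ℝ → H1 d) (v : ℝ → Lp ℝ 2 (volume : Measure (Space d)))
    (F : ℝ → HNegOne d) : Prop where
  integrable : Integrable q (timeMeasure T)
  integrable_deriv : Integrable v (timeMeasure T)
  eq_integral : ∀ᵐ t ∂(timeMeasure T), H1.toL2 d (q t) = ∫ s in 0..t, v s
  equation : ∀ χ : TestFn d, ∀ᵐ t ∂(timeMeasure T), ∀ ψ : H1 d,
    waveLhs w (TestFn.smoothMul ha χ).bcf χ (v t) (H1.toL2 d (q t))
      (∫ s in 0..t, H1.grad d (q s)) ψ = F t (H1.mul χ ψ)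

namespace IsIntegratedWave

variable {w : BoundedContinuousFunction (Space d) ℝ} {a : Space d → ℝ} {ha : ContDiff ℝ ∞ a} {T : ℝ}
  {q q₂ : ℝ → H1 d} {v v₂ : ℝ → Lp ℝ 2 (volume : Measure (Space d))} {F F₂ : ℝ → HNegOne d}

theorem integrable_grad (h : IsIntegratedWave w ha T q v F) :
    Integrable (fun t => H1.grad d (q t)) (timeMeasure T) := (H1.grad d).integrable_comp h.integrable

theorem sub (h : IsIntegratedWave w ha T q v F) (h₂ : IsIntegratedWave w ha T q₂ v₂ F₂) :
    IsIntegratedWave w ha T (fun t => q t - q₂ t) (fun t => v t - v₂ t) (fun t => F t - F₂ t) where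
  integrable := h.integrable.sub h₂.integrable
  integrable_deriv := h.integrable_deriv.sub h₂.integrable_deriv
  eq_integral := by
    filter_upwards [h.eq_integral, h₂.eq_integral, ae_mem_Icc] with t h1 h2 ht
    rw [ContinuousLinearMap.map_sub, h1, h2,
      integral_sub_of_time h.integrable_deriv h₂.integrable_deriv ht]
  equation := fun χ => by
    have e : ∀ t, (H1.grad d (q t - q₂ t)) = H1.grad d (q t) - H1.grad d (q₂ t) := fun t =>
      ContinuousLinearMap.map_sub _ _ _
    filter_upwards [h.equation χ, h₂.equation χ, ae_mem_Icc] with t h1 h2 ht ψ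
    simp only [e]
    rw [integral_sub_of_time h.integrable_grad h₂.integrable_grad ht,
      ContinuousLinearMap.map_sub, waveLhs_sub, h1, h2, _root_.sub_apply]

/-- Domain of dependence: if the source `F` vanishes on the ball of radius `R` about `x₀`, then the
solution vanishes in the backward cone over that ball. -/
theorem ae_eq_zero_of_ball (h : IsIntegratedWave w ha T q v F) (ha0 : ∀ x, 0 ≤ a x) {κ : ℝ}
    (hκ : 0 < κ) (hw : ∀ x, 0 < w x ∧ 1 ≤ κ ^ 2 * w x) {x₀ : Space d} {R : ℝ}
    (hF : ∀ t ∈ Set.Icc 0 T, ∀ χ : TestFn d, (∀ x, R ≤ ‖x - x₀‖ → χ x = 0) →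
      ∀ ψ, F t (H1.mul χ ψ) = 0) {t : ℝ} (ht : t ∈ Set.Icc 0 T) :
    ∀ᵐ x : Space d, ‖x - x₀‖ < R - κ * t → (∫ s in 0..t, v s : Lp ℝ 2 volume) x = 0 := by
  refine ae_eq_zero_of_scalarMul_coneCutoff fun ε hε => ?_
  -- localising the damping to a ball that contains the base of the cone makes it bounded
  obtain ⟨n, hn⟩ := exists_nat_ge (R + ‖x₀‖)
  have hb : ∀ x, 0 ≤ (TestFn.smoothMul ha (cutoff d n)).bcf x := fun x =>
    mul_nonneg (ha0 x) (cutoff_mem_Icc n x).1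
  refine scalarMul_coneCutoff_eq_zero (q := q) (v := v) (u := fun t => ∫ s in 0..t, v s)
    (P := fun t => ∫ s in 0..t, H1.grad d (q s)) hε hκ hw hb
    (isPrimitive_integral h.integrable_deriv) (intervalIntegral.integral_same)
    (isPrimitive_integral h.integrable_grad)
    (intervalIntegral.integral_same) h.eq_integral ?_ ht
  filter_upwards [h.equation (cutoff d n), ae_mem_Icc] with s h1 hs
  have hc : ∀ x, R ≤ ‖x - x₀‖ → coneCutoff x₀ R κ hε s x = 0 := fun x hx =>
    coneCutoff_eq_zero hε hκ.le hs.1 hx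
  have e : H1.mul (cutoff d n) (H1.mul (coneCutoff x₀ R κ hε s) (q s))
      = H1.mul (coneCutoff x₀ R κ hε s) (q s) := by
    refine H1.mul_eq_mul (fun x => ?_) _
    rcases le_total R ‖x - x₀‖ with hx | hx
    · rw [hc x hx, mul_zero]
    · rw [cutoff_eq_one_of_mem_closedBall hn hx, one_mul]
  have h2 := h1 (H1.mul (coneCutoff x₀ R κ hε s) (q s))
  rw [waveLhs, e, hF s hs _ hc] at h2
  exact h2

/-- The solution is determined by its source. -/
theorem ae_eq_zero (hT : 0 ≤ T) (h : IsIntegratedWave w ha T q v F) (ha0 : ∀ x, 0 ≤ a x) {κ : ℝ}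
    (hκ : 0 < κ) (hw : ∀ x, 0 < w x ∧ 1 ≤ κ ^ 2 * w x) (hF : ∀ t, F t = 0) :
    q =ᵐ[timeMeasure T] 0 ∧ v =ᵐ[timeMeasure T] 0 := by
  have h0 : ∀ t ∈ Set.Icc 0 T, (∫ s in 0..t, v s : Lp ℝ 2 (volume : Measure (Space d))) = 0 := by
    intro t ht
    refine Lp.ext ?_
    have h1 : ∀ n : ℕ, ∀ᵐ x : Space d, ‖x - 0‖ < (n : ℝ) - κ * t →
        (∫ s in 0..t, v s : Lp ℝ 2 volume) x = 0 := fun n =>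
      h.ae_eq_zero_of_ball ha0 hκ hw (fun s _ χ _ ψ => by rw [hF]; rfl) ht
    filter_upwards [ae_all_iff.2 h1, Lp.coeFn_zero ℝ 2 (volume : Measure (Space d))] with x hx h2
    obtain ⟨n, hn⟩ := exists_nat_gt (‖x - 0‖ + κ * t)
    rw [h2, hx n (by linarith), Pi.zero_apply]
  refine ⟨?_, ae_eq_zero_of_primitive_eq_zero hT h.integrable_deriv ?_⟩
  · filter_upwards [h.eq_integral, ae_mem_Icc] with t h1 ht
    rw [h0 t ht] at h1
    exact H1.toL2_injective (h1.trans (map_zero _).symm)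
  · filter_upwards [ae_mem_Icc] with t ht using h0 t ht

end IsIntegratedWave

end Integrated

/-! ### Weak solutions satisfy the integrated equation -/

section Weak

variable {d : ℕ} {Ω : Set (Space d)} {T : ℝ}

/-- The negative of the adjoint of a bounded operator. -/
def negDual {V W : Type*} [NormedAddCommGroup V] [NormedSpace ℝ V] [NormedAddCommGroup W]
    [NormedSpace ℝ W] (L : V →L[ℝ] W) : StrongDual ℝ W →L[ℝ] StrongDual ℝ V :=
  -((ContinuousLinearMap.compL ℝ V W ℝ).flip L)

theorem memLp_clm {E F : Type*} [NormedAddCommGroup E] [NormedSpace ℝ E] [NormedAddCommGroup F]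
    [NormedSpace ℝ F] (L : E →L[ℝ] F) {f : ℝ → E} (h : MemLp f 2 (timeMeasure T)) :
    MemLp (fun t => L (f t)) 2 (timeMeasure T) := L.comp_memLp' h

theorem clm_intervalIntegral {E F : Type*} [NormedAddCommGroup E] [NormedSpace ℝ E]
    [CompleteSpace E] [NormedAddCommGroup F] [NormedSpace ℝ F] [CompleteSpace F] (L : E →L[ℝ] F)
    {f : ℝ → E} (hf : MemLp f 2 (timeMeasure T)) {t : ℝ} (ht : t ∈ Set.Icc 0 T) :
    ∫ s in 0..t, L (f s) = L (∫ s in 0..t, f s) :=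
  L.intervalIntegral_comp_comm
    (intervalIntegrable_of_time (hf.integrable (by norm_num)) ⟨le_rfl, ht.1.trans ht.2⟩ ht)

/-- The functional `φ ↦ -⟨G, φ|_∂Ω⟩` on `H^1` given by a jump `G` of the normal derivative. -/
def jumpLoad (tr : H1 d →L[ℝ] HHalf Ω) (G : HNegHalf Ω) : HNegOne d := negDual tr G

theorem jumpLoad_apply (tr : H1 d →L[ℝ] HHalf Ω) (G : HNegHalf Ω) (φ : H1 d) :
    jumpLoad tr G φ = -G (tr φ) := rfl

theorem toHNegHalf_eq (g : HHalf Ω) : g.toHNegHalf = dualEmb (HHalf.toL2 Ω) (HHalf.toL2 Ω g) := rfl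

theorem IsJumpDatum.memLp_toHNegHalf {g : ℝ → HHalf Ω} {gt : ℝ → HNegHalf Ω}
    (h : IsJumpDatum Ω T g gt) : MemLp (fun t => (g t).toHNegHalf) 2 (timeMeasure T) :=
  memLp_clm (dualEmb (HHalf.toL2 Ω)) (memLp_clm (HHalf.toL2 Ω) h.memLp)

theorem memLp_jumpLoad (tr : H1 d →L[ℝ] HHalf Ω) {G : ℝ → HNegHalf Ω}
    (h : MemLp G 2 (timeMeasure T)) :
    MemLp (fun t => jumpLoad tr (G t)) 2 (timeMeasure T) :=
  memLp_clm (negDual tr) h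

theorem integral_apply_of_memLp {V : Type*} [NormedAddCommGroup V] [NormedSpace ℝ V]
    {f : ℝ → StrongDual ℝ V} (hf : MemLp f 2 (timeMeasure T)) {t : ℝ} (ht : t ∈ Set.Icc 0 T)
    (ψ : V) : ∫ s in 0..t, f s ψ = (∫ s in 0..t, f s) ψ :=
  clm_intervalIntegral (ContinuousLinearMap.apply ℝ ℝ ψ) hf ht

theorem integral_inner_of_memLp {H : Type*} [NormedAddCommGroup H] [InnerProductSpace ℝ H]
    [CompleteSpace H] {f : ℝ → H} (hf : MemLp f 2 (timeMeasure T)) {t : ℝ}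
    (ht : t ∈ Set.Icc 0 T) (h : H) :
    ∫ s in 0..t, inner ℝ (f s) h = inner ℝ (∫ s in 0..t, f s) h :=
  clm_intervalIntegral ((innerSL ℝ).flip h) hf ht

theorem memLp_inner_const {H : Type*} [NormedAddCommGroup H] [InnerProductSpace ℝ H]
    {f : ℝ → H} (hf : MemLp f 2 (timeMeasure T)) (h : H) :
    MemLp (fun s => (inner ℝ (f s) h : ℝ)) 2 (timeMeasure T) := memLp_clm ((innerSL ℝ).flip h) hf

theorem memLp_apply_const {V : Type*} [NormedAddCommGroup V] [NormedSpace ℝ V]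
    {f : ℝ → StrongDual ℝ V} (hf : MemLp f 2 (timeMeasure T)) (ψ : V) :
    MemLp (fun s => f s ψ) 2 (timeMeasure T) := memLp_clm (ContinuousLinearMap.apply ℝ ℝ ψ) hf

theorem integral_add_add_eq {f₁ f₂ f₃ g : ℝ → ℝ} (h₁ : MemLp f₁ 2 (timeMeasure T))
    (h₂ : MemLp f₂ 2 (timeMeasure T)) (h₃ : MemLp f₃ 2 (timeMeasure T))
    (h : ∀ᵐ s ∂(timeMeasure T), f₁ s + f₂ s + f₃ s = g s) {t : ℝ} (ht : t ∈ Set.Icc 0 T) :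
    (∫ s in 0..t, f₁ s) + (∫ s in 0..t, f₂ s) + (∫ s in 0..t, f₃ s) = ∫ s in 0..t, g s := by
  have h0 : (0 : ℝ) ∈ Set.Icc 0 T := ⟨le_rfl, ht.1.trans ht.2⟩
  have i₁ := intervalIntegrable_of_time (h₁.integrable (by norm_num)) h0 ht
  have i₂ := intervalIntegrable_of_time (h₂.integrable (by norm_num)) h0 ht
  have i₃ := intervalIntegrable_of_time (h₃.integrable (by norm_num)) h0 ht
  rw [← intervalIntegral.integral_add i₁ i₂, ← intervalIntegral.integral_add (i₁.add i₂) i₃]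
  refine intervalIntegral.integral_congr_ae_restrict ?_
  rw [Set.uIoc_of_le ht.1]
  have hs : Set.Ioc 0 t ⊆ Set.Icc 0 T := fun s hs => ⟨hs.1.le, hs.2.trans ht.2⟩
  exact ae_restrict_of_ae_restrict_of_subset hs h

theorem inner_eq_integral_mul {X : Type*} [MeasurableSpace X] {μ : Measure X} (f g : Lp ℝ 2 μ) :
    inner ℝ f g = ∫ x, f x * g x ∂μ := by
  rw [L2.inner_def]
  exact integral_congr_ae (Eventually.of_forall fun x => by simp [mul_comm])

theorem integral_mul_mul_eq_inner {a : Space d → ℝ} (ha : ContDiff ℝ ∞ a) (χ : TestFn d)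
    (v : Lp ℝ 2 (volume : Measure (Space d))) (ψ : H1 d) :
    ∫ x, a x * v x * H1.toL2 d (H1.mul χ ψ) x
      = inner ℝ (scalarMul (TestFn.smoothMul ha χ).bcf v) (H1.toL2 d ψ) := by
  rw [inner_scalarMul]
  refine integral_congr_ae ?_
  filter_upwards [H1.coeFn_toL2_mul χ ψ] with x hx
  rw [hx, TestFn.bcf_apply, TestFn.smoothMul_apply]
  simp only [RCLike.inner_apply, conj_trivial]
  ring

/-- The weak equation tested with `χ ψ`, with the weights `c⁻²` and `a` moved to test functions. The
cut-off `χ` is what makes these weights bounded multipliers, as neither the derivatives of `c⁻²` nor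
`a` need be bounded. -/
theorem IsWeakSolution.equation_mul {c a : Space d → ℝ}
    (hc : ContDiff ℝ ∞ fun x => (c x ^ 2)⁻¹) (ha : ContDiff ℝ ∞ a)
    {tr : H1 d →L[ℝ] HHalf Ω} (htr : ∀ u f, IsTrace Ω u f → f = HHalf.toL2 Ω (tr u))
    {g : ℝ → HHalf Ω} {q : ℝ → H1 d} {qt : ℝ → Lp ℝ 2 (volume : Measure (Space d))}
    {qtt : ℝ → HNegOne d} (h : IsWeakSolution c a Ω T g q qt qtt) (χ : TestFn d) (ψ : H1 d) :
    ∀ᵐ s ∂(timeMeasure T), qtt s (H1.mul (TestFn.smoothMul hc χ) ψ)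
      + inner ℝ (scalarMul (TestFn.smoothMul ha χ).bcf (qt s)) (H1.toL2 d ψ)
      + inner ℝ (H1.grad d (q s)) (H1.grad d (H1.mul χ ψ))
      = jumpLoad tr (g s).toHNegHalf (H1.mul χ ψ) := by
  obtain ⟨W, hW, hWeq⟩ := h.equation
  obtain ⟨f, hf, hfe⟩ := hWeq (H1.mul χ ψ)
  have hj : ∀ s, jumpLoad tr (g s).toHNegHalf (H1.mul χ ψ)
      = -∫ y, HHalf.toL2 Ω (g s) y * f y ∂(surfaceMeasure Ω) := by
    intro s
    rw [htr _ _ hf, jumpLoad_apply, toHNegHalf_eq, dualEmb_apply, inner_eq_integral_mul]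
  filter_upwards [hW, hfe] with s k1 k2
  have k3 : W s (H1.mul χ ψ) = qtt s (H1.mul (TestFn.smoothMul hc χ) ψ) :=
    k1 _ _ (coeFn_toL2_smoothMul hc χ ψ)
  have k5 : inner ℝ (H1.grad d (q s)) (H1.grad d (H1.mul χ ψ))
    = ∫ x, inner ℝ (H1.grad d (q s) x) (H1.grad d (H1.mul χ ψ) x) := L2.inner_def _ _
  exact add_add_eq_of_eq k2.2 k3 (integral_mul_mul_eq_inner ha χ (qt s) ψ) k5.symm (hj s).symm

/-- The equation of `equation_mul` integrated from `0` to `t`. This removes the exceptional null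
set of times, which depends on `ψ`. -/
theorem IsWeakSolution.integral_equation_mul {c a : Space d → ℝ}
    (hc : ContDiff ℝ ∞ fun x => (c x ^ 2)⁻¹) (ha : ContDiff ℝ ∞ a)
    {tr : H1 d →L[ℝ] HHalf Ω} (htr : ∀ u f, IsTrace Ω u f → f = HHalf.toL2 Ω (tr u))
    {g : ℝ → HHalf Ω} (hg : MemLp (fun t => (g t).toHNegHalf) 2 (timeMeasure T))
    {q : ℝ → H1 d} {qt : ℝ → Lp ℝ 2 (volume : Measure (Space d))}
    {qtt : ℝ → HNegOne d} (h : IsWeakSolution c a Ω T g q qt qtt) {t : ℝ} (ht : t ∈ Set.Icc 0 T)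
    (χ : TestFn d) (ψ : H1 d) :
    (∫ s in 0..t, qtt s) (H1.mul (TestFn.smoothMul hc χ) ψ)
      + inner ℝ (scalarMul (TestFn.smoothMul ha χ).bcf (∫ s in 0..t, qt s)) (H1.toL2 d ψ)
      + inner ℝ (∫ s in 0..t, H1.grad d (q s)) (H1.grad d (H1.mul χ ψ))
      = (∫ s in 0..t, jumpLoad tr (g s).toHNegHalf) (H1.mul χ ψ) := by
  have hgr : MemLp (fun s => H1.grad d (q s)) 2 (timeMeasure T) := memLp_clm (H1.grad d) h.memLp
  have hv := memLp_clm (scalarMul (TestFn.smoothMul ha χ).bcf) h.memLp_deriv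
  have i1 := integral_apply_of_memLp h.memLp_deriv_deriv ht (H1.mul (TestFn.smoothMul hc χ) ψ)
  have i2 := integral_inner_of_memLp hv ht (H1.toL2 d ψ)
  have i2' := clm_intervalIntegral (scalarMul (TestFn.smoothMul ha χ).bcf) h.memLp_deriv ht
  have i3 := integral_inner_of_memLp hgr ht (H1.grad d (H1.mul χ ψ))
  have i4 := integral_apply_of_memLp (memLp_jumpLoad tr hg) ht (H1.mul χ ψ)
  exact add_add_eq_of_eq (integral_add_add_eq (memLp_apply_const h.memLp_deriv_deriv _)
    (memLp_inner_const hv (H1.toL2 d ψ)) (memLp_inner_const hgr (H1.grad d (H1.mul χ ψ)))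
    (h.equation_mul hc ha htr χ ψ) ht) i1 (i2.trans (congrArg (inner ℝ · _) i2')) i3 i4

theorem inner_toL2_smoothMul {f : Space d → ℝ} (hf : ContDiff ℝ ∞ f)
    {w : BoundedContinuousFunction (Space d) ℝ} (hw : ∀ x, w x = f x) (χ : TestFn d) (ψ : H1 d)
    (v : Lp ℝ 2 (volume : Measure (Space d))) :
    inner ℝ v (H1.toL2 d (H1.mul (TestFn.smoothMul hf χ) ψ))
      = inner ℝ (scalarMul w v) (H1.toL2 d (H1.mul χ ψ)) := by
  rw [← inner_scalarMul_right]
  refine congrArg (inner ℝ v) (Lp.ext ?_)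
  filter_upwards [coeFn_toL2_smoothMul hf χ ψ, coeFn_scalarMul w (H1.toL2 d (H1.mul χ ψ))]
    with x l1 l2
  rw [l1, l2, hw, smul_eq_mul]

/-- A weak solution satisfies the integrated equation, in which only `q`, `q'` and the time integral
of `∇q` occur. -/
theorem IsWeakSolution.isIntegratedWave {c a : Space d → ℝ}
    (hT : 0 < T) (hc : ContDiff ℝ ∞ fun x => (c x ^ 2)⁻¹) (ha : ContDiff ℝ ∞ a)
    {w : BoundedContinuousFunction (Space d) ℝ} (hw : ∀ x, w x = (c x ^ 2)⁻¹)
    {tr : H1 d →L[ℝ] HHalf Ω} (htr : ∀ u f, IsTrace Ω u f → f = HHalf.toL2 Ω (tr u))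
    {g : ℝ → HHalf Ω} (hg : MemLp (fun t => (g t).toHNegHalf) 2 (timeMeasure T)) {q : ℝ → H1 d}
    {qt : ℝ → Lp ℝ 2 (volume : Measure (Space d))} {qtt : ℝ → HNegOne d}
    (h : IsWeakSolution c a Ω T g q qt qtt) :
    IsIntegratedWave w ha T q qt fun t => ∫ s in 0..t, jumpLoad tr (g s).toHNegHalf := by
  have hq : Integrable q (timeMeasure T) := h.memLp.integrable (by norm_num)
  have hqt : Integrable qt (timeMeasure T) := h.memLp_deriv.integrable (by norm_num)
  have hgr : MemLp (fun s => H1.grad d (q s)) 2 (timeMeasure T) := memLp_clm (H1.grad d) h.memLp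
  have e1 := ae_eq_primitive_of_vanishesAtZero hT (memLp_clm (H1.toL2 d) h.memLp) h.memLp_deriv
    h.deriv h.initial
  have e2 := ae_eq_primitive_of_vanishesAtZero hT (memLp_clm (dualEmb (H1.toL2 d)) h.memLp_deriv)
    h.memLp_deriv_deriv h.deriv_deriv h.initial_deriv
  refine ⟨hq, hqt, e1, fun χ => ?_⟩
  filter_upwards [e1, e2, ae_mem_Icc] with t h1 h2 ht ψ
  have e3 := h.integral_equation_mul hc ha htr hg ht χ ψ
  have e4 : (∫ s in 0..t, qtt s) (H1.mul (TestFn.smoothMul hc χ) ψ)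
      = inner ℝ (scalarMul w (qt t)) (H1.toL2 d (H1.mul χ ψ)) := by
    rw [← h2]
    exact inner_toL2_smoothMul hc hw χ ψ (qt t)
  exact add_add_eq_of_eq e3 e4 (by rw [h1]) rfl rfl

end Weak

/-! ### Finite speed of propagation and uniqueness -/

section Propagation

variable {d : ℕ}

/-- Vanishing on a set is preserved by limits in `L²`. -/
theorem ae_eq_zero_of_tendsto {X E : Type*} [MeasurableSpace X] [NormedAddCommGroup E]
    {μ : Measure X} {A : Set X} (hA : MeasurableSet A) {ι : Type*} {l : Filter ι} [l.NeBot]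
    {u : ι → Lp E 2 μ} {h : Lp E 2 μ} (hu : Tendsto u l (𝓝 h))
    (hz : ∀ᶠ i in l, ∀ᵐ x ∂μ, x ∈ A → u i x = 0) : ∀ᵐ x ∂μ, x ∈ A → h x = 0 := by
  have h1 : ∀ᶠ i in l, eLpNorm h 2 (μ.restrict A) ≤ edist (u i) h := by
    filter_upwards [hz] with i hi
    rw [edist_comm, Lp.edist_def]
    refine le_trans (le_of_eq (eLpNorm_congr_ae ?_)) (eLpNorm_mono_measure _ Measure.restrict_le_self)
    rw [EventuallyEq, ae_restrict_iff' hA]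
    filter_upwards [hi] with x hx hxA
    rw [Pi.sub_apply, hx hxA, sub_zero]
  have h2 : Tendsto (fun i => edist (u i) h) l (𝓝 0) := tendsto_iff_edist_tendsto_0.1 hu
  have h3 : eLpNorm h 2 (μ.restrict A) = 0 := le_antisymm (ge_of_tendsto h2 h1) zero_le
  rw [eLpNorm_eq_zero_iff ((Lp.aestronglyMeasurable h).restrict) (by norm_num), EventuallyEq,
    ae_restrict_iff' hA] at h3
  exact h3

namespace IsIntegratedWave

variable {w : BoundedContinuousFunction (Space d) ℝ} {a : Space d → ℝ} {ha : ContDiff ℝ ∞ a} {T : ℝ}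
  {q : ℝ → H1 d} {v : ℝ → Lp ℝ 2 (volume : Measure (Space d))} {F : ℝ → HNegOne d}

/-- Finite speed of propagation. Here `ρ` is a lower bound for the distance to the support of the
source. -/
theorem ae_eq_zero_of_lt (h : IsIntegratedWave w ha T q v F) (ha0 : ∀ x, 0 ≤ a x) {κ : ℝ}
    (hκ : 0 < κ) (hw : ∀ x, 0 < w x ∧ 1 ≤ κ ^ 2 * w x) {ρ : Space d → ℝ} (hρ : LipschitzWith 1 ρ)
    (hF : ∀ x₀, ∀ t ∈ Set.Icc 0 T, ∀ χ : TestFn d, (∀ x, ρ x₀ ≤ ‖x - x₀‖ → χ x = 0) →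
      ∀ ψ, F t (H1.mul χ ψ) = 0) {t : ℝ} (ht : t ∈ Set.Icc 0 T) :
    ∀ᵐ x : Space d, κ * t < ρ x → (∫ s in 0..t, v s : Lp ℝ 2 volume) x = 0 := by
  have h1 : ∀ n : ℕ, ∀ᵐ x : Space d, ‖x - TopologicalSpace.denseSeq (Space d) n‖
      < ρ (TopologicalSpace.denseSeq (Space d) n) - κ * t →
        (∫ s in 0..t, v s : Lp ℝ 2 volume) x = 0 := fun n =>
    h.ae_eq_zero_of_ball ha0 hκ hw (hF _) ht
  filter_upwards [ae_all_iff.2 h1] with x hx hlt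
  obtain ⟨n, hn⟩ := (TopologicalSpace.denseRange_denseSeq (Space d)).exists_dist_lt x
    (half_pos (sub_pos.2 hlt))
  refine hx n ?_
  have h2 := (abs_le.1 ((Real.dist_eq _ _).symm.trans_le (hρ.dist_le_mul x
    (TopologicalSpace.denseSeq (Space d) n)))).2
  rw [NNReal.coe_one, one_mul] at h2
  rw [← dist_eq_norm]
  linarith

/-- The closed form of finite speed of propagation, by continuity in time. -/
theorem ae_eq_zero_of_le (h : IsIntegratedWave w ha T q v F) (ha0 : ∀ x, 0 ≤ a x) {κ : ℝ}
    (hκ : 0 < κ) (hw : ∀ x, 0 < w x ∧ 1 ≤ κ ^ 2 * w x) {ρ : Space d → ℝ} (hρ : LipschitzWith 1 ρ)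
    (hF : ∀ x₀, ∀ t ∈ Set.Icc 0 T, ∀ χ : TestFn d, (∀ x, ρ x₀ ≤ ‖x - x₀‖ → χ x = 0) →
      ∀ ψ, F t (H1.mul χ ψ) = 0) {t : ℝ} (ht : t ∈ Set.Icc 0 T) :
    ∀ᵐ x : Space d, κ * t ≤ ρ x → (∫ s in 0..t, v s : Lp ℝ 2 volume) x = 0 := by
  rcases ht.1.eq_or_lt with h0 | h0
  · filter_upwards [Lp.coeFn_zero ℝ 2 (volume : Measure (Space d))] with x hx _
    rw [← h0, intervalIntegral.integral_same, hx, Pi.zero_apply]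
  · have hc : ContinuousOn (fun t => ∫ s in 0..t, v s) (Set.Icc 0 T) :=
      continuousOn_primitive h.integrable_deriv
    have hcl : MeasurableSet {x | κ * t ≤ ρ x} :=
      (isClosed_le continuous_const hρ.continuous).measurableSet
    have hle : 𝓝[Set.Ioo 0 t] t ≤ 𝓝[Set.Icc 0 T] t :=
      nhdsWithin_mono t fun s hs => ⟨hs.1.le, hs.2.le.trans ht.2⟩
    have : (𝓝[Set.Ioo 0 t] t).NeBot := right_nhdsWithin_Ioo_neBot h0
    refine ae_eq_zero_of_tendsto hcl ((hc t ht).mono_left hle) ?_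
    filter_upwards [self_mem_nhdsWithin] with s hs
    filter_upwards [h.ae_eq_zero_of_lt ha0 hκ hw hρ hF (t := s) ⟨hs.1.le, hs.2.le.trans ht.2⟩]
      with x hx hxt
    exact hx ((mul_lt_mul_of_pos_left hs.2 hκ).trans_le hxt)

/-- The solution is determined by its source. -/
theorem ae_eq_of_ae_eq (hT : 0 ≤ T) (h : IsIntegratedWave w ha T q v F) (ha0 : ∀ x, 0 ≤ a x) {κ : ℝ}
    (hκ : 0 < κ) (hw : ∀ x, 0 < w x ∧ 1 ≤ κ ^ 2 * w x) {q₂ : ℝ → H1 d}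
    {v₂ : ℝ → Lp ℝ 2 (volume : Measure (Space d))} (h₂ : IsIntegratedWave w ha T q₂ v₂ F) :
    q =ᵐ[timeMeasure T] q₂ ∧ v =ᵐ[timeMeasure T] v₂ := by
  obtain ⟨h1, h2⟩ := (h.sub h₂).ae_eq_zero hT ha0 hκ hw fun t => sub_self (F t)
  constructor
  · filter_upwards [h1] with t ht using sub_eq_zero.1 ht
  · filter_upwards [h2] with t ht using sub_eq_zero.1 ht

end IsIntegratedWave

variable {Ω : Set (Space d)} {T : ℝ}

theorem integral_jumpLoad_eq_zero {tr : H1 d →L[ℝ] HHalf Ω} {G : ℝ → HNegHalf Ω}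
    (hG : MemLp G 2 (timeMeasure T)) {φ : H1 d} (hφ : tr φ = 0) {t : ℝ} (ht : t ∈ Set.Icc 0 T) :
    (∫ s in 0..t, jumpLoad tr (G s)) φ = 0 := by
  rw [← integral_apply_of_memLp (memLp_jumpLoad tr hG) ht]
  simp_rw [jumpLoad_apply, hφ, map_zero, neg_zero]
  exact intervalIntegral.integral_zero

theorem ae_eq_of_primitive_ae_eq {E : Type*} [NormedAddCommGroup E] [NormedSpace ℝ E]
    [CompleteSpace E] (hT : 0 ≤ T) {u w : ℝ → E} (hu : MemLp u 2 (timeMeasure T))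
    (hw : MemLp w 2 (timeMeasure T))
    (h : (fun t => ∫ s in 0..t, u s) =ᵐ[timeMeasure T] fun t => ∫ s in 0..t, w s) :
    u =ᵐ[timeMeasure T] w := by
  have hu' := hu.integrable (q := 2) (by norm_num)
  have hw' := hw.integrable (q := 2) (by norm_num)
  have := ae_eq_zero_of_primitive_eq_zero hT (hu'.sub hw') (by
    filter_upwards [h, ae_mem_Icc] with t h1 ht
    exact (integral_sub_of_time hu' hw' ht).trans (sub_eq_zero.2 h1))
  filter_upwards [this] with t ht using sub_eq_zero.1 ht

/-- Two weak solutions satisfy the same integrated equation, which determines `q` and `q'`; then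
`q''` is determined as a weak derivative. -/
theorem IsWeakSolution.unique {c a : Space d → ℝ}
    (hT : 0 < T) (hc : ContDiff ℝ ∞ fun x => (c x ^ 2)⁻¹) (ha : ContDiff ℝ ∞ a)
    (ha0 : ∀ x, 0 ≤ a x) {w : BoundedContinuousFunction (Space d) ℝ}
    (hwc : ∀ x, w x = (c x ^ 2)⁻¹) {κ : ℝ}
    (hκ : 0 < κ) (hw : ∀ x, 0 < w x ∧ 1 ≤ κ ^ 2 * w x)
    {tr : H1 d →L[ℝ] HHalf Ω} (htr : ∀ u f, IsTrace Ω u f → f = HHalf.toL2 Ω (tr u))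
    {g : ℝ → HHalf Ω} (hg : MemLp (fun t => (g t).toHNegHalf) 2 (timeMeasure T)) {q p : ℝ → H1 d}
    {qt pt : ℝ → Lp ℝ 2 (volume : Measure (Space d))} {qtt ptt : ℝ → HNegOne d}
    (h : IsWeakSolution c a Ω T g q qt qtt) (h' : IsWeakSolution c a Ω T g p pt ptt) :
    p =ᵐ[timeMeasure T] q ∧ pt =ᵐ[timeMeasure T] qt ∧ ptt =ᵐ[timeMeasure T] qtt := by
  have hI := h.isIntegratedWave hT hc ha hwc htr hg
  have hI' := h'.isIntegratedWave hT hc ha hwc htr hg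
  obtain ⟨h1, h2⟩ := hI'.ae_eq_of_ae_eq hT.le ha0 hκ hw hI
  refine ⟨h1, h2, ae_eq_of_primitive_ae_eq hT.le h'.memLp_deriv_deriv h.memLp_deriv_deriv ?_⟩
  filter_upwards [h2,
    ae_eq_primitive_of_vanishesAtZero hT (memLp_clm (dualEmb (H1.toL2 d)) h.memLp_deriv)
      h.memLp_deriv_deriv h.deriv_deriv h.initial_deriv,
    ae_eq_primitive_of_vanishesAtZero hT (memLp_clm (dualEmb (H1.toL2 d)) h'.memLp_deriv)
      h'.memLp_deriv_deriv h'.deriv_deriv h'.initial_deriv] with t k1 k2 k3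
  exact (k3.symm.trans (congrArg (dualEmb (H1.toL2 d)) k1)).trans k2

/-- Finite speed of propagation for weak solutions. -/
theorem IsWeakSolution.ae_eq_zero_of_le_infDist [SFinite (surfaceMeasure Ω)] {c a : Space d → ℝ}
    (hT : 0 < T) (hc : ContDiff ℝ ∞ fun x => (c x ^ 2)⁻¹) (ha : ContDiff ℝ ∞ a)
    (ha0 : ∀ x, 0 ≤ a x) {w : BoundedContinuousFunction (Space d) ℝ}
    (hwc : ∀ x, w x = (c x ^ 2)⁻¹) {κ : ℝ}
    (hκ : 0 < κ) (hw : ∀ x, 0 < w x ∧ 1 ≤ κ ^ 2 * w x)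
    {tr : H1 d →L[ℝ] HHalf Ω} (htr : ∀ φ : TestFn d,
      HHalf.toL2 Ω (tr (H1.ofTest φ)) =ᵐ[surfaceMeasure Ω] (φ : Space d → ℝ))
    {g : ℝ → HHalf Ω} (hg : MemLp (fun t => (g t).toHNegHalf) 2 (timeMeasure T)) {q : ℝ → H1 d}
    {qt : ℝ → Lp ℝ 2 (volume : Measure (Space d))} {qtt : ℝ → HNegOne d}
    (h : IsWeakSolution c a Ω T g q qt qtt) {u : ℝ → Lp ℝ 2 (volume : Measure (Space d))}
    (hu : IsContinuousRep T (fun t => H1.toL2 d (q t)) u) {t : ℝ} (ht : t ∈ Set.Icc 0 T) :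
    ∀ᵐ x : Space d, κ * t ≤ Metric.infDist x (frontier Ω) → u t x = 0 := by
  have hI := h.isIntegratedWave hT hc ha hwc (fun u f => (isTrace_iff htr u f).1) hg
  have h1 := hI.ae_eq_zero_of_le ha0 hκ hw (Metric.lipschitz_infDist_pt (frontier Ω))
    (fun x₀ s hs χ hχ ψ => integral_jumpLoad_eq_zero hg (trace_mul_eq_zero htr χ
      (fun y hy => hχ y (by
        rw [← dist_eq_norm, dist_comm]; exact Metric.infDist_le_dist_of_mem hy)) ψ) hs) ht
  have h2 : u t = ∫ s in 0..t, qt s :=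
    eqOn_of_ae_eq hT hu.1 (continuousOn_primitive hI.integrable_deriv)
      (hu.2.symm.trans hI.eq_integral) ht
  rwa [h2]

end Propagation

/-! ### Existence -/

section Existence

/-- The abstract damped wave equation with the stiffness operator `S = G* G`. -/
theorem exists_wave_of_form {V H K : Type*} [NormedAddCommGroup V] [InnerProductSpace ℝ V]
    [CompleteSpace V] [NormedAddCommGroup H] [InnerProductSpace ℝ H] [CompleteSpace H]
    [NormedAddCommGroup K] [InnerProductSpace ℝ K] [CompleteSpace K] {T : ℝ} (hT : 0 < T)
    {ι : V →L[ℝ] H} {G : V →L[ℝ] K} {A B : H →L[ℝ] H} {β : ℝ} (hβ : 0 < β)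
    (hV : ∀ u, ‖u‖ ^ 2 = ‖ι u‖ ^ 2 + ‖G u‖ ^ 2) (hA : ∀ h, 0 ≤ inner ℝ (A h) h)
    (hAs : ∀ h h', inner ℝ (A h) h' = inner ℝ h (A h'))
    (hB : ∀ h h', inner ℝ (B h) h' = inner ℝ h (B h')) (hBβ : ∀ h, β * ‖h‖ ^ 2 ≤ inner ℝ (B h) h) :
    ∃ C : ℝ, 0 ≤ C ∧ ∀ f f' : ℝ → StrongDual ℝ V, IsPrimitive T f f' →
      MemLp f' 2 (timeMeasure T) → ∃ (q : ℝ → V) (v : ℝ → H),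
        MemLp q 2 (timeMeasure T) ∧ MemLp v 2 (timeMeasure T) ∧
        (∀ᵐ t ∂(timeMeasure T), ι (q t) = ∫ s in 0..t, v s) ∧
        (∀ᵐ t ∂(timeMeasure T), dualEmb ι (B (v t)) = ∫ s in 0..t,
          (f s - dualEmb ι (A (v s)) - dualEmb G (G (q s)))) ∧
        (∫ t, ‖q t‖ ^ 2 ∂(timeMeasure T)) + (∫ t, ‖v t‖ ^ 2 ∂(timeMeasure T))
          ≤ C * ∫ t, (‖f t‖ ^ 2 + ‖f' t‖ ^ 2) ∂(timeMeasure T) := by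
  obtain ⟨S, hS⟩ : ∃ S, S = (ContinuousLinearMap.adjoint G).comp G := ⟨_, rfl⟩
  have hSi : ∀ u w, inner ℝ (S u) w = inner ℝ (G u) (G w) := fun u w => by
    rw [hS, ContinuousLinearMap.comp_apply, ContinuousLinearMap.adjoint_inner_left]
  have hSG : ∀ u, innerSL ℝ (S u) = dualEmb G (G u) := fun u => by
    ext w
    exact hSi u w
  obtain ⟨C, hC, h⟩ := exists_abstract_wave (S := S) hT hβ
    (fun u w => by rw [hSi, real_inner_comm, ← hSi, real_inner_comm])
    (fun u => by rw [hSi]; exact real_inner_self_nonneg)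
    (fun u => by rw [hSi, real_inner_self_eq_norm_sq]; exact hV u) hA hAs hB hBβ
  refine ⟨C, hC, fun f f' hf hf' => ?_⟩
  obtain ⟨q, v, h1, h2, h3, h4, h5⟩ := h f f' hf hf'
  refine ⟨q, v, h1, h2, h3, ?_, h5⟩
  simp_rw [hSG] at h4
  exact h4

variable {d : ℕ} {Ω : Set (Space d)} {T : ℝ}

theorem inner_scalarMul_comm {E : Type*} [NormedAddCommGroup E] [InnerProductSpace ℝ E]
    (f : BoundedContinuousFunction (Space d) ℝ) (u v : Lp E 2 (volume : Measure (Space d))) :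
    inner ℝ (scalarMul f u) v = inner ℝ u (scalarMul f v) := (inner_scalarMul_right f u v).symm

theorem le_inner_scalarMul {w : BoundedContinuousFunction (Space d) ℝ} {β : ℝ}
    (hβ : ∀ x, β ≤ w x) (u : Lp ℝ 2 (volume : Measure (Space d))) :
    β * ‖u‖ ^ 2 ≤ inner ℝ (scalarMul w u) u := by
  have h1 := L2.integrable_inner (𝕜 := ℝ) (scalarMul w u) u
  have h2 := L2.integrable_inner (𝕜 := ℝ) u u
  rw [← real_inner_self_eq_norm_sq, L2.inner_def, L2.inner_def, ← integral_const_mul]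
  refine integral_mono_ae (h2.const_mul β) h1 ?_
  filter_upwards [coeFn_scalarMul w u] with x hx
  rw [hx, real_inner_smul_left]
  exact mul_le_mul_of_nonneg_right (hβ x) real_inner_self_nonneg

/-- One component of the left-hand side of the definition of the weak gradient, as an inner product.
-/
theorem inner_integral_smul_gradient (u : Lp ℝ 2 (volume : Measure (Space d))) (φ : TestFn d)
    (e : Space d) (h : MemLp (fun x => inner ℝ e (∇ (φ : Space d → ℝ) x)) 2 volume) :
    inner ℝ e (∫ x, u x • ∇ (φ : Space d → ℝ) x) = inner ℝ (h.toLp _) u := by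
  rw [← integral_inner (integrable_smul_gradient u φ.contDiff φ.hasCompactSupport), L2.inner_def]
  refine integral_congr_ae ?_
  filter_upwards [h.coeFn_toLp] with x hx
  rw [hx, real_inner_smul_right]
  rfl

/-- One component of the right-hand side of the definition of the weak gradient, as an inner
product. -/
theorem inner_integral_test_smul (G : Lp (Space d) 2 (volume : Measure (Space d))) (φ : TestFn d)
    (e : Space d) (h : MemLp (fun x => φ x • e) 2 volume) :
    inner ℝ e (∫ x, φ x • G x) = inner ℝ (h.toLp _) G := by
  rw [← integral_inner (integrable_test_smul G φ.contDiff φ.hasCompactSupport), L2.inner_def]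
  refine integral_congr_ae ?_
  filter_upwards [h.coeFn_toLp] with x hx
  rw [hx, real_inner_smul_right, real_inner_smul_left]

/-- `H^1` is an intersection of kernels of continuous functionals on `L² × L²`. -/
theorem isClosed_sobolevOne : IsClosed (sobolevOne d : Set (WithLp 2
    (Lp ℝ 2 (volume : Measure (Space d)) × Lp (Space d) 2 (volume : Measure (Space d))))) := by
  have h1 : ∀ (φ : TestFn d) (e : Space d),
      MemLp (fun x => (inner ℝ e (∇ (φ : Space d → ℝ) x) : ℝ)) 2 volume := fun φ e =>
    (φ.memLp_gradient 2 volume).const_inner e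
  have h2 : ∀ (φ : TestFn d) (e : Space d), MemLp (fun x => φ x • e) 2 (volume : Measure (Space d)) :=
    fun φ e => (ContinuousLinearMap.toSpanSingleton ℝ e).comp_memLp' (φ.memLp 2 volume)
  have h3 : (sobolevOne d : Set (WithLp 2
      (Lp ℝ 2 (volume : Measure (Space d)) × Lp (Space d) 2 (volume : Measure (Space d)))))
      = ⋂ (φ : TestFn d) (e : Space d), {w | (inner ℝ ((h1 φ e).toLp _) w.fst : ℝ)
        = -inner ℝ ((h2 φ e).toLp _) w.snd} := by
    ext w
    simp only [Set.mem_iInter, Set.mem_ofPred_eq]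
    constructor
    · intro hw φ e
      rw [← inner_integral_smul_gradient, ← inner_integral_test_smul,
        hw φ φ.contDiff φ.hasCompactSupport, inner_neg_right]
    · intro hw φ hφ hφ'
      refine ext_inner_left ℝ fun e => ?_
      have := hw ⟨φ, hφ, hφ'⟩ e
      rw [← inner_integral_smul_gradient, ← inner_integral_test_smul, ← inner_neg_right] at this
      exact this
  rw [h3]
  refine isClosed_iInter fun φ => isClosed_iInter fun e => isClosed_eq ?_ ?_
  · exact continuous_const.inner (WithLp.fstL 2 ℝ _ _).continuous
  · exact (continuous_const.inner (WithLp.sndL 2 ℝ _ _).continuous).neg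

theorem completeSpace_H1 : CompleteSpace (H1 d) := isClosed_sobolevOne.completeSpace_coe

/-- The wave equation `w q'' + b q' - Δ q = f` with bounded damping `b` and zero initial data, in
the form integrated once in time, has a solution that is bounded by the load. -/
theorem exists_wave {w b : BoundedContinuousFunction (Space d) ℝ} {β : ℝ} (hT : 0 < T) (hβ : 0 < β)
    (hw : ∀ x, β ≤ w x) (hb : ∀ x, 0 ≤ b x) :
    ∃ C : ℝ, 0 ≤ C ∧ ∀ f f' : ℝ → HNegOne d, IsPrimitive T f f' →
      MemLp f' 2 (timeMeasure T) → ∃ (q : ℝ → H1 d) (v : ℝ → Lp ℝ 2 (volume : Measure (Space d))),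
        MemLp q 2 (timeMeasure T) ∧ MemLp v 2 (timeMeasure T) ∧
        (∀ᵐ t ∂(timeMeasure T), H1.toL2 d (q t) = ∫ s in 0..t, v s) ∧
        (∀ᵐ t ∂(timeMeasure T), dualEmb (H1.toL2 d) (scalarMul w (v t)) = ∫ s in 0..t,
          (f s - dualEmb (H1.toL2 d) (scalarMul b (v s))
            - dualEmb (H1.grad d) (H1.grad d (q s)))) ∧
        (∫ t, ‖q t‖ ^ 2 ∂(timeMeasure T)) + (∫ t, ‖v t‖ ^ 2 ∂(timeMeasure T))
          ≤ C * ∫ t, (‖f t‖ ^ 2 + ‖f' t‖ ^ 2) ∂(timeMeasure T) :=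
  have := completeSpace_H1 (d := d)
  exists_wave_of_form hT hβ H1.norm_sq_eq (inner_scalarMul_self_nonneg hb) (inner_scalarMul_comm b)
    (inner_scalarMul_comm w) (le_inner_scalarMul hw)

end Existence

/-! ### From the variational problem to weak solutions -/

section Construction

theorem memLp_sub_dualEmb {V H K : Type*} [NormedAddCommGroup V] [InnerProductSpace ℝ V]
    [NormedAddCommGroup H] [InnerProductSpace ℝ H] [NormedAddCommGroup K] [InnerProductSpace ℝ K]
    {T : ℝ} (ι : V →L[ℝ] H) (G : V →L[ℝ] K) {f : ℝ → StrongDual ℝ V} {y : ℝ → H} {p : ℝ → K}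
    (hf : MemLp f 2 (timeMeasure T)) (hy : MemLp y 2 (timeMeasure T))
    (hp : MemLp p 2 (timeMeasure T)) :
    MemLp (fun s => f s - dualEmb ι (y s) - dualEmb G (p s)) 2 (timeMeasure T) :=
  (hf.sub (memLp_clm (dualEmb ι) hy)).sub (memLp_clm (dualEmb G) hp)

theorem integral_sub_dualEmb_apply {V H K : Type*} [NormedAddCommGroup V] [InnerProductSpace ℝ V]
    [NormedAddCommGroup H] [InnerProductSpace ℝ H] [CompleteSpace H] [NormedAddCommGroup K]
    [InnerProductSpace ℝ K] [CompleteSpace K] {T : ℝ} (ι : V →L[ℝ] H) (A : H →L[ℝ] H)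
    (G : V →L[ℝ] K) {f : ℝ → StrongDual ℝ V} {v : ℝ → H} {p : ℝ → K}
    (hf : MemLp f 2 (timeMeasure T)) (hv : MemLp v 2 (timeMeasure T))
    (hp : MemLp p 2 (timeMeasure T)) {t : ℝ} (ht : t ∈ Set.Icc 0 T) (φ : V) :
    (∫ s in 0..t, (f s - dualEmb ι (A (v s)) - dualEmb G (p s))) φ
      = (∫ s in 0..t, f s) φ - inner ℝ (A (∫ s in 0..t, v s)) (ι φ)
        - inner ℝ (∫ s in 0..t, p s) (G φ) := by
  have hy := memLp_clm A hv
  have h1 := memLp_clm (dualEmb ι) hy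
  have h2 := memLp_clm (dualEmb G) hp
  have h3 : Integrable (fun s => f s - dualEmb ι (A (v s))) (timeMeasure T) :=
    (hf.sub h1).integrable (by norm_num)
  rw [integral_sub_of_time h3 (h2.integrable (by norm_num)) ht,
    integral_sub_of_time (hf.integrable (by norm_num)) (h1.integrable (by norm_num)) ht,
    clm_intervalIntegral (dualEmb ι) hy ht, clm_intervalIntegral (dualEmb G) hp ht,
    clm_intervalIntegral A hv ht]
  rfl

variable {d : ℕ}

/-- The acceleration functional `f - b q' + Δ q`. -/
def accel (b : BoundedContinuousFunction (Space d) ℝ) (f : HNegOne d) (q : H1 d)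
    (v : Lp ℝ 2 (volume : Measure (Space d))) : HNegOne d :=
  f - dualEmb (H1.toL2 d) (scalarMul b v) - dualEmb (H1.grad d) (H1.grad d q)

theorem accel_apply (b : BoundedContinuousFunction (Space d) ℝ) (f : HNegOne d) (q : H1 d)
    (v : Lp ℝ 2 (volume : Measure (Space d))) (φ : H1 d) :
    accel b f q v φ = f φ - inner ℝ (scalarMul b v) (H1.toL2 d φ)
      - inner ℝ (H1.grad d q) (H1.grad d φ) := rfl

/-- `q`, with `q' = v`, solves `(w q')' = f - b q' + Δ q` with vanishing initial values. -/
structure IsVariationalWave (w b : BoundedContinuousFunction (Space d) ℝ) (T : ℝ)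
    (f : ℝ → HNegOne d) (q : ℝ → H1 d) (v : ℝ → Lp ℝ 2 (volume : Measure (Space d))) : Prop where
  memLp : MemLp q 2 (timeMeasure T)
  memLp_deriv : MemLp v 2 (timeMeasure T)
  eq_integral : ∀ᵐ t ∂(timeMeasure T), H1.toL2 d (q t) = ∫ s in 0..t, v s
  equation : ∀ᵐ t ∂(timeMeasure T),
    dualEmb (H1.toL2 d) (scalarMul w (v t)) = ∫ s in 0..t, accel b (f s) (q s) (v s)

/-- A test function that is `1` on a neighbourhood of the support of `cutoff d n`, because the
former is `1` on the ball of radius `2 (n + 1) + 1` and the latter vanishes outside the ball of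
radius `2 (n + 1)`. -/
def outerCutoff (d n : ℕ) : TestFn d := cutoff d (2 * (n + 1))

theorem cutoff_eq_zero {n : ℕ} {x : Space d} (h : 2 * ((n : ℝ) + 1) ≤ ‖x‖) : cutoff d n x = 0 := by
  refine ContDiffBump.zero_of_le_dist _ ?_
  rw [dist_zero_right, norm_smul, norm_inv, Real.norm_of_nonneg (by positivity)]
  change (2 : ℝ) ≤ _
  rw [le_inv_mul_iff₀ (by positivity), mul_comm]
  exact h

/-- At every point, either the inner cutoff function vanishes together with its gradient, or the
outer one is `1` with vanishing gradient. -/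
theorem cutoff_or (n : ℕ) (x : Space d) :
    (cutoff d n x = 0 ∧ ∇ (cutoff d n : Space d → ℝ) x = 0) ∨
      (outerCutoff d n x = 1 ∧ ∇ (outerCutoff d n : Space d → ℝ) x = 0) := by
  rcases lt_or_ge ‖x‖ (2 * ((n : ℝ) + 1) + 1) with h | h
  · right
    have : (outerCutoff d n : Space d → ℝ) =ᶠ[𝓝 x] fun _ => 1 := by
      filter_upwards [(isOpen_lt continuous_norm continuous_const).mem_nhds h] with y hy
      have hy' : ‖y‖ < 2 * ((n : ℝ) + 1) + 1 := hy
      refine cutoff_eq_one ?_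
      push_cast
      exact hy'.le
    refine ⟨this.eq_of_nhds, ?_⟩
    rw [gradient, this.fderiv_eq, fderiv_const_apply, map_zero]
  · left
    have : (cutoff d n : Space d → ℝ) =ᶠ[𝓝 x] fun _ => 0 := by
      have h' : 2 * ((n : ℝ) + 1) < ‖x‖ := by linarith
      filter_upwards [(isOpen_lt continuous_const continuous_norm).mem_nhds h'] with y hy
      have hy' : 2 * ((n : ℝ) + 1) < ‖y‖ := hy
      exact cutoff_eq_zero hy'.le
    refine ⟨this.eq_of_nhds, ?_⟩
    rw [gradient, this.fderiv_eq, fderiv_const_apply, map_zero]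

/-- For `u` supported where the inner cutoff lives, test functions may be cut off by the outer one.
-/
theorem inner_grad_mul_outerCutoff {n : ℕ} {u : H1 d} (hu : H1.mul (cutoff d n) u = u) (φ : H1 d) :
    inner ℝ (H1.grad d u) (H1.grad d (H1.mul (outerCutoff d n) φ))
      = inner ℝ (H1.grad d u) (H1.grad d φ) := by
  have h0 : ∀ᵐ x : Space d, H1.grad d u x = cutoff d n x • H1.grad d u x
      + H1.toL2 d u x • ∇ (cutoff d n : Space d → ℝ) x := by
    have := H1.coeFn_grad_mul (cutoff d n) u
    rwa [hu] at this
  refine (L2.inner_def _ _).trans (Eq.trans (integral_congr_ae ?_) (L2.inner_def _ _).symm)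
  filter_upwards [h0, H1.coeFn_grad_mul (outerCutoff d n) φ] with x h1 h2
  rcases cutoff_or n x with h | h
  · have h1' : H1.grad d u x = 0 := h1.trans (by rw [h.1, h.2, zero_smul, smul_zero, add_zero])
    exact ((congrArg (inner ℝ · _) h1').trans (inner_zero_left _)).trans
      ((congrArg (inner ℝ · _) h1').trans (inner_zero_left _)).symm
  · exact congrArg (inner ℝ _) (h2.trans (by rw [h.1, h.2, one_smul, smul_zero, add_zero]))

theorem scalarMul_outerCutoff {n : ℕ} {v : Lp ℝ 2 (volume : Measure (Space d))}
    (hv : scalarMul (cutoff d n).bcf v = v) : scalarMul (outerCutoff d n).bcf v = v := by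
  have e : (outerCutoff d n).bcf * (cutoff d n).bcf = (cutoff d n).bcf := by
    ext x
    rw [BoundedContinuousFunction.mul_apply, TestFn.bcf_apply, TestFn.bcf_apply]
    rcases cutoff_or n x with h | h
    · rw [h.1, mul_zero]
    · rw [h.1, one_mul]
  calc scalarMul (outerCutoff d n).bcf v
      = scalarMul (outerCutoff d n).bcf (scalarMul (cutoff d n).bcf v) := by rw [hv]
    _ = v := by rw [← scalarMul_mul, e, hv]

theorem add_add_eq_of_sub_sub {x y z e y' z' : ℝ} (h : x = e - y' - z') (hy : y = y')
    (hz : z = z') : x + y + z = e := by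
  rw [h, hy, hz]
  ring

namespace IsVariationalWave

variable {w b : BoundedContinuousFunction (Space d) ℝ} {T : ℝ} {f : ℝ → HNegOne d}
  {q : ℝ → H1 d} {v : ℝ → Lp ℝ 2 (volume : Measure (Space d))}

theorem memLp_accel (h : IsVariationalWave w b T f q v) (hf : MemLp f 2 (timeMeasure T)) :
    MemLp (fun s => accel b (f s) (q s) (v s)) 2 (timeMeasure T) :=
  memLp_sub_dualEmb (H1.toL2 d) (H1.grad d) hf (memLp_clm (scalarMul b) h.memLp_deriv)
    (memLp_clm (H1.grad d) h.memLp)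

theorem integral_accel_apply (h : IsVariationalWave w b T f q v) (hf : MemLp f 2 (timeMeasure T))
    {t : ℝ} (ht : t ∈ Set.Icc 0 T) (φ : H1 d) :
    (∫ s in 0..t, accel b (f s) (q s) (v s)) φ
      = (∫ s in 0..t, f s) φ - inner ℝ (scalarMul b (∫ s in 0..t, v s)) (H1.toL2 d φ)
        - inner ℝ (∫ s in 0..t, H1.grad d (q s)) (H1.grad d φ) :=
  integral_sub_dualEmb_apply (H1.toL2 d) (scalarMul b) (H1.grad d) hf h.memLp_deriv
    (memLp_clm (H1.grad d) h.memLp) ht φ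

/-- With smooth damping, the variational solution falls under the finite speed results for the
integrated equation. -/
theorem isIntegratedWave (h : IsVariationalWave w b T f q v) (hf : MemLp f 2 (timeMeasure T))
    {a : Space d → ℝ} (ha : ContDiff ℝ ∞ a) (hb : ∀ x, b x = a x) :
    IsIntegratedWave w ha T q v fun t => ∫ s in 0..t, f s := by
  refine ⟨h.memLp.integrable (by norm_num), h.memLp_deriv.integrable (by norm_num), h.eq_integral,
    fun χ => ?_⟩
  filter_upwards [h.eq_integral, h.equation, ae_mem_Icc] with t h1 h2 ht ψ
  have h3 : inner ℝ (scalarMul w (v t)) (H1.toL2 d (H1.mul χ ψ))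
      = (∫ s in 0..t, f s) (H1.mul χ ψ)
        - inner ℝ (scalarMul b (∫ s in 0..t, v s)) (H1.toL2 d (H1.mul χ ψ))
        - inner ℝ (∫ s in 0..t, H1.grad d (q s)) (H1.grad d (H1.mul χ ψ)) :=
    (congrArg (fun z => z (H1.mul χ ψ)) h2).trans (h.integral_accel_apply hf ht _)
  have h4 : inner ℝ (scalarMul (TestFn.smoothMul ha χ).bcf (H1.toL2 d (q t))) (H1.toL2 d ψ)
      = inner ℝ (scalarMul b (∫ s in 0..t, v s)) (H1.toL2 d (H1.mul χ ψ)) := by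
    have e : (TestFn.smoothMul ha χ).bcf = χ.bcf * b := by
      ext x
      rw [TestFn.bcf_apply, TestFn.smoothMul_apply, BoundedContinuousFunction.mul_apply, hb,
        TestFn.bcf_apply, mul_comm]
    rw [e, scalarMul_mul, ← inner_scalarMul_right, h1, H1.toL2_mul]
  exact add_add_eq_of_sub_sub h3 h4 rfl

end IsVariationalWave

end Construction

/-! ### Existence of weak solutions -/

section WeakExistence

theorem memLp_comp {V W : Type*} [NormedAddCommGroup V] [NormedSpace ℝ V] [NormedAddCommGroup W]
    [NormedSpace ℝ W] {T : ℝ} (L : V →L[ℝ] W) {f : ℝ → StrongDual ℝ W}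
    (hf : MemLp f 2 (timeMeasure T)) : MemLp (fun t => (f t).comp L) 2 (timeMeasure T) :=
  memLp_clm ((ContinuousLinearMap.compL ℝ V W ℝ).flip L) hf

theorem integral_comp_of_memLp {V W : Type*} [NormedAddCommGroup V] [NormedSpace ℝ V]
    [NormedAddCommGroup W] [NormedSpace ℝ W] {T : ℝ} (L : V →L[ℝ] W) {f : ℝ → StrongDual ℝ W}
    (hf : MemLp f 2 (timeMeasure T)) {t : ℝ} (ht : t ∈ Set.Icc 0 T) :
    ∫ s in 0..t, (f s).comp L = (∫ s in 0..t, f s).comp L :=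
  clm_intervalIntegral ((ContinuousLinearMap.compL ℝ V W ℝ).flip L) hf ht

theorem isWeakTimeDeriv_of_primitive {E : Type*} [NormedAddCommGroup E] [NormedSpace ℝ E]
    [CompleteSpace E] {T : ℝ} (hT : 0 ≤ T) {u u' : ℝ → E} (hu' : MemLp u' 2 (timeMeasure T))
    (h : u =ᵐ[timeMeasure T] fun t => ∫ s in 0..t, u' s) :
    IsWeakTimeDeriv T u u' ∧ VanishesAtZero T u :=
  have hp := isPrimitive_integral (hu'.integrable (q := 2) (by norm_num))
  ⟨hp.isWeakTimeDeriv hT h, hp.vanishesAtZero h intervalIntegral.integral_same⟩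

variable {d : ℕ} {Ω : Set (Space d)} {T : ℝ}

theorem scalarMul_eq_self {E : Type*} [NormedAddCommGroup E] [NormedSpace ℝ E]
    {f : BoundedContinuousFunction (Space d) ℝ} {u : Lp E 2 (volume : Measure (Space d))}
    (h : ∀ᵐ x : Space d, f x = 1 ∨ u x = 0) : scalarMul f u = u := by
  refine Lp.ext ?_
  filter_upwards [coeFn_scalarMul f u, h] with x h1 h2
  rcases h2 with h2 | h2
  · rw [h1, h2, one_smul]
  · rw [h1, h2, smul_zero]

theorem H1.mul_eq_self {χ : TestFn d} {u : H1 d} (h : scalarMul χ.bcf (H1.toL2 d u) = H1.toL2 d u) :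
    H1.mul χ u = u := H1.toL2_injective h

/-- A wave whose source is supported in a ball stays in a larger ball up to time `T`. -/
theorem IsIntegratedWave.mul_cutoff_eq (hT : 0 ≤ T) {w : BoundedContinuousFunction (Space d) ℝ}
    {a : Space d → ℝ} {ha : ContDiff ℝ ∞ a} {q : ℝ → H1 d}
    {v : ℝ → Lp ℝ 2 (volume : Measure (Space d))} {F : ℝ → HNegOne d}
    (h : IsIntegratedWave w ha T q v F) (hv : MemLp v 2 (timeMeasure T)) (ha0 : ∀ x, 0 ≤ a x) {κ : ℝ}
    (hκ : 0 < κ) (hw : ∀ x, 0 < w x ∧ 1 ≤ κ ^ 2 * w x) {R : ℝ}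
    (hF : ∀ t ∈ Set.Icc 0 T, ∀ χ : TestFn d, (∀ x, ‖x‖ ≤ R → χ x = 0) →
      ∀ ψ, F t (H1.mul χ ψ) = 0) {n : ℕ} (hn : R + κ * T < n + 1) :
    (∀ᵐ t ∂(timeMeasure T), H1.mul (cutoff d n) (q t) = q t) ∧
      ∀ᵐ t ∂(timeMeasure T), scalarMul (cutoff d n).bcf (v t) = v t := by
  have hρ : LipschitzWith 1 fun x : Space d => ‖x‖ - R :=
    LipschitzWith.of_dist_le_mul fun x y => by
      rw [dist_sub_right, NNReal.coe_one, one_mul]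
      exact (lipschitzWith_one_norm.dist_le_mul x y).trans (by simp)
  have h1 : ∀ t ∈ Set.Icc 0 T, scalarMul (cutoff d n).bcf (∫ s in 0..t, v s) = ∫ s in 0..t, v s := by
    intro t ht
    refine scalarMul_eq_self ?_
    filter_upwards [h.ae_eq_zero_of_lt ha0 hκ hw hρ (fun x₀ s hs χ hχ ψ => hF s hs χ (fun x hx =>
      hχ x (by
        have : ‖x₀‖ ≤ ‖x - x₀‖ + ‖x‖ := by
          rw [norm_sub_rev]; simpa using norm_add_le (x₀ - x) x
        linarith)) ψ) ht] with x hx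
    rcases le_or_gt ‖x‖ (n + 1) with hxn | hxn
    · exact Or.inl (cutoff_eq_one hxn)
    · refine Or.inr (hx ?_)
      have := mul_le_mul_of_nonneg_left ht.2 hκ.le
      linarith
  constructor
  · filter_upwards [h.eq_integral, ae_mem_Icc] with t h2 ht
    refine H1.mul_eq_self ?_
    rw [h2, h1 t ht]
  · refine ae_eq_of_primitive_ae_eq hT (memLp_clm (scalarMul (cutoff d n).bcf) hv) hv ?_
    filter_upwards [ae_mem_Icc] with t ht
    rw [clm_intervalIntegral _ hv ht, h1 t ht]

/-- A cut-off that equals `1` on `∂Ω` does not change traces. -/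
theorem trace_mul_eq [SFinite (surfaceMeasure Ω)] {tr : H1 d →L[ℝ] HHalf Ω}
    (htr : ∀ φ : TestFn d,
      HHalf.toL2 Ω (tr (H1.ofTest φ)) =ᵐ[surfaceMeasure Ω] (φ : Space d → ℝ))
    (hm : MeasurableSet (frontier Ω)) {χ : TestFn d} (hχ : ∀ x ∈ frontier Ω, χ x = 1) (u : H1 d) :
    tr (H1.mul χ u) = tr u := by
  refine denseRange_ofTest.induction_on u (p := fun u => tr (H1.mul χ u) = tr u)
    (isClosed_eq (by fun_prop) (by fun_prop)) fun φ => HHalf.toL2_injective (Lp.ext ?_)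
  rw [H1.mul_ofTest]
  refine (htr _).trans (EventuallyEq.trans ?_ (htr φ).symm)
  filter_upwards [ae_restrict_mem hm] with x hx
  rw [TestFn.mul_apply, hχ x hx, one_mul]

/-- The acceleration functional of a compactly supported wave is compactly supported. -/
theorem accel_mul_outerCutoff [SFinite (surfaceMeasure Ω)] {tr : H1 d →L[ℝ] HHalf Ω}
    (htr : ∀ φ : TestFn d,
      HHalf.toL2 Ω (tr (H1.ofTest φ)) =ᵐ[surfaceMeasure Ω] (φ : Space d → ℝ)) {n : ℕ}
    (hχ : ∀ x ∈ frontier Ω, outerCutoff d n x = 1) {b : BoundedContinuousFunction (Space d) ℝ}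
    {G : HNegHalf Ω} {q : H1 d} {v : Lp ℝ 2 (volume : Measure (Space d))}
    (hq : H1.mul (cutoff d n) q = q) (hv : scalarMul (cutoff d n).bcf v = v) (φ : H1 d) :
    accel b (jumpLoad tr G) q v (H1.mul (outerCutoff d n) φ) = accel b (jumpLoad tr G) q v φ := by
  have h1 : inner ℝ (scalarMul b v) (H1.toL2 d (H1.mul (outerCutoff d n) φ))
      = inner ℝ (scalarMul b v) (H1.toL2 d φ) := by
    rw [H1.toL2_mul, inner_scalarMul_right, scalarMul_comm, scalarMul_outerCutoff hv]
  have h2 : jumpLoad tr G (H1.mul (outerCutoff d n) φ) = jumpLoad tr G φ := by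
    rw [jumpLoad_apply, jumpLoad_apply, trace_mul_eq htr isClosed_frontier.measurableSet hχ]
  exact congrArg₂ (· - ·) (congrArg₂ (· - ·) h2 h1) (inner_grad_mul_outerCutoff hq φ)

/-- A functional `W` supported where `χ = 1` is `c⁻²` times the functional `φ ↦ W (c² χ φ)`, even if
multiplication by `c²` is not bounded on `H^1`. -/
theorem isWeightedFunctional_accel {c : Space d → ℝ} (hc0 : ∀ x, c x ≠ 0)
    (hc2 : ContDiff ℝ ∞ fun x => c x ^ 2) {χ : TestFn d} {W : HNegOne d}
    (hW : ∀ φ, W (H1.mul χ φ) = W φ) :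
    IsWeightedFunctional c (W.comp (H1.mul (TestFn.smoothMul hc2 χ))) W := by
  intro φ ψ h
  rw [ContinuousLinearMap.comp_apply, ← hW φ]
  refine congrArg W (H1.toL2_injective (Lp.ext ?_))
  filter_upwards [h, H1.coeFn_toL2_mul χ φ, H1.coeFn_toL2_mul (TestFn.smoothMul hc2 χ) ψ]
    with x h1 h2 h3
  rw [h2, h3, h1, TestFn.smoothMul_apply]
  field_simp [hc0 x]

/-- The damping term of a compactly supported velocity is integrable although `a` may be unbounded.
-/
theorem integrable_mul_mul {a : Space d → ℝ} (ha : ContDiff ℝ ∞ a) (χ : TestFn d)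
    {v : Lp ℝ 2 (volume : Measure (Space d))} (hv : scalarMul χ.bcf v = v)
    (u : Lp ℝ 2 (volume : Measure (Space d))) :
    Integrable (fun x => a x * v x * u x) ∧
      ∫ x, a x * v x * u x = inner ℝ (scalarMul (TestFn.smoothMul ha χ).bcf v) u := by
  have h : (fun x => (inner ℝ (scalarMul (TestFn.smoothMul ha χ).bcf v x) (u x) : ℝ))
      =ᵐ[volume] fun x => a x * v x * u x := by
    have h0 : ∀ᵐ x : Space d, v x = χ x * v x := by
      have := coeFn_scalarMul χ.bcf v
      rwa [hv] at this
    filter_upwards [h0, coeFn_scalarMul (TestFn.smoothMul ha χ).bcf v] with x h1 h2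
    rw [h2, TestFn.bcf_apply, TestFn.smoothMul_apply]
    simp only [RCLike.inner_apply, conj_trivial, smul_eq_mul]
    linear_combination (-(a x * u x)) * h1
  exact ⟨(L2.integrable_inner (𝕜 := ℝ) _ u).congr h,
    (integral_congr_ae h).symm.trans (L2.inner_def _ _).symm⟩

theorem inner_scalarMul_toL2_smoothMul {c : Space d → ℝ} (hc0 : ∀ x, c x ≠ 0)
    (hc2 : ContDiff ℝ ∞ fun x => c x ^ 2) {w : BoundedContinuousFunction (Space d) ℝ}
    (hwc : ∀ x, w x = (c x ^ 2)⁻¹) {χ : TestFn d} {v : Lp ℝ 2 (volume : Measure (Space d))}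
    (hv : scalarMul χ.bcf v = v) (ψ : H1 d) :
    inner ℝ (scalarMul w v) (H1.toL2 d (H1.mul (TestFn.smoothMul hc2 χ) ψ))
      = inner ℝ v (H1.toL2 d ψ) := by
  have e : (TestFn.smoothMul hc2 χ).bcf * w = χ.bcf := by
    ext x
    rw [BoundedContinuousFunction.mul_apply, TestFn.bcf_apply, TestFn.smoothMul_apply, hwc,
      TestFn.bcf_apply]
    field_simp [hc0 x]
  rw [H1.toL2_mul, inner_scalarMul_right, ← scalarMul_mul, e, hv]

/-- If the variational solution with damping `a χ` stays in the region where `χ = 1`, then it is a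
weak solution for the damping `a`. Its second derivative is `c²` times the acceleration functional.
-/
theorem IsVariationalWave.isWeakSolution [SFinite (surfaceMeasure Ω)] (hT : 0 < T)
    {tr : H1 d →L[ℝ] HHalf Ω}
    (htr : ∀ φ : TestFn d,
      HHalf.toL2 Ω (tr (H1.ofTest φ)) =ᵐ[surfaceMeasure Ω] (φ : Space d → ℝ)) {n : ℕ}
    (hχ : ∀ x ∈ frontier Ω, outerCutoff d n x = 1) {c a : Space d → ℝ} (hc0 : ∀ x, c x ≠ 0)
    (hc2 : ContDiff ℝ ∞ fun x => c x ^ 2) (ha : ContDiff ℝ ∞ a)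
    {w : BoundedContinuousFunction (Space d) ℝ} (hwc : ∀ x, w x = (c x ^ 2)⁻¹) {g : ℝ → HHalf Ω}
    {f : ℝ → HNegOne d} (hf : MemLp f 2 (timeMeasure T))
    (hfg : ∀ᵐ t ∂(timeMeasure T), f t = jumpLoad tr (g t).toHNegHalf) {q : ℝ → H1 d}
    {v : ℝ → Lp ℝ 2 (volume : Measure (Space d))}
    (h : IsVariationalWave w (TestFn.smoothMul ha (outerCutoff d n)).bcf T f q v)
    (hq : ∀ᵐ t ∂(timeMeasure T), H1.mul (cutoff d n) (q t) = q t)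
    (hv : ∀ᵐ t ∂(timeMeasure T), scalarMul (cutoff d n).bcf (v t) = v t) :
    IsWeakSolution c a Ω T g q v fun t =>
      (accel (TestFn.smoothMul ha (outerCutoff d n)).bcf (f t) (q t) (v t)).comp
        (H1.mul (TestFn.smoothMul hc2 (outerCutoff d n))) := by
  have hW := h.memLp_accel hf
  have hqtt := memLp_comp (H1.mul (TestFn.smoothMul hc2 (outerCutoff d n))) hW
  have h1 := isWeakTimeDeriv_of_primitive hT.le h.memLp_deriv h.eq_integral
  have h2 := isWeakTimeDeriv_of_primitive (u := fun t => L2.toHNegOne (v t)) hT.le hqtt (by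
    filter_upwards [h.equation, hv, ae_mem_Icc] with t k1 k2 ht
    rw [integral_comp_of_memLp _ hW ht, ← k1]
    ext ψ
    exact (inner_scalarMul_toL2_smoothMul hc0 hc2 hwc (scalarMul_outerCutoff k2) ψ).symm)
  refine ⟨h.memLp, h.memLp_deriv, hqtt, h1.1, h2.1, h1.2, h2.2,
    fun t => accel (TestFn.smoothMul ha (outerCutoff d n)).bcf (f t) (q t) (v t), ?_, fun φ =>
    ⟨HHalf.toL2 Ω (tr φ), (isTrace_iff htr φ _).2 rfl, ?_⟩⟩
  · filter_upwards [hfg, hq, hv] with t k1 k2 k3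
    refine isWeightedFunctional_accel hc0 hc2 fun φ => ?_
    rw [k1]
    exact accel_mul_outerCutoff htr hχ k2 k3 φ
  · filter_upwards [hfg, hv] with t k1 k2
    obtain ⟨k3, k4⟩ := integrable_mul_mul ha (outerCutoff d n) (scalarMul_outerCutoff k2)
      (H1.toL2 d φ)
    refine ⟨k3, ?_⟩
    have k5 : ∫ x, inner ℝ (H1.grad d (q t) x) (H1.grad d φ x)
      = inner ℝ (H1.grad d (q t)) (H1.grad d φ) := (L2.inner_def _ _).symm
    have k6 : ∫ y, HHalf.toL2 Ω (g t) y * HHalf.toL2 Ω (tr φ) y ∂(surfaceMeasure Ω)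
      = (g t).toHNegHalf (tr φ) := (inner_eq_integral_mul _ _).symm
    have k7 : f t φ = -(g t).toHNegHalf (tr φ) := k1 ▸ jumpLoad_apply tr (g t).toHNegHalf φ
    rw [k6]
    exact add_add_eq_of_sub_sub ((accel_apply _ _ _ _ φ).trans
      (congrArg (fun z => z - _ - _) k7)) k4 k5

end WeakExistence

/-! ### Existence with the energy bound -/

section Assembly

theorem exists_norm_negDual_le {V W : Type*} [NormedAddCommGroup V] [NormedSpace ℝ V]
    [NormedAddCommGroup W] [NormedSpace ℝ W] (L : V →L[ℝ] W) :
    ∃ K : ℝ, 0 ≤ K ∧ ∀ G, ‖negDual L G‖ ≤ K * ‖G‖ :=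
  ⟨‖negDual L‖, (negDual L).opNorm_nonneg, (negDual L).le_opNorm⟩

theorem integrable_norm_sq {E : Type*} [NormedAddCommGroup E] {T : ℝ} {u : ℝ → E}
    (hu : MemLp u 2 (timeMeasure T)) : Integrable (fun t => ‖u t‖ ^ 2) (timeMeasure T) :=
  hu.integrable_norm_pow (p := 2) (by norm_num)

theorem integral_sq_add_sq_le {E₁ E₂ F : Type*} [NormedAddCommGroup E₁] [NormedAddCommGroup E₂]
    [NormedAddCommGroup F] {T K : ℝ} {f f' : ℝ → F} {G : ℝ → E₁} {G' : ℝ → E₂}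
    (hG : MemLp G 2 (timeMeasure T)) (hG' : MemLp G' 2 (timeMeasure T))
    (h : ∀ᵐ t ∂(timeMeasure T), ‖f t‖ ≤ K * ‖G t‖) (h' : ∀ t, ‖f' t‖ ≤ K * ‖G' t‖) :
    ∫ t, (‖f t‖ ^ 2 + ‖f' t‖ ^ 2) ∂(timeMeasure T)
      ≤ K ^ 2 * ∫ t, (‖G t‖ ^ 2 + ‖G' t‖ ^ 2) ∂(timeMeasure T) := by
  rw [← integral_const_mul]
  refine integral_mono_of_nonneg (Eventually.of_forall fun t => by positivity)
    (((integrable_norm_sq hG).add (integrable_norm_sq hG')).const_mul _) ?_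
  filter_upwards [h] with t ht
  have h1 := pow_le_pow_left₀ (norm_nonneg _) ht 2
  have h2 := pow_le_pow_left₀ (norm_nonneg _) (h' t) 2
  rw [mul_pow] at h1 h2
  change ‖f t‖ ^ 2 + ‖f' t‖ ^ 2 ≤ K ^ 2 * (‖G t‖ ^ 2 + ‖G' t‖ ^ 2)
  linarith

variable {d : ℕ} {Ω : Set (Space d)} {T : ℝ}

/-- Existence with the bound. The cut-off of `a` is chosen so large that the wave, which travels
with speed at most `κ` from `∂Ω`, does not reach it before time `T`. -/
theorem exists_weakSolution [SFinite (surfaceMeasure Ω)] (hT : 0 < T)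
    (hΩ : Bornology.IsBounded (frontier Ω)) {tr : H1 d →L[ℝ] HHalf Ω}
    (htr : ∀ φ : TestFn d,
      HHalf.toL2 Ω (tr (H1.ofTest φ)) =ᵐ[surfaceMeasure Ω] (φ : Space d → ℝ))
    {c a : Space d → ℝ} (hc0 : ∀ x, c x ≠ 0)
    (hc2 : ContDiff ℝ ∞ fun x => c x ^ 2) (ha : ContDiff ℝ ∞ a) (ha0 : ∀ x, 0 ≤ a x)
    {w : BoundedContinuousFunction (Space d) ℝ} (hwc : ∀ x, w x = (c x ^ 2)⁻¹) {κ : ℝ}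
    (hκ : 0 < κ) (hw : ∀ x, 0 < w x ∧ 1 ≤ κ ^ 2 * w x) :
    ∃ C : ℝ, 0 ≤ C ∧ ∀ (g : ℝ → HHalf Ω) (gt : ℝ → HNegHalf Ω), IsJumpDatum Ω T g gt →
      ∃ (q : ℝ → H1 d) (v : ℝ → Lp ℝ 2 (volume : Measure (Space d))) (qtt : ℝ → HNegOne d),
        IsWeakSolution c a Ω T g q v qtt ∧
        (∫ t, ‖q t‖ ^ 2 ∂(timeMeasure T)) + (∫ t, ‖v t‖ ^ 2 ∂(timeMeasure T))
          ≤ C * ∫ t, (‖(g t).toHNegHalf‖ ^ 2 + ‖gt t‖ ^ 2) ∂(timeMeasure T) := by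
  obtain ⟨R, hR⟩ := hΩ.subset_closedBall 0
  obtain ⟨n, hn⟩ := exists_nat_gt (R + κ * T)
  have hn' : R + κ * T < (n : ℝ) + 1 := by linarith
  have hχ : ∀ x ∈ frontier Ω, outerCutoff d n x = 1 := fun x hx => by
    refine cutoff_eq_one ?_
    have h1 : ‖x‖ ≤ R := mem_closedBall_zero_iff.1 (hR hx)
    have h2 := mul_pos hκ hT
    push_cast
    linarith [(Nat.cast_nonneg n : (0 : ℝ) ≤ n)]
  have hb : ∀ x, 0 ≤ (TestFn.smoothMul ha (outerCutoff d n)).bcf x := fun x =>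
    mul_nonneg (ha0 x) (cutoff_mem_Icc _ x).1
  -- the lower bound of `w` is also the coercivity constant of the mass term
  have hβ : ∀ x, (κ ^ 2)⁻¹ ≤ w x := fun x => by
    rw [inv_le_iff_one_le_mul₀' (by positivity)]
    exact (hw x).2
  obtain ⟨C, hC, hex⟩ := exists_wave hT (inv_pos.2 (pow_pos hκ 2)) hβ hb
  obtain ⟨K, hK, hKL⟩ := exists_norm_negDual_le tr
  refine ⟨C * K ^ 2, by positivity, fun g gt hg => ?_⟩
  -- the load needs values at all times, so `g` is replaced by its continuous representative
  obtain ⟨G, hgG, hG⟩ := exists_isPrimitive hT hg.memLp_toHNegHalf hg.memLp_deriv hg.deriv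
  have hG2 := hG.memLp 2
  have hf := memLp_jumpLoad tr hG2
  obtain ⟨q, v, hq, hv, h1, h2, h3⟩ := hex (fun t => jumpLoad tr (G t)) (fun t => jumpLoad tr (gt t))
    (hG.clm_comp (negDual tr)) (memLp_jumpLoad tr hg.memLp_deriv)
  have hW : IsVariationalWave w (TestFn.smoothMul ha (outerCutoff d n)).bcf T
    (fun t => jumpLoad tr (G t)) q v := ⟨hq, hv, h1, h2⟩
  have hã : ContDiff ℝ ∞ fun x => a x * outerCutoff d n x := ha.mul (outerCutoff d n).contDiff
  obtain ⟨k1, k2⟩ := (hW.isIntegratedWave hf hã fun x => rfl).mul_cutoff_eq hT.le hv hb hκ hw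
    (R := R) (fun t ht χ hχ' ψ => integral_jumpLoad_eq_zero hG2 (trace_mul_eq_zero htr χ
      (fun x hx => hχ' x (mem_closedBall_zero_iff.1 (hR hx))) ψ) ht) hn'
  refine ⟨q, v, _, hW.isWeakSolution hT htr hχ hc0 hc2 ha hwc hf ?_ k1 k2, h3.trans ?_⟩
  · filter_upwards [hgG] with t ht using congrArg (jumpLoad tr) ht.symm
  · have hae : ∀ᵐ t ∂(timeMeasure T), ‖jumpLoad tr (G t)‖ ≤ K * ‖(g t).toHNegHalf‖ := by
      filter_upwards [hgG] with t ht
      rw [ht]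
      exact hKL (G t)
    have hfin := integral_sq_add_sq_le (f := fun t => jumpLoad tr (G t))
      (f' := fun t => jumpLoad tr (gt t)) (G := fun t => (g t).toHNegHalf) (G' := gt)
      hg.memLp_toHNegHalf hg.memLp_deriv hae fun t => hKL (gt t)
    exact (mul_le_mul_of_nonneg_left hfin hC).trans (mul_assoc _ _ _).ge

theorem integral_weight_mul_sq_le {w : BoundedContinuousFunction (Space d) ℝ} {B : ℝ}
    (hB : ∀ x, w x ≤ B) (v : Lp ℝ 2 (volume : Measure (Space d))) :
    ∫ x, w x * v x ^ 2 ≤ B * ‖v‖ ^ 2 := by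
  have h1 : Integrable (fun x => v x ^ 2) := (Lp.memLp v).integrable_sq
  have h2 : ‖v‖ ^ 2 = ∫ x, v x ^ 2 := by
    rw [← real_inner_self_eq_norm_sq, inner_eq_integral_mul]
    exact integral_congr_ae (Eventually.of_forall fun x => by ring)
  have h3 : Integrable (fun x => w x * v x ^ 2) :=
    h1.bdd_mul w.continuous.aestronglyMeasurable (Eventually.of_forall w.norm_coe_le_norm)
  rw [h2, ← integral_const_mul]
  exact integral_mono h3 (h1.const_mul B) fun x => mul_le_mul_of_nonneg_right (hB x) (sq_nonneg _)

theorem integral_energy_le {w : BoundedContinuousFunction (Space d) ℝ} (hw : ∀ x, 0 ≤ w x) {B : ℝ}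
    (hB : ∀ x, w x ≤ B) {q : ℝ → H1 d} {v : ℝ → Lp ℝ 2 (volume : Measure (Space d))}
    (hq : MemLp q 2 (timeMeasure T)) (hv : MemLp v 2 (timeMeasure T)) :
    ∫ t, ((∫ x, w x * v t x ^ 2) + ‖q t‖ ^ 2) ∂(timeMeasure T) ≤
      (B + 1) * ((∫ t, ‖q t‖ ^ 2 ∂(timeMeasure T)) + ∫ t, ‖v t‖ ^ 2 ∂(timeMeasure T)) := by
  have hB0 : 0 ≤ B := (hw 0).trans (hB 0)
  have h1 := integrable_norm_sq hq
  have h2 := integrable_norm_sq hv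
  rw [← integral_add h1 h2, ← integral_const_mul]
  refine integral_mono_of_nonneg (Eventually.of_forall fun t =>
    add_nonneg (integral_nonneg fun x => mul_nonneg (hw x) (sq_nonneg _)) (sq_nonneg _))
    ((h1.add h2).const_mul _) (Eventually.of_forall fun t => ?_)
  change (∫ x, w x * v t x ^ 2) + ‖q t‖ ^ 2 ≤ (B + 1) * (‖q t‖ ^ 2 + ‖v t‖ ^ 2)
  have h3 := integral_weight_mul_sq_le hB (v t)
  have h4 : 0 ≤ B * ‖q t‖ ^ 2 := by positivity
  nlinarith [sq_nonneg ‖v t‖]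

/-- The weight `c⁻²` as a bounded continuous function. -/
theorem exists_weight {c : Space d → ℝ} (hc : Continuous c) {m : ℝ} (hm : 0 < m)
    (hmc : ∀ x, m ≤ c x) : ∃ w : BoundedContinuousFunction (Space d) ℝ,
      (∀ x, w x = (c x ^ 2)⁻¹) ∧ ∀ x, w x ≤ (m ^ 2)⁻¹ := by
  have hb : ∀ x, (c x ^ 2)⁻¹ ≤ (m ^ 2)⁻¹ := fun x =>
    inv_anti₀ (by positivity) (pow_le_pow_left₀ hm.le (hmc x) 2)
  refine ⟨BoundedContinuousFunction.ofNormedAddCommGroup (fun x => (c x ^ 2)⁻¹)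
    ((hc.pow 2).inv₀ fun x => pow_ne_zero 2 (hm.trans_le (hmc x)).ne') (m ^ 2)⁻¹ fun x => ?_,
    fun x => rfl, hb⟩
  rw [Real.norm_of_nonneg (by positivity)]
  exact hb x

end Assembly

end DampedWave

end

theorem theoremE {d : ℕ} (hd : 1 ≤ d)
    (c a : DampedWave.Space d → ℝ)
    (hc : ContDiff ℝ ∞ c) (ha : ContDiff ℝ ∞ a)
    (hc_bounds : ∃ m M : ℝ, 0 < m ∧ ∀ x, m ≤ c x ∧ c x ≤ M)
    (ha_nonneg : ∀ x, 0 ≤ a x)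
    (Ω : Set (DampedWave.Space d)) (hΩ_open : IsOpen Ω) (hΩ_bdd : Bornology.IsBounded Ω)
    (hΩ_lip : DampedWave.HasLipschitzBoundary Ω)
    (T : ℝ) (hT : 0 < T) :
    ∃ C : ℝ, ∀ (g : ℝ → DampedWave.HHalf Ω) (gt : ℝ → DampedWave.HNegHalf Ω),
      DampedWave.IsJumpDatum Ω T g gt →
      ∃ (q : ℝ → DampedWave.H1 d)
        (qt : ℝ → Lp ℝ 2 (volume : Measure (DampedWave.Space d)))
        (qtt : ℝ → DampedWave.HNegOne d),
        -- existence
        DampedWave.IsWeakSolution c a Ω T g q qt qtt ∧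
        -- uniqueness
        (∀ (p : ℝ → DampedWave.H1 d)
          (pt : ℝ → Lp ℝ 2 (volume : Measure (DampedWave.Space d)))
          (ptt : ℝ → DampedWave.HNegOne d),
          DampedWave.IsWeakSolution c a Ω T g p pt ptt →
            p =ᵐ[DampedWave.timeMeasure T] q ∧ pt =ᵐ[DampedWave.timeMeasure T] qt ∧
              ptt =ᵐ[DampedWave.timeMeasure T] qtt) ∧
        -- finite speed of propagation
        (∀ u : ℝ → Lp ℝ 2 (volume : Measure (DampedWave.Space d)),
          DampedWave.IsContinuousRep T (fun t => DampedWave.H1.toL2 d (q t)) u →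
          ∀ t ∈ Set.Icc 0 T, ∀ᵐ x : DampedWave.Space d,
            x ∉ Ω → (⨆ z, c z) * t ≤ Metric.infDist x (frontier Ω) → u t x = 0) ∧
        -- energy estimate
        (∫ t, ((∫ x, (c x ^ 2)⁻¹ * (qt t x) ^ 2) + ‖q t‖ ^ 2) ∂(DampedWave.timeMeasure T)
          ≤ C * ∫ t, (‖(g t).toHNegHalf‖ ^ 2 + ‖gt t‖ ^ 2) ∂(DampedWave.timeMeasure T)) := by
  obtain ⟨m, M, hm, hmM⟩ := hc_bounds
  have hfin := DampedWave.isFiniteMeasure_surfaceMeasure hΩ_bdd hΩ_lip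
  obtain ⟨tr, htr⟩ := DampedWave.exists_trace hΩ_bdd hΩ_lip
  have hpos : ∀ x, 0 < c x := fun x => hm.trans_le (hmM x).1
  have hc0 : ∀ x, c x ≠ 0 := fun x => (hpos x).ne'
  have hc2 : ContDiff ℝ ∞ fun x => c x ^ 2 := hc.pow 2
  have hci : ContDiff ℝ ∞ fun x => (c x ^ 2)⁻¹ := hc2.inv fun x => pow_ne_zero 2 (hc0 x)
  obtain ⟨w, hwc, hwm⟩ := DampedWave.exists_weight hc.continuous hm fun x => (hmM x).1
  have hle : ∀ x, c x ≤ ⨆ z, c z := le_ciSup ⟨M, by rintro _ ⟨x, rfl⟩; exact (hmM x).2⟩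
  have hκ : 0 < ⨆ z, c z := (hpos 0).trans_le (hle 0)
  -- cones of slope `sup c` are at least as wide as the characteristic ones
  have hw : ∀ x, 0 < w x ∧ 1 ≤ (⨆ z, c z) ^ 2 * w x := fun x => by
    have h2 := pow_le_pow_left₀ (hpos x).le (hle x) 2
    have h3 : 0 < c x ^ 2 := pow_pos (hpos x) 2
    rw [hwc, ← div_eq_mul_inv, one_le_div h3]
    exact ⟨inv_pos.2 h3, h2⟩
  obtain ⟨C, hC, hex⟩ := DampedWave.exists_weakSolution hT
    (hΩ_bdd.closure.subset frontier_subset_closure) htr hc0 hc2 ha ha_nonneg hwc hκ hw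
  refine ⟨((m ^ 2)⁻¹ + 1) * C, fun g gt hg => ?_⟩
  obtain ⟨q, qt, qtt, hsol, hest⟩ := hex g gt hg
  refine ⟨q, qt, qtt, hsol, fun p pt ptt hp => ?_, fun u hu t ht => ?_, ?_⟩
  · exact hsol.unique hT hci ha ha_nonneg hwc hκ hw (fun u f => (DampedWave.isTrace_iff htr u f).1)
      hg.memLp_toHNegHalf hp
  · filter_upwards [hsol.ae_eq_zero_of_le_infDist hT hci ha ha_nonneg hwc hκ hw htr
      hg.memLp_toHNegHalf hu ht] with x hx _ using hx
  · have h1 := DampedWave.integral_energy_le (fun x => (hw x).1.le) hwm hsol.memLp hsol.memLp_deriv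
    simp_rw [hwc] at h1
    refine h1.trans ?_
    rw [mul_assoc]
    exact mul_le_mul_of_nonneg_left hest (by positivity)
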